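/- Let $S^1=\mathbb R/\mathbb Z$, let $\mathbb D=\{(y,z)\in\mathbb R^2: y^2+z^2\le 1\}$ and let $M=S^1\times\mathbb D$ be the solid torus, with Lebesgue measure. Let $(f_\alpha)_{0<\alpha<1}$ be a family of intermittent circle maps $f_\alpha:S^1\to S^1$, meaning that one of the following holds. (i) There is $d\ge 2$ such that, for every $\alpha\in(0,1)$, $f_\alpha$ has a lift to $\mathbb R$, again written $f_\alpha$, with $f_\alpha(x+1)=f_\alpha(x)+d$ and (s1) $f_\alpha(0)=0$ and $f_\alpha'(0)=1$; (s2) $f_\alpha'>1$ on $S^1\setminus\{0\}$; (s3) $f_\alpha$ is $C^2$ on $S^1\setminus\{0\}$ and $C^{-1}|x|^\alpha\le x f_\alpha''(x)\le C|x|^\alpha$ for $0<|x|<\varepsilon$, where $C\ge1$ and $\varepsilon>0$ can be chosen uniformly for $\alpha$ in each compact subinterval of $(0,1)$; and for $k=0,1,2$ the map $(\alpha,x)\mapsto \partial_x^k f_\alpha(x)$ is continuous on $(0,1)\times(\mathbb R\setminus\mathbb Z)$. (ii) For every $\alpha\in(0,1)$, $f_\alpha$ is the explicit map of degree two with $f_\alpha(x)=x(1+2^\alpha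 x^\alpha)$ for $0\le x<\tfrac12$ and $f_\alpha(x)=x-2^\alpha(1-x)^{\alpha+1}$ for $\tfrac12\le x\le 1$ (modulo $1$). Let $F_\alpha:M\to M$ be the solenoid skew product $$F_\alpha(x,y,z)=\Bigl(f_\alpha(x),\ \tfrac12\cos(2\pi x)+\tfrac15 y,\ \tfrac12\sin(2\pi x)+\tfrac15 z\Bigr).$$ Then for every $\alpha\in(0,1)$ the map $f_\alpha$ has a unique absolutely continuous invariant probability measure $\mu_\alpha$, and $F_\alpha$ has a unique SRB measure $\eta_\alpha$ (an invariant Borel probability measure $\eta$ such that the set of points $p\in M$ with $\frac1n\sum_{j<n}\phi(F_\alpha^j(p))\to\int\phi\,d\eta$ for all continuous $\phi:M\to\mathbb R$ has positive Lebesgue measure). Moreover $\eta_\alpha$ is the unique $F_\alpha$-invariant Borel probability measure that projects to $\mu_\alpha$ under $M\to S^1$. The family is statistically stable: whenever $\alpha_n\to\alpha_0$ with all $\alpha_n$ and $\alpha_0$ in $(0,1)$, $$\lim_{n\to\infty}\int_M\phi\,d\eta_{\alpha_n}=\int_M\phi\,d\eta_{\alpha_0}\qquad\text{for every continuous }\phi:M\to\mathbb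 R.$$ -/

import Mathlib

open MeasureTheory Filter Topology Set

noncomputable section

/-- The circle `S¹ = ℝ/ℤ`; its `volume` is normalised Lebesgue measure. -/
abbrev S1 : Type := UnitAddCircle

/-- The representative in `[0,1)` of a point of the circle. -/
def rep (x : S1) : ℝ := (AddCircle.equivIco (1 : ℝ) 0 x : ℝ)

/-- The circle map `x mod 1 ↦ F x mod 1`, for `x ∈ [0,1)`. -/
def circleMapOf (F : ℝ → ℝ) (x : S1) : S1 := ((F (rep x) : ℝ) : S1)

/-- The real numbers that are not integers, i.e. the points over `S¹ \ {0}`. -/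
def nonIntegers : Set ℝ := (range ((↑) : ℤ → ℝ))ᶜ

/-- `F α`, `0 < α < 1`, are the lifts to `ℝ` of a family of intermittent circle maps of degree `d`,
depending continuously on `α`. -/
structure IsIntermittentLiftFamily (d : ℕ) (F : ℝ → ℝ → ℝ) : Prop where
  /-- degree `d` -/
  map_add_one : ∀ α ∈ Ioo (0 : ℝ) 1, ∀ x, F α (x + 1) = F α x + d
  /-- `f_α(0) = 0` -/
  map_zero : ∀ α ∈ Ioo (0 : ℝ) 1, F α 0 = 0
  /-- `f_α'(0) = 1` -/
  hasDerivAt_zero : ∀ α ∈ Ioo (0 : ℝ) 1, HasDerivAt (F α) 1 0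
  /-- `f_α' > 1` on `S¹ \ {0}` -/
  one_lt_deriv : ∀ α ∈ Ioo (0 : ℝ) 1, ∀ x ∈ nonIntegers, 1 < deriv (F α) x
  /-- `f_α` is `C²` on `S¹ \ {0}` -/
  contDiffOn : ∀ α ∈ Ioo (0 : ℝ) 1, ContDiffOn ℝ 2 (F α) nonIntegers
  /-- `x f_α''(x) ≈ |x|^α` near `0`, with constants that are locally uniform in `α` -/
  neutral : ∀ a b : ℝ, 0 < a → b < 1 → ∃ C : ℝ, 1 ≤ C ∧ ∃ ε : ℝ, 0 < ε ∧
    ∀ α ∈ Icc a b, ∀ x : ℝ, 0 < |x| → |x| < ε →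
      C⁻¹ * |x| ^ α ≤ x * iteratedDeriv 2 (F α) x ∧
        x * iteratedDeriv 2 (F α) x ≤ C * |x| ^ α
  /-- `α ↦ f_α` is continuous for the `C²` topology on compact subsets of `S¹ \ {0}` -/
  continuous_param : ∀ k : ℕ, k ≤ 2 →
    ContinuousOn (fun p : ℝ × ℝ => iteratedDeriv k (F p.1) p.2) (Ioo (0 : ℝ) 1 ×ˢ nonIntegers)

/-- A family `f α`, `0 < α < 1`, of intermittent circle maps of degree `d`. -/
def IsIntermittentFamily (d : ℕ) (f : ℝ → S1 → S1) : Prop :=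
  ∃ F : ℝ → ℝ → ℝ, IsIntermittentLiftFamily d F ∧ ∀ α ∈ Ioo (0 : ℝ) 1, f α = circleMapOf (F α)

/-- The explicit intermittent circle map of degree two. -/
def explicitMap (α : ℝ) : S1 → S1 :=
  circleMapOf fun x =>
    if x < 1 / 2 then x * (1 + 2 ^ α * x ^ α) else x - 2 ^ α * (1 - x) ^ (α + 1)

/-- The closed unit disk. -/
abbrev Disk : Type := {p : ℝ × ℝ // p.1 ^ 2 + p.2 ^ 2 ≤ 1}

/-- The solid torus `S¹ × 𝔻`. -/
abbrev SolidTorus : Type := S1 × Disk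

/-- Lebesgue measure on the solid torus. -/
def lebesgueTorus : Measure SolidTorus :=
  (volume : Measure S1).prod ((volume : Measure (ℝ × ℝ)).comap Subtype.val)

theorem fiber_mem (t : ℝ) (p : Disk) :
    (1 / 2 * Real.cos t + 1 / 5 * p.1.1) ^ 2 + (1 / 2 * Real.sin t + 1 / 5 * p.1.2) ^ 2 ≤ 1 := by
  have h1 := Real.sin_sq_add_cos_sq t
  have h2 := p.2
  nlinarith [sq_nonneg (Real.cos t - p.1.1), sq_nonneg (Real.sin t - p.1.2)]

/-- The solenoid skew product over the circle map `f`. -/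
def solenoidMap (f : S1 → S1) (p : SolidTorus) : SolidTorus :=
  (f p.1,
    ⟨(1 / 2 * Real.cos (2 * Real.pi * rep p.1) + 1 / 5 * p.2.1.1,
      1 / 2 * Real.sin (2 * Real.pi * rep p.1) + 1 / 5 * p.2.1.2), fiber_mem _ _⟩)

/-- `μ` is an absolutely continuous invariant probability measure of the circle map `f`. -/
def IsACIP (f : S1 → S1) (μ : ProbabilityMeasure S1) : Prop :=
  MeasurePreserving f (μ : Measure S1) (μ : Measure S1) ∧
    (μ : Measure S1) ≪ (volume : Measure S1)

/-- The basin of `η`: the points whose time averages converge to the integral against `η`, for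
every continuous observable. -/
def basin (T : SolidTorus → SolidTorus) (η : ProbabilityMeasure SolidTorus) : Set SolidTorus :=
  {p | ∀ φ : SolidTorus → ℝ, Continuous φ →
    Tendsto (fun n : ℕ => (∑ j ∈ Finset.range n, φ (T^[j] p)) / (n : ℝ)) atTop
      (𝓝 (∫ q, φ q ∂(η : Measure SolidTorus)))}

/-- `η` is an SRB (physical) measure of `T`: an invariant Borel probability measure whose basin has
positive Lebesgue measure. -/
def IsSRB (T : SolidTorus → SolidTorus) (η : ProbabilityMeasure SolidTorus) : Prop :=
  MeasurePreserving T (η : Measure SolidTorus) (η : Measure SolidTorus) ∧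
    0 < lebesgueTorus (basin T η)

end

set_option linter.unusedSectionVars false

/-! The fibres of the torus are contracted by the factor 1/5, so after k steps an observable is, up
to ε, a function of the base point alone. Hence an invariant measure of the skew product is
determined by its projection, every invariant measure of the circle map lifts by Krylov–Bogoliubov,
and all points over a generic base point are generic. This reduces the theorem to three facts about
the circle maps (`solenoid_statistical_stability`): ergodicity with respect to Lebesgue measure, an
absolutely continuous invariant probability measure lying below a finite measure `ν ≪ volume` that
is the same for all parameters near α₀, and uniform convergence of the maps. Stability is then soft:
a weak limit of the measures η at αₙ is invariant for the limit map, its projection lies below ν and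
so is the absolutely continuous invariant measure, and uniqueness of the lift identifies the limit.
Convergence of densities is never needed.

Domination and ergodicity rest on one distortion estimate. Let D(x) = log x − log(1 − x) + M x
(`distortionScale`). On the i-th branch the oscillation of log F' is at most K times the increment
of D(F − i) − D. This is a coboundary, so it telescopes along orbits: the derivatives of inverse
branches of all iterates, and the images of the constant density under all powers of the transfer
operator, satisfy the same bound K·ΔD. Since D is infinite only at the neutral fixed point, this is
bounded distortion on compact subintervals of (0, 1), and no induced map is needed. The estimate
holds near 0 because x F' − F is at least of order x^(1+α), so that F'/F − 1/x dominates F''. It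
holds in the middle because M (F' − 1) can be made large.

For a density of mass one, distortion bounds the values in the middle. Near the fixed point, x^(−β)
with α ≤ β < 1 satisfies x^(−β) + c ≤ F(x)^(−β) F'(x), and the gain c absorbs the contribution of
the other branches. So the class `IsAdmissibleDensity` is preserved by the transfer operator, and
Cesàro averages of Lebesgue measure accumulate at the required measure. Taking for β the right end
of a parameter interval makes the bound locally uniform in α.

Ergodicity is a Lebesgue density argument (`IsNeutralExpanding.isLebesgueErgodic`): almost every
orbit returns to the middle with arbitrarily large accumulated derivative, and the corresponding
inverse branches carry a fixed proportion of an invariant set into short intervals around the point.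
Both kinds of families enter through the quantitative hypotheses `IsIntermittentLift`. -/

noncomputable section

/-! ### Weak limits of measures: domination, invariance, Krylov–Bogoliubov -/

section WeakLimits

variable {X : Type*} [MetricSpace X] [CompactSpace X] [MeasurableSpace X] [BorelSpace X]

/-- Domination by a fixed outer regular measure passes to weak limits. -/
theorem MeasureTheory.ProbabilityMeasure.toMeasure_le_of_tendsto {ι : Type*} {L : Filter ι} [L.NeBot]
    {μs : ι → ProbabilityMeasure X} {μ : ProbabilityMeasure X} (h : Tendsto μs L (𝓝 μ))
    {ν : Measure X} [ν.OuterRegular] (hle : ∀ᶠ i in L, (μs i : Measure X) ≤ ν) :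
    (μ : Measure X) ≤ ν := by
  -- The portmanteau inequality gives the bound on open sets; outer regularity of ν extends it to
  -- all sets.
  have hopen : ∀ U : Set X, IsOpen U → (μ : Measure X) U ≤ ν U := fun U hU => by
    refine (ProbabilityMeasure.le_liminf_measure_open_of_tendsto h hU).trans ?_
    refine (liminf_le_liminf (v := fun _ => ν U) (hle.mono fun i hi => hi U)).trans ?_
    simp
  refine Measure.le_iff.2 fun s _ => ?_
  rw [Set.measure_eq_iInf_isOpen s ν]
  exact le_iInf₂ fun U hsU => le_iInf fun hU => (measure_mono hsU).trans (hopen U hU)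

theorem MeasureTheory.integrable_of_continuous {φ : X → ℝ} (hφ : Continuous φ) (μ : Measure X)
    [IsFiniteMeasure μ] : Integrable φ μ :=
  (BoundedContinuousFunction.mkOfCompact ⟨φ, hφ⟩).integrable μ

theorem MeasureTheory.ProbabilityMeasure.tendsto_integral {ι : Type*} {L : Filter ι}
    {μs : ι → ProbabilityMeasure X} {μ : ProbabilityMeasure X} (h : Tendsto μs L (𝓝 μ))
    {φ : X → ℝ} (hφ : Continuous φ) :
    Tendsto (fun i => ∫ x, φ x ∂(μs i : Measure X)) L (𝓝 (∫ x, φ x ∂(μ : Measure X))) :=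
  ProbabilityMeasure.tendsto_iff_forall_integral_tendsto.1 h
    (BoundedContinuousFunction.mkOfCompact ⟨φ, hφ⟩)

theorem MeasureTheory.measure_ext_of_integral_continuous {μ ν : Measure X} [IsFiniteMeasure μ]
    [IsFiniteMeasure ν] (h : ∀ φ : X → ℝ, Continuous φ → ∫ x, φ x ∂μ = ∫ x, φ x ∂ν) : μ = ν :=
  ext_of_forall_integral_eq_of_IsFiniteMeasure fun φ => h φ φ.continuous

theorem MeasureTheory.measurePreserving_of_integral_comp {T : X → X} (hT : Continuous T)
    {μ : Measure X} [IsFiniteMeasure μ]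
    (h : ∀ φ : X → ℝ, Continuous φ → ∫ x, φ (T x) ∂μ = ∫ x, φ x ∂μ) : MeasurePreserving T μ μ := by
  refine ⟨hT.measurable, measure_ext_of_integral_continuous fun φ hφ => ?_⟩
  rw [integral_map hT.aemeasurable hφ.aestronglyMeasurable, h φ hφ]

theorem MeasureTheory.MeasurePreserving.integral_comp_continuous {Y : Type*} [TopologicalSpace Y]
    [MeasurableSpace Y] [BorelSpace Y] {T : X → Y} {μ : Measure X} {ν : Measure Y}
    (h : MeasurePreserving T μ ν) {φ : Y → ℝ} (hφ : Continuous φ) [SecondCountableTopology Y] :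
    ∫ x, φ (T x) ∂μ = ∫ y, φ y ∂ν := by
  rw [← h.map_eq, integral_map h.measurable.aemeasurable hφ.aestronglyMeasurable]

/-- A weak limit of measures invariant under maps that converge uniformly is invariant. -/
theorem MeasureTheory.measurePreserving_of_tendsto {ι : Type*} {L : Filter ι} [L.NeBot]
    {T : X → X} (hT : Continuous T) {Ts : ι → X → X} (hTs : ∀ i, Continuous (Ts i))
    (hunif : TendstoUniformly Ts T L)
    {μs : ι → ProbabilityMeasure X} {μ : ProbabilityMeasure X} (h : Tendsto μs L (𝓝 μ))
    (hinv : ∀ i, MeasurePreserving (Ts i) (μs i : Measure X) (μs i : Measure X)) :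
    MeasurePreserving T (μ : Measure X) (μ : Measure X) := by
  refine measurePreserving_of_integral_comp hT fun φ hφ => ?_
  have h1 := ProbabilityMeasure.tendsto_integral h (hφ.comp hT)
  have h2 := ProbabilityMeasure.tendsto_integral h hφ
  have huc : UniformContinuous φ := CompactSpace.uniformContinuous_of_continuous hφ
  have hcomp : TendstoUniformly (fun i => φ ∘ Ts i) (φ ∘ T) L := huc.comp_tendstoUniformly hunif
  have h3 : Tendsto (fun i => ∫ x, φ (T x) ∂(μs i : Measure X) - ∫ x, φ x ∂(μs i : Measure X)) L
      (𝓝 0) := by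
    rw [Metric.tendsto_nhds]
    intro ε hε
    filter_upwards [Metric.tendstoUniformly_iff.1 hcomp (ε / 2) (half_pos hε)] with i hi
    -- Invariance under `Ts i` turns the integral of φ into that of φ ∘ Ts i, which is uniformly
    -- close to φ ∘ T.
    rw [← (hinv i).integral_comp_continuous hφ, dist_zero_right,
      ← integral_sub (f := fun x => φ (T x)) (g := fun x => φ (Ts i x))
        (integrable_of_continuous (hφ.comp hT) _)
        (integrable_of_continuous (hφ.comp (hTs i)) _)]
    refine lt_of_le_of_lt (norm_integral_le_of_norm_le_const (C := ε / 2)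
      (Eventually.of_forall fun x => ?_)) ?_
    · exact (hi x).le
    · simp [hε]
  exact sub_eq_zero.1 (tendsto_nhds_unique (h1.sub h2) h3)

/-- The Cesàro average of the first `n + 1` images of `m`. -/
def cesaro (T : X → X) (m : Measure X) (n : ℕ) : Measure X :=
  ((n + 1 : ℕ) : ENNReal)⁻¹ • ∑ k ∈ Finset.range (n + 1), m.map T^[k]

theorem isProbabilityMeasure_cesaro {T : X → X} (hT : Continuous T) (m : Measure X)
    [IsProbabilityMeasure m] (n : ℕ) : IsProbabilityMeasure (cesaro T m n) := by
  constructor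
  have : ∀ k, (m.map T^[k]) univ = 1 := fun k => by
    rw [Measure.map_apply (hT.iterate k).measurable MeasurableSet.univ]
    simp
  simp only [cesaro, Measure.smul_apply, Measure.coe_finsetSum, Finset.sum_apply, this,
    Finset.sum_const, Finset.card_range, smul_eq_mul, nsmul_eq_mul, mul_one]
  exact ENNReal.inv_mul_cancel (by simp) (ENNReal.natCast_ne_top _)

theorem integral_cesaro {T : X → X} (hT : Continuous T) (m : Measure X)
    [IsProbabilityMeasure m] (n : ℕ) {φ : X → ℝ} (hφ : Continuous φ) :
    ∫ x, φ x ∂(cesaro T m n) =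
      (∑ k ∈ Finset.range (n + 1), ∫ x, φ (T^[k] x) ∂m) / ((n : ℝ) + 1) := by
  have hk : ∀ k, IsProbabilityMeasure (m.map T^[k]) := fun k =>
    Measure.isProbabilityMeasure_map (hT.iterate k).aemeasurable
  rw [cesaro, integral_smul_measure,
    integral_finsetSum_measure fun k _ => integrable_of_continuous hφ _]
  rw [Finset.sum_congr rfl fun k _ =>
    integral_map (hT.iterate k).aemeasurable hφ.aestronglyMeasurable]
  have : (((n + 1 : ℕ) : ENNReal)⁻¹).toReal = ((n : ℝ) + 1)⁻¹ := by
    rw [ENNReal.toReal_inv, ENNReal.toReal_natCast]; push_cast; rfl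
  rw [this, smul_eq_mul, div_eq_inv_mul]

theorem cesaro_le {T : X → X} {m ν : Measure X} (h : ∀ k, m.map T^[k] ≤ ν) (n : ℕ) :
    cesaro T m n ≤ ν := by
  refine Measure.le_iff.2 fun s _ => ?_
  simp only [cesaro, Measure.smul_apply, Measure.coe_finsetSum, Finset.sum_apply, smul_eq_mul]
  calc _ ≤ ((n + 1 : ℕ) : ENNReal)⁻¹ * ∑ k ∈ Finset.range (n + 1), ν s := by
        gcongr with k; exact h k
    _ = ν s := by
        rw [Finset.sum_const, Finset.card_range, nsmul_eq_mul, ← mul_assoc,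
          ENNReal.inv_mul_cancel (by simp) (ENNReal.natCast_ne_top _), one_mul]

/-- **Krylov–Bogoliubov**: the Cesàro averages accumulate at an invariant measure. -/
theorem exists_invariant_of_cesaro {T : X → X} (hT : Continuous T) (m : ProbabilityMeasure X) :
    ∃ η : ProbabilityMeasure X, MeasurePreserving T (η : Measure X) (η : Measure X) ∧
      ∃ (L : Ultrafilter ℕ) (c : ℕ → ProbabilityMeasure X),
        (∀ n, (c n : Measure X) = cesaro T (m : Measure X) n) ∧ Tendsto c L (𝓝 η) := by
  let c : ℕ → ProbabilityMeasure X := fun n =>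
    ⟨cesaro T (m : Measure X) n, isProbabilityMeasure_cesaro hT _ n⟩
  obtain ⟨η, -, hη⟩ := isCompact_univ.ultrafilter_le_nhds' ((hyperfilter ℕ).map c)
    (Ultrafilter.mem_coe.1 univ_mem)
  have hlim : Tendsto c (hyperfilter ℕ) (𝓝 η) := hη
  refine ⟨η, ?_, hyperfilter ℕ, c, fun n => rfl, hlim⟩
  refine measurePreserving_of_integral_comp hT fun φ hφ => ?_
  have h1 := ProbabilityMeasure.tendsto_integral hlim (hφ.comp hT)
  have h2 := ProbabilityMeasure.tendsto_integral hlim hφ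
  obtain ⟨C, hC⟩ : ∃ C, ∀ x, ‖φ x‖ ≤ C :=
    ⟨_, (BoundedContinuousFunction.mkOfCompact ⟨φ, hφ⟩).norm_coe_le_norm⟩
  have hb : ∀ k, |∫ x, φ (T^[k] x) ∂(m : Measure X)| ≤ C := fun k => by
    have := norm_integral_le_of_norm_le_const (μ := (m : Measure X))
      (Eventually.of_forall fun x => hC (T^[k] x))
    simpa using this
  -- The sums telescope: only the first and the last term survive, which gives the bound 2C/(n + 1).
  have h3 : Tendsto (fun n => ∫ x, φ (T x) ∂(c n : Measure X) - ∫ x, φ x ∂(c n : Measure X))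
      atTop (𝓝 0) := by
    have hz : Tendsto (fun n : ℕ => 2 * C / ((n : ℝ) + 1)) atTop (𝓝 0) := by
      simpa using (tendsto_one_div_add_atTop_nhds_zero_nat (𝕜 := ℝ) |>.const_mul (2 * C)).congr
        fun n : ℕ => mul_one_div (2 * C) ((n : ℝ) + 1)
    refine squeeze_zero_norm (fun n => ?_) hz
    have e1 : ∫ x, φ (T x) ∂(c n : Measure X) = _ := integral_cesaro hT (m : Measure X) n (hφ.comp hT)
    have e2 : ∫ x, φ x ∂(c n : Measure X) = _ := integral_cesaro hT (m : Measure X) n hφ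
    have e3 : ∀ k x, φ (T (T^[k] x)) = φ (T^[k + 1] x) := fun k x => by
      rw [Function.iterate_succ_apply']
    rw [e1, e2, ← sub_div, ← Finset.sum_sub_distrib]
    simp only [e3]
    rw [Finset.sum_range_sub (fun k => ∫ x, φ (T^[k] x) ∂(m : Measure X)), norm_div]
    have : ‖(n : ℝ) + 1‖ = n + 1 := by rw [Real.norm_of_nonneg]; positivity
    rw [this]
    gcongr
    rw [two_mul]
    exact (norm_sub_le _ _).trans (add_le_add (hb _) (hb _))
  exact sub_eq_zero.1 (tendsto_nhds_unique (h1.sub h2) (h3.mono_left Nat.hyperfilter_le_atTop))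

end WeakLimits

/-! ### Birkhoff's theorem for bounded observables -/

section Birkhoff

variable {X : Type*} [MeasurableSpace X]

/-- The maximum of the first `n + 1` Birkhoff sums of `ψ`. -/
def birkhoffMax (f : X → X) (ψ : X → ℝ) : ℕ → X → ℝ
  | 0, _ => 0
  | n + 1, x => max 0 (ψ x + birkhoffMax f ψ n (f x))

theorem birkhoffMax_nonneg (f : X → X) (ψ : X → ℝ) (n : ℕ) (x : X) : 0 ≤ birkhoffMax f ψ n x := by
  cases n with
  | zero => exact le_rfl
  | succ n => exact le_max_left _ _

theorem birkhoffMax_le_succ (f : X → X) (ψ : X → ℝ) (n : ℕ) (x : X) :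
    birkhoffMax f ψ n x ≤ birkhoffMax f ψ (n + 1) x := by
  induction n generalizing x with
  | zero => exact birkhoffMax_nonneg _ _ _ _
  | succ n ih => exact max_le_max le_rfl (add_le_add le_rfl (ih (f x)))

theorem birkhoffMax_mono (f : X → X) (ψ : X → ℝ) (x : X) :
    Monotone fun n => birkhoffMax f ψ n x :=
  monotone_nat_of_le_succ fun n => birkhoffMax_le_succ f ψ n x

theorem birkhoffSum_le_birkhoffMax (f : X → X) (ψ : X → ℝ) (n : ℕ) (x : X) :
    birkhoffSum f ψ n x ≤ birkhoffMax f ψ n x := by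
  induction n generalizing x with
  | zero => simp [birkhoffMax]
  | succ n ih =>
    rw [birkhoffSum_succ']
    exact (add_le_add le_rfl (ih (f x))).trans (le_max_right _ _)

theorem measurable_birkhoffMax {f : X → X} (hf : Measurable f) {ψ : X → ℝ} (hψ : Measurable ψ)
    (n : ℕ) : Measurable (birkhoffMax f ψ n) := by
  induction n with
  | zero => exact measurable_const
  | succ n ih => exact measurable_const.max (hψ.add (ih.comp hf))

theorem birkhoffMax_le_mul (f : X → X) {ψ : X → ℝ} {C : ℝ} (hC : ∀ x, |ψ x| ≤ C) (n : ℕ) (x : X) :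
    birkhoffMax f ψ n x ≤ n * C := by
  have hC0 : 0 ≤ C := (abs_nonneg _).trans (hC x)
  induction n generalizing x with
  | zero => simp [birkhoffMax]
  | succ n ih =>
    refine max_le (by positivity) ?_
    push_cast
    linarith [ih (f x), le_abs_self (ψ x), hC x]

variable {μ : Measure X} [IsProbabilityMeasure μ] {f : X → X}

/-- Write M_n for the maxima. The set where they are unbounded is invariant because ψ is bounded. If
it had full measure, then M_(n+1) − M_n ∘ f would equal ψ there for all large n, and dominated
convergence with invariance of μ would give ∫ ψ = lim ∫ (M_(n+1) − M_n) ≥ 0. Ergodicity leaves only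
the null case. -/
theorem ae_bddAbove_birkhoffMax (hf : MeasurePreserving f μ μ)
    (herg : ∀ A, MeasurableSet A → f ⁻¹' A = A → μ A = 0 ∨ μ Aᶜ = 0)
    {ψ : X → ℝ} (hψ : Measurable ψ) {C : ℝ} (hC : ∀ x, |ψ x| ≤ C) (hneg : ∫ x, ψ x ∂μ < 0) :
    ∀ᵐ x ∂μ, ∃ B : ℕ, ∀ n, birkhoffMax f ψ n x ≤ B := by
  set A : Set X := {x | ∀ B : ℕ, ∃ n, (B : ℝ) < birkhoffMax f ψ n x} with hA
  have hmeas : MeasurableSet A := by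
    have : A = ⋂ B : ℕ, ⋃ n, {x | (B : ℝ) < birkhoffMax f ψ n x} := by ext; simp [hA]
    rw [this]
    exact MeasurableSet.iInter fun B => MeasurableSet.iUnion fun n =>
      measurableSet_lt measurable_const (measurable_birkhoffMax hf.measurable hψ n)
  have hC0 : ∀ x : X, 0 ≤ C := fun x => (abs_nonneg _).trans (hC x)
  have hinv : f ⁻¹' A = A := by
    ext x
    obtain ⟨k, hk⟩ := exists_nat_ge C
    simp only [mem_preimage, hA, mem_ofPred_eq]
    constructor
    · intro h B
      obtain ⟨n, hn⟩ := h (B + k)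
      refine ⟨n + 1, lt_of_lt_of_le ?_ (le_max_right _ _)⟩
      push_cast at hn
      linarith [neg_abs_le (ψ x), hC x]
    · intro h B
      obtain ⟨n, hn⟩ := h (B + k)
      have hpos : (0 : ℝ) ≤ ((B + k : ℕ) : ℝ) := Nat.cast_nonneg _
      cases n with
      | zero => exact absurd hn (not_lt.2 (by simpa [birkhoffMax] using hpos))
      | succ n =>
        refine ⟨n, ?_⟩
        rcases lt_max_iff.1 (show _ < max 0 (ψ x + birkhoffMax f ψ n (f x)) from hn) with h' | h'
        · exact absurd h' (not_lt.2 hpos)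
        · push_cast at h'
          linarith [le_abs_self (ψ x), hC x]
  rcases herg A hmeas hinv with h0 | h1
  · have : ∀ᵐ x ∂μ, x ∉ A := measure_eq_zero_iff_ae_notMem.1 h0
    filter_upwards [this] with x hx
    simpa [hA] using hx
  · exfalso
    have hAae : ∀ᵐ x ∂μ, x ∈ A := by
      filter_upwards [measure_eq_zero_iff_ae_notMem.1 h1] with x hx using by simpa using hx
    have hint : ∀ n, Integrable (birkhoffMax f ψ n) μ := fun n =>
      Integrable.of_bound (measurable_birkhoffMax hf.measurable hψ n).aestronglyMeasurable (n * C)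
        (Eventually.of_forall fun x => by
          rw [Real.norm_of_nonneg (birkhoffMax_nonneg _ _ _ _)]; exact birkhoffMax_le_mul f hC n x)
    have hlim : Tendsto (fun n => ∫ x, (birkhoffMax f ψ (n + 1) x - birkhoffMax f ψ n (f x)) ∂μ)
        atTop (𝓝 (∫ x, ψ x ∂μ)) := by
      refine tendsto_integral_of_dominated_convergence (fun _ => C) (fun n => ?_)
        (integrable_const C) (fun n => Eventually.of_forall fun x => ?_) ?_
      · exact ((measurable_birkhoffMax hf.measurable hψ _).sub
          ((measurable_birkhoffMax hf.measurable hψ n).comp hf.measurable)).aestronglyMeasurable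
      · have h2 := birkhoffMax_nonneg f ψ n (f x)
        have h3 := abs_le.1 (hC x)
        rw [Real.norm_eq_abs, abs_le]
        simp only [birkhoffMax]
        rcases max_cases 0 (ψ x + birkhoffMax f ψ n (f x)) with ⟨h, _⟩ | ⟨h, _⟩ <;> rw [h] <;>
          constructor <;> linarith [hC0 x]
      · filter_upwards [hAae] with x hx
        have hx' : f x ∈ A := by rw [← hinv] at hx; exact hx
        obtain ⟨k, hk⟩ := exists_nat_ge C
        obtain ⟨n, hn⟩ := hx' k
        refine tendsto_const_nhds.congr' ?_
        filter_upwards [eventually_ge_atTop n] with m hm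
        have h2 : (k : ℝ) < birkhoffMax f ψ m (f x) := hn.trans_le (birkhoffMax_mono f ψ (f x) hm)
        have h3 := abs_le.1 (hC x)
        simp only [birkhoffMax]
        rw [max_eq_right (by linarith)]
        ring
    refine absurd (ge_of_tendsto' hlim fun n => ?_) (not_le.2 hneg)
    have hcomp : Integrable (fun x => birkhoffMax f ψ n (f x)) μ :=
      hf.integrable_comp_of_integrable (hint n)
    have hch : ∫ x, birkhoffMax f ψ n (f x) ∂μ = ∫ x, birkhoffMax f ψ n x ∂μ := by
      conv_rhs => rw [← hf.map_eq]
      rw [integral_map hf.measurable.aemeasurable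
        (measurable_birkhoffMax hf.measurable hψ n).aestronglyMeasurable]
    rw [integral_sub (hint _) hcomp, hch, sub_nonneg]
    exact integral_mono (hint _) (hint _) fun x => birkhoffMax_le_succ f ψ n x

/-- The observable ψ − c with c = ∫ ψ + ε/2 has negative mean, so its sums have a finite bound B
along almost every orbit. The remaining ε/2 absorbs B/n. -/
theorem ae_eventually_birkhoffSum_le (hf : MeasurePreserving f μ μ)
    (herg : ∀ A, MeasurableSet A → f ⁻¹' A = A → μ A = 0 ∨ μ Aᶜ = 0)
    {ψ : X → ℝ} (hψ : Measurable ψ) {C : ℝ} (hC : ∀ x, |ψ x| ≤ C) {ε : ℝ} (hε : 0 < ε) :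
    ∀ᵐ x ∂μ, ∀ᶠ n : ℕ in atTop, birkhoffSum f ψ n x / n ≤ ∫ x, ψ x ∂μ + ε := by
  set c := ∫ x, ψ x ∂μ + ε / 2 with hc
  have hψi : Integrable ψ μ := Integrable.of_bound hψ.aestronglyMeasurable C
    (Eventually.of_forall hC)
  have hint : ∫ x, (ψ x - c) ∂μ < 0 := by
    rw [integral_sub hψi (integrable_const c)]
    simp [hc, hε]
  have hsum : ∀ n x, birkhoffSum f (fun x => ψ x - c) n x = birkhoffSum f ψ n x - n * c := by
    intro n x
    simp [birkhoffSum, Finset.sum_sub_distrib]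
  filter_upwards [ae_bddAbove_birkhoffMax hf herg (hψ.sub_const c) (C := C + |c|)
    (fun x => (abs_sub _ _).trans (add_le_add (hC x) le_rfl)) hint] with x ⟨B, hB⟩
  have h2 : Tendsto (fun n : ℕ => (B : ℝ) / n) atTop (𝓝 0) := tendsto_const_div_atTop_nhds_zero_nat _
  filter_upwards [h2.eventually (ge_mem_nhds (half_pos hε)), eventually_gt_atTop 0] with n hn hn0
  have h3 := (birkhoffSum_le_birkhoffMax f (fun x => ψ x - c) n x).trans (hB n)
  rw [hsum] at h3
  have hn' : (0 : ℝ) < n := by exact_mod_cast hn0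
  rw [div_le_iff₀ hn'] at hn ⊢
  have : ∫ x, ψ x ∂μ + ε = c + ε / 2 := by rw [hc]; ring
  rw [this]
  nlinarith

/-- **Birkhoff's theorem** for an ergodic map and a bounded observable. -/
theorem ae_tendsto_birkhoffSum_div (hf : MeasurePreserving f μ μ)
    (herg : ∀ A, MeasurableSet A → f ⁻¹' A = A → μ A = 0 ∨ μ Aᶜ = 0)
    {ψ : X → ℝ} (hψ : Measurable ψ) {C : ℝ} (hC : ∀ x, |ψ x| ≤ C) :
    ∀ᵐ x ∂μ, Tendsto (fun n : ℕ => birkhoffSum f ψ n x / n) atTop (𝓝 (∫ x, ψ x ∂μ)) := by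
  have hpos : ∀ m : ℕ, (0 : ℝ) < 1 / ((m : ℝ) + 1) := fun m => Nat.one_div_pos_of_nat
  have h1 := ae_all_iff.2 fun m : ℕ => ae_eventually_birkhoffSum_le hf herg hψ hC (hpos m)
  have h2 := ae_all_iff.2 fun m : ℕ => ae_eventually_birkhoffSum_le hf herg hψ.neg (C := C)
    (fun x => by simpa using hC x) (hpos m)
  filter_upwards [h1, h2] with x hx1 hx2
  rw [Metric.tendsto_atTop']
  intro ε hε
  obtain ⟨m, hm⟩ := exists_nat_one_div_lt hε
  obtain ⟨N, hN⟩ := eventually_atTop.1 ((hx1 m).and (hx2 m))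
  refine ⟨N, fun n hn => ?_⟩
  obtain ⟨h3, h4⟩ := hN n hn.le
  have h5 : birkhoffSum f (-ψ) n x = -birkhoffSum f ψ n x := by simp [birkhoffSum]
  have h6 : ∫ x, (-ψ) x ∂μ = -∫ x, ψ x ∂μ := by simp [integral_neg]
  rw [h5, h6, neg_div] at h4
  rw [Real.dist_eq, abs_lt]
  constructor <;> linarith

end Birkhoff

/-! ### Generic points of Lebesgue-ergodic circle maps -/

/-- `f` is ergodic with respect to Lebesgue measure (which need not be invariant). -/
def IsLebesgueErgodic (f : S1 → S1) : Prop :=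
  ∀ A : Set S1, MeasurableSet A → f ⁻¹' A = A → volume A = 0 ∨ volume Aᶜ = 0

theorem tendsto_birkhoffSum_iterate_sub {X : Type*} (T : X → X) {φ : X → ℝ} {C : ℝ}
    (hC : ∀ x, |φ x| ≤ C) (x : X) (k : ℕ) :
    Tendsto (fun n : ℕ => birkhoffSum T φ n (T^[k] x) / n - birkhoffSum T φ n x / n) atTop (𝓝 0) := by
  induction k with
  | zero => simp
  | succ k ih =>
    have h1 : Tendsto (fun n : ℕ => birkhoffSum T φ n (T (T^[k] x)) / n
        - birkhoffSum T φ n (T^[k] x) / n) atTop (𝓝 0) := by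
      refine squeeze_zero_norm (fun n => ?_) (tendsto_const_div_atTop_nhds_zero_nat (2 * C))
      rw [← sub_div, birkhoffSum_apply_sub_birkhoffSum, norm_div, Real.norm_natCast]
      gcongr
      rw [two_mul]
      exact (norm_sub_le _ _).trans (add_le_add (hC _) (hC _))
    have h2 := h1.add ih
    simp only [sub_add_sub_cancel, add_zero] at h2
    simpa only [Function.iterate_succ_apply'] using h2

theorem probabilityMeasure_ext_of_integral_continuous {X : Type*} [MetricSpace X]
    [MeasurableSpace X] [BorelSpace X] {μ ν : ProbabilityMeasure X}
    (h : ∀ φ : X → ℝ, Continuous φ → ∫ x, φ x ∂(μ : Measure X) = ∫ x, φ x ∂(ν : Measure X)) :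
    μ = ν := by
  have h' : (μ : Measure X) = ν :=
    ext_of_forall_integral_eq_of_IsFiniteMeasure fun φ => h φ φ.continuous
  exact Subtype.ext h'

theorem exists_abs_le_of_continuous {X : Type*} [TopologicalSpace X] [CompactSpace X] {φ : X → ℝ}
    (hφ : Continuous φ) : ∃ C, ∀ x, |φ x| ≤ C :=
  ⟨_, (BoundedContinuousFunction.mkOfCompact ⟨φ, hφ⟩).norm_coe_le_norm⟩

section Circle

variable {f : S1 → S1}

/-- The convergence set is invariant and has full μ-measure. It is Lebesgue null or conull, and null
is impossible because μ ≪ Lebesgue. Thus genericity holds Lebesgue almost everywhere although the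
density of μ is not known to be positive. -/
theorem ae_tendsto_birkhoffSum_of_continuous (hf : Continuous f) (herg : IsLebesgueErgodic f)
    {μ : ProbabilityMeasure S1} (hμ : IsACIP f μ) {ψ : S1 → ℝ} (hψ : Continuous ψ) :
    ∀ᵐ x : S1, Tendsto (fun n : ℕ => birkhoffSum f ψ n x / n) atTop
      (𝓝 (∫ y, ψ y ∂(μ : Measure S1))) := by
  obtain ⟨C, hC⟩ := exists_abs_le_of_continuous hψ
  set A : Set S1 := {x | Tendsto (fun n : ℕ => birkhoffSum f ψ n x / n) atTop
      (𝓝 (∫ y, ψ y ∂(μ : Measure S1)))} with hA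
  have hmeas : MeasurableSet A := by
    refine measurableSet_tendsto _ fun n => ?_
    refine Measurable.div_const (Finset.measurable_sum _ fun k _ => ?_) _
    exact (hψ.comp (hf.iterate k)).measurable
  have hinv : f ⁻¹' A = A := by
    ext x
    have h := tendsto_birkhoffSum_iterate_sub f hC x 1
    simp only [Function.iterate_one] at h
    simp only [hA, mem_preimage, mem_ofPred_eq]
    constructor
    · intro h1
      simpa using h1.sub h
    · intro h1
      simpa using h1.add h
  have hae := ae_tendsto_birkhoffSum_div hμ.1
    (fun B hB hB' => (herg B hB hB').imp (fun h => hμ.2 h) fun h => hμ.2 h) hψ.measurable hC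
  rcases herg A hmeas hinv with h | h
  · exfalso
    have h0 : (μ : Measure S1) A = 0 := hμ.2 h
    have h1 : (μ : Measure S1) Aᶜ = 0 := hae
    have h2 := measure_union_le (μ := (μ : Measure S1)) A Aᶜ
    rw [h0, h1, union_compl_self, measure_univ] at h2
    simp at h2
  · exact h

/-- For a Lebesgue-ergodic map, Lebesgue-almost every point is generic for the absolutely
continuous invariant probability measure. -/
theorem ae_generic (hf : Continuous f) (herg : IsLebesgueErgodic f)
    {μ : ProbabilityMeasure S1} (hμ : IsACIP f μ) :
    ∀ᵐ x : S1, ∀ ψ : S1 → ℝ, Continuous ψ →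
      Tendsto (fun n : ℕ => birkhoffSum f ψ n x / n) atTop (𝓝 (∫ y, ψ y ∂(μ : Measure S1))) := by
  -- Separability of C(S¹) reduces the claim to countably many observables, and a uniform ε/3
  -- argument recovers the others.
  have h := ae_all_iff.2 fun k : ℕ => ae_tendsto_birkhoffSum_of_continuous hf herg hμ
    (TopologicalSpace.denseSeq C(S1, ℝ) k).continuous
  filter_upwards [h] with x hx ψ hψ
  rw [Metric.tendsto_atTop']
  intro ε hε
  obtain ⟨k, hk⟩ := (TopologicalSpace.denseRange_denseSeq C(S1, ℝ)).exists_dist_lt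
    (⟨ψ, hψ⟩ : C(S1, ℝ)) (by positivity : (0 : ℝ) < ε / 3)
  set χ := TopologicalSpace.denseSeq C(S1, ℝ) k with hχ
  have hclose : ∀ y, |ψ y - χ y| ≤ ε / 3 := fun y =>
    (ContinuousMap.dist_apply_le_dist (f := (⟨ψ, hψ⟩ : C(S1, ℝ))) (g := χ) y).trans hk.le
  obtain ⟨N, hN⟩ := Metric.tendsto_atTop'.1 (hx k) (ε / 3) (by positivity)
  refine ⟨N, fun n hn => ?_⟩
  have h1 := hN n hn
  have hn0 : (0 : ℝ) < n := by exact_mod_cast (Nat.zero_le N).trans_lt hn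
  have h2 : |birkhoffSum f ψ n x / n - birkhoffSum f χ n x / n| ≤ ε / 3 := by
    rw [← sub_div, abs_div, abs_of_pos hn0, div_le_iff₀ hn0]
    simp only [birkhoffSum, ← Finset.sum_sub_distrib]
    refine (Finset.abs_sum_le_sum_abs _ _).trans
      ((Finset.sum_le_sum fun j _ => hclose _).trans_eq ?_)
    simp [mul_comm]
  have h3 : |∫ y, ψ y ∂(μ : Measure S1) - ∫ y, χ y ∂(μ : Measure S1)| ≤ ε / 3 := by
    rw [← integral_sub (integrable_of_continuous hψ _) (integrable_of_continuous χ.continuous _)]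
    refine (norm_integral_le_of_norm_le_const (C := ε / 3)
      (Eventually.of_forall fun y => (Real.norm_eq_abs _).trans_le (hclose y))).trans ?_
    simp
  rw [Real.dist_eq] at h1 ⊢
  rw [abs_lt] at h1 ⊢
  rw [abs_le] at h2 h3
  constructor <;> linarith

/-- Almost every point is generic for both measures, and one common generic point identifies them.
-/
theorem IsACIP.unique (hf : Continuous f) (herg : IsLebesgueErgodic f)
    {μ μ' : ProbabilityMeasure S1} (hμ : IsACIP f μ) (hμ' : IsACIP f μ') : μ = μ' := by
  obtain ⟨x, h1, h2⟩ := ((ae_generic hf herg hμ).and (ae_generic hf herg hμ')).exists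
  exact probabilityMeasure_ext_of_integral_continuous fun φ hφ =>
    tendsto_nhds_unique (h1 φ hφ) (h2 φ hφ)

end Circle

/-! ### Skew products: lifts of invariant measures, basins and stability -/

section Solenoid

variable {f : S1 → S1}

theorem continuous_comp_rep {g : ℝ → ℝ} (hg : Continuous g) (h01 : g 0 = g 1) :
    Continuous fun x : S1 => g (rep x) :=
  AddCircle.liftIco_zero_continuous h01 hg.continuousOn

theorem continuous_solenoidMap (hf : Continuous f) : Continuous (solenoidMap f) := by
  have h1 : Continuous fun x : S1 => Real.cos (2 * Real.pi * rep x) :=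
    continuous_comp_rep (g := fun t => Real.cos (2 * Real.pi * t)) (by fun_prop) (by simp)
  have h2 : Continuous fun x : S1 => Real.sin (2 * Real.pi * rep x) :=
    continuous_comp_rep (g := fun t => Real.sin (2 * Real.pi * t)) (by fun_prop) (by simp)
  refine (hf.comp continuous_fst).prodMk (Continuous.subtype_mk (Continuous.prodMk ?_ ?_) _)
  · exact ((h1.comp continuous_fst).const_mul _).add (by fun_prop)
  · exact ((h2.comp continuous_fst).const_mul _).add (by fun_prop)

theorem solenoidMap_iterate_fst (n : ℕ) (p : SolidTorus) :
    ((solenoidMap f)^[n] p).1 = f^[n] p.1 := by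
  induction n generalizing p with
  | zero => rfl
  | succ n ih => rw [Function.iterate_succ_apply, ih, Function.iterate_succ_apply]; rfl

theorem dist_solenoidMap_le {p q : SolidTorus} (h : p.1 = q.1) :
    dist (solenoidMap f p) (solenoidMap f q) ≤ 1 / 5 * dist p q := by
  obtain ⟨x, ⟨⟨y, z⟩, hp⟩⟩ := p
  obtain ⟨x', ⟨⟨y', z'⟩, hq⟩⟩ := q
  obtain rfl : x = x' := h
  have key : ∀ c u v : ℝ, |c + 1 / 5 * u - (c + 1 / 5 * v)| = 1 / 5 * |u - v| := fun c u v => by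
    rw [show c + 1 / 5 * u - (c + 1 / 5 * v) = 1 / 5 * (u - v) by ring, abs_mul]
    norm_num
  simp only [solenoidMap, Prod.dist_eq, Subtype.dist_eq, dist_self, Real.dist_eq, key]
  rw [max_eq_right (le_max_of_le_left (by positivity)),
    max_eq_right (le_max_of_le_left (abs_nonneg _)), mul_max_of_nonneg _ _ (by norm_num)]

theorem dist_solenoidMap_iterate_le {p q : SolidTorus} (h : p.1 = q.1) (n : ℕ) :
    dist ((solenoidMap f)^[n] p) ((solenoidMap f)^[n] q) ≤ (1 / 5) ^ n * dist p q := by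
  induction n with
  | zero => simp
  | succ n ih =>
    rw [Function.iterate_succ_apply', Function.iterate_succ_apply', pow_succ']
    refine (dist_solenoidMap_le ?_).trans ?_
    · rw [solenoidMap_iterate_fst, solenoidMap_iterate_fst, h]
    · rw [mul_assoc]; gcongr

instance : CompactSpace Disk := by
  refine (isCompact_iff_compactSpace (s := {p : ℝ × ℝ | p.1 ^ 2 + p.2 ^ 2 ≤ 1})).1
    (Metric.isCompact_of_isClosed_isBounded ?_ ?_)
  · exact isClosed_le (by fun_prop) continuous_const
  · refine (Metric.isBounded_closedBall (x := (0 : ℝ × ℝ)) (r := 1)).subset fun p hp => ?_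
    have hp' : p.1 ^ 2 + p.2 ^ 2 ≤ 1 := hp
    rw [mem_closedBall_zero_iff, Prod.norm_def, max_le_iff, Real.norm_eq_abs, Real.norm_eq_abs]
    exact ⟨abs_le_one_iff_mul_self_le_one.2 (by nlinarith [sq_nonneg p.2]),
      abs_le_one_iff_mul_self_le_one.2 (by nlinarith [sq_nonneg p.1])⟩

/-- The values of an observable on long forward orbits depend little on the fibre coordinate. -/
theorem exists_iterate_close {φ : SolidTorus → ℝ} (hφ : Continuous φ) {ε : ℝ} (hε : 0 < ε) :
    ∃ k : ℕ, ∀ p q : SolidTorus, p.1 = q.1 →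
      |φ ((solenoidMap f)^[k] p) - φ ((solenoidMap f)^[k] q)| ≤ ε := by
  obtain ⟨δ, hδ, h⟩ := Metric.uniformContinuous_iff.1
    (CompactSpace.uniformContinuous_of_continuous hφ) ε hε
  have hD : ∀ p q : SolidTorus, dist p q ≤ Metric.diam (univ : Set SolidTorus) := fun p q =>
    Metric.dist_le_diam_of_mem isCompact_univ.isBounded (mem_univ p) (mem_univ q)
  have hlim : Tendsto (fun n : ℕ => (1 / 5 : ℝ) ^ n * Metric.diam (univ : Set SolidTorus)) atTop
      (𝓝 0) := by
    simpa using (tendsto_pow_atTop_nhds_zero_of_lt_one (by norm_num : (0 : ℝ) ≤ 1 / 5)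
      (by norm_num)).mul_const (Metric.diam (univ : Set SolidTorus))
  obtain ⟨k, hk⟩ := (hlim.eventually (gt_mem_nhds hδ)).exists
  refine ⟨k, fun p q hpq => (h ?_).le⟩
  refine ((dist_solenoidMap_iterate_le hpq k).trans ?_).trans_lt hk
  gcongr
  exact hD p q

/-- The zero section of the solid torus. -/
def zeroSection (x : S1) : SolidTorus := (x, ⟨(0, 0), by norm_num⟩)

theorem continuous_zeroSection : Continuous zeroSection := by
  unfold zeroSection; fun_prop

theorem abs_integral_sub_le {X : Type*} [MeasurableSpace X] {μ : Measure X}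
    [IsProbabilityMeasure μ] {φ ψ : X → ℝ} (hφ : Integrable φ μ) (hψ : Integrable ψ μ) {ε : ℝ}
    (h : ∀ x, |φ x - ψ x| ≤ ε) : |∫ x, φ x ∂μ - ∫ x, ψ x ∂μ| ≤ ε := by
  rw [← integral_sub hφ hψ]
  refine (norm_integral_le_of_norm_le_const (C := ε) (Eventually.of_forall fun x => (Real.norm_eq_abs _).trans_le (h x))).trans ?_
  simp

/-- Integrals against an invariant measure are determined by its projection, up to `ε`. -/
theorem abs_integral_sub_integral_zeroSection_le (hf : Continuous f)
    {η : ProbabilityMeasure SolidTorus} {μ : Measure S1}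
    (hη : MeasurePreserving (solenoidMap f) (η : Measure SolidTorus) (η : Measure SolidTorus))
    (hμ : (η : Measure SolidTorus).map Prod.fst = μ)
    {φ : SolidTorus → ℝ} (hφ : Continuous φ) {ε : ℝ} {k : ℕ}
    (hk : ∀ p q : SolidTorus, p.1 = q.1 →
      |φ ((solenoidMap f)^[k] p) - φ ((solenoidMap f)^[k] q)| ≤ ε) :
    |∫ p, φ p ∂(η : Measure SolidTorus)
      - ∫ x, φ ((solenoidMap f)^[k] (zeroSection x)) ∂μ| ≤ ε := by
  have hc := (continuous_solenoidMap hf).iterate k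
  have hs : Continuous fun x => φ ((solenoidMap f)^[k] (zeroSection x)) :=
    hφ.comp (hc.comp continuous_zeroSection)
  rw [← hμ, integral_map continuous_fst.aemeasurable hs.aestronglyMeasurable,
    ← (hη.iterate k).integral_comp_continuous hφ]
  exact abs_integral_sub_le (integrable_of_continuous (hφ.comp hc) _)
    (integrable_of_continuous (hs.comp continuous_fst) _) fun p => hk _ _ rfl

/-- Both integrals are within ε/2 of the same integral over the base. -/
theorem solenoid_lift_unique (hf : Continuous f) {η η' : ProbabilityMeasure SolidTorus}
    (hη : MeasurePreserving (solenoidMap f) (η : Measure SolidTorus) (η : Measure SolidTorus))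
    (hη' : MeasurePreserving (solenoidMap f) (η' : Measure SolidTorus) (η' : Measure SolidTorus))
    (h : (η : Measure SolidTorus).map Prod.fst = (η' : Measure SolidTorus).map Prod.fst) :
    η = η' := by
  refine probabilityMeasure_ext_of_integral_continuous fun φ hφ => ?_
  refine eq_of_forall_dist_le fun ε hε => ?_
  obtain ⟨k, hk⟩ := exists_iterate_close (f := f) hφ (half_pos hε)
  have h1 := abs_le.1 (abs_integral_sub_integral_zeroSection_le hf hη h hφ hk)
  have h2 := abs_le.1 (abs_integral_sub_integral_zeroSection_le hf hη' rfl hφ hk)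
  rw [Real.dist_eq, abs_le]
  constructor
  · linarith [h1.1, h2.2]
  · linarith [h1.2, h2.1]

/-- Krylov–Bogoliubov is started from μ placed on the zero section. As f preserves μ, every Cesàro
average projects to μ, and so does the limit. -/
theorem solenoid_lift_exists (hf : Continuous f) {μ : ProbabilityMeasure S1}
    (hμ : MeasurePreserving f (μ : Measure S1) (μ : Measure S1)) :
    ∃ η : ProbabilityMeasure SolidTorus,
      MeasurePreserving (solenoidMap f) (η : Measure SolidTorus) (η : Measure SolidTorus) ∧
        (η : Measure SolidTorus).map Prod.fst = (μ : Measure S1) := by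
  let m : ProbabilityMeasure SolidTorus := μ.map continuous_zeroSection.aemeasurable
  have hT := continuous_solenoidMap hf
  obtain ⟨η, hη, L, c, hc, hlim⟩ := exists_invariant_of_cesaro hT m
  have := Measure.isProbabilityMeasure_map (μ := (η : Measure SolidTorus))
    (f := (Prod.fst : SolidTorus → S1)) continuous_fst.aemeasurable
  refine ⟨η, hη, measure_ext_of_integral_continuous fun ψ hψ => ?_⟩
  rw [integral_map continuous_fst.aemeasurable hψ.aestronglyMeasurable]
  refine tendsto_nhds_unique (ProbabilityMeasure.tendsto_integral hlim (hψ.comp continuous_fst))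
    (tendsto_const_nhds.congr fun n => ?_)
  rw [hc n]
  refine Eq.trans ?_ (integral_cesaro hT _ n (hψ.comp continuous_fst)).symm
  have hk : ∀ k, ∫ p, (ψ ∘ Prod.fst) ((solenoidMap f)^[k] p) ∂(m : Measure SolidTorus) =
      ∫ x, ψ x ∂(μ : Measure S1) := fun k => by
    have hcont : Continuous fun p : SolidTorus => (ψ ∘ Prod.fst) ((solenoidMap f)^[k] p) :=
      (hψ.comp continuous_fst).comp (hT.iterate k)
    rw [ProbabilityMeasure.toMeasure_map, integral_map continuous_zeroSection.aemeasurable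
      hcont.aestronglyMeasurable, ← (hμ.iterate k).integral_comp_continuous hψ]
    refine integral_congr_ae (Eventually.of_forall fun x => ?_)
    simp only [Function.comp_apply, solenoidMap_iterate_fst]
    rfl
  rw [Finset.sum_congr rfl fun k _ => hk k]
  simp only [Finset.sum_const, Finset.card_range, nsmul_eq_mul]
  push_cast
  field_simp

/-- The fibres over generic points of `μ` consist of generic points of its lift. -/
theorem mem_basin_of_generic (hf : Continuous f) {η : ProbabilityMeasure SolidTorus}
    {μ : Measure S1}
    (hη : MeasurePreserving (solenoidMap f) (η : Measure SolidTorus) (η : Measure SolidTorus))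
    (hμ : (η : Measure SolidTorus).map Prod.fst = μ) {p : SolidTorus}
    (hp : ∀ ψ : S1 → ℝ, Continuous ψ →
      Tendsto (fun n : ℕ => birkhoffSum f ψ n p.1 / n) atTop (𝓝 (∫ y, ψ y ∂μ))) :
    p ∈ basin (solenoidMap f) η := by
  intro φ hφ
  change Tendsto (fun n : ℕ => birkhoffSum (solenoidMap f) φ n p / n) atTop _
  set T := solenoidMap f with hT
  obtain ⟨C, hC⟩ := exists_abs_le_of_continuous hφ
  rw [Metric.tendsto_atTop']
  intro ε hε
  have hε4 : 0 < ε / 4 := by positivity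
  obtain ⟨k, hk⟩ := exists_iterate_close (f := f) hφ hε4
  have h1 := abs_le.1 (abs_integral_sub_integral_zeroSection_le hf hη hμ hφ hk)
  have hs : Continuous fun x => φ (T^[k] (zeroSection x)) :=
    hφ.comp (((continuous_solenoidMap hf).iterate k).comp continuous_zeroSection)
  obtain ⟨N, hN⟩ := Metric.tendsto_atTop'.1 (hp _ hs) (ε / 4) hε4
  obtain ⟨N', hN'⟩ := Metric.tendsto_atTop'.1 (tendsto_birkhoffSum_iterate_sub T hC p k) (ε / 4) hε4
  refine ⟨max N N', fun n hn => ?_⟩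
  have h2 := hN n ((le_max_left _ _).trans_lt hn)
  have h3 := hN' n ((le_max_right _ _).trans_lt hn)
  have hn0 : (0 : ℝ) < n := by exact_mod_cast (Nat.zero_le _).trans_lt hn
  -- The comparison is termwise: the j-th iterate of p and the zero section over f^j(p.1) lie in the
  -- same fibre, so k further steps bring the values of φ within ε/4.
  have h4 : |birkhoffSum T φ n (T^[k] p) / n
      - birkhoffSum f (fun x => φ (T^[k] (zeroSection x))) n p.1 / n| ≤ ε / 4 := by
    rw [← sub_div, abs_div, abs_of_pos hn0, div_le_iff₀ hn0]
    simp only [birkhoffSum, ← Finset.sum_sub_distrib]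
    refine (Finset.abs_sum_le_sum_abs _ _).trans
      ((Finset.sum_le_sum fun j _ => ?_).trans_eq (b := ∑ j ∈ Finset.range n, ε / 4) ?_)
    · rw [← Function.iterate_add_apply, add_comm, Function.iterate_add_apply]
      exact hk _ _ (solenoidMap_iterate_fst j p)
    · simp [mul_comm]
  rw [Real.dist_eq, abs_lt] at *
  rw [abs_le] at h4
  constructor <;> linarith [h1.1, h1.2, h2.1, h2.2, h3.1, h3.2]

instance : IsFiniteMeasure ((volume : Measure (ℝ × ℝ)).comap (Subtype.val : Disk → ℝ × ℝ)) := by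
  constructor
  have hm : MeasurableSet {p : ℝ × ℝ | p.1 ^ 2 + p.2 ^ 2 ≤ 1} :=
    measurableSet_le (by fun_prop) measurable_const
  refine lt_of_eq_of_lt (comap_subtype_coe_apply hm _ _) ?_
  refine lt_of_le_of_lt (measure_mono ?_) (measure_closedBall_lt_top (x := (0 : ℝ × ℝ)) (r := 1))
  rintro _ ⟨⟨p, hp⟩, -, rfl⟩
  have hp' : p.1 ^ 2 + p.2 ^ 2 ≤ 1 := hp
  change p ∈ _
  rw [mem_closedBall_zero_iff, Prod.norm_def, max_le_iff, Real.norm_eq_abs, Real.norm_eq_abs]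
  exact ⟨abs_le_one_iff_mul_self_le_one.2 (by nlinarith [sq_nonneg p.2]),
    abs_le_one_iff_mul_self_le_one.2 (by nlinarith [sq_nonneg p.1])⟩

theorem volume_comap_disk_univ_pos :
    0 < ((volume : Measure (ℝ × ℝ)).comap (Subtype.val : Disk → ℝ × ℝ)) univ := by
  have hm : MeasurableSet {p : ℝ × ℝ | p.1 ^ 2 + p.2 ^ 2 ≤ 1} :=
    measurableSet_le (by fun_prop) measurable_const
  refine lt_of_lt_of_eq ?_ (comap_subtype_coe_apply hm _ _).symm
  refine lt_of_lt_of_le (Metric.measure_ball_pos volume (0 : ℝ × ℝ) (by norm_num : (0 : ℝ) < 1 / 2))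
    (measure_mono fun p hp => ?_)
  rw [mem_ball_zero_iff, Prod.norm_def, max_lt_iff, Real.norm_eq_abs, Real.norm_eq_abs, abs_lt,
    abs_lt] at hp
  refine ⟨⟨p, ?_⟩, mem_univ _, rfl⟩
  change p.1 ^ 2 + p.2 ^ 2 ≤ 1
  nlinarith [hp.1.1, hp.1.2, hp.2.1, hp.2.2]

theorem lebesgueTorus_fst_preimage (A : Set S1) :
    lebesgueTorus (Prod.fst ⁻¹' A) =
      volume A * ((volume : Measure (ℝ × ℝ)).comap (Subtype.val : Disk → ℝ × ℝ)) univ := by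
  rw [lebesgueTorus, ← Measure.prod_prod, prod_univ]

/-- The fibres over generic base points fill the torus up to a null set and lie in the basin of η. A
basin of positive outer measure must meet this set, and a common point forces equality of the two
measures; no measurability of basins is needed. -/
theorem isSRB_iff (hf : Continuous f) (herg : IsLebesgueErgodic f) {μ : ProbabilityMeasure S1}
    (hμ : IsACIP f μ) {η : ProbabilityMeasure SolidTorus}
    (hη : MeasurePreserving (solenoidMap f) (η : Measure SolidTorus) (η : Measure SolidTorus))
    (hμη : (η : Measure SolidTorus).map Prod.fst = (μ : Measure S1))
    (η' : ProbabilityMeasure SolidTorus) : IsSRB (solenoidMap f) η' ↔ η' = η := by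
  have hae := ae_generic hf herg hμ
  set B : Set S1 := {x | ∀ ψ : S1 → ℝ, Continuous ψ →
      Tendsto (fun n : ℕ => birkhoffSum f ψ n x / n) atTop (𝓝 (∫ y, ψ y ∂(μ : Measure S1)))} with hB
  have hBc : volume Bᶜ = 0 := hae
  constructor
  · rintro ⟨-, hpos⟩
    have hnull : lebesgueTorus (Prod.fst ⁻¹' Bᶜ) = 0 := by
      rw [lebesgueTorus_fst_preimage, hBc, zero_mul]
    obtain ⟨p, hp, hpB⟩ : ∃ p ∈ basin (solenoidMap f) η', p ∉ Prod.fst ⁻¹' Bᶜ := by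
      by_contra! h
      exact hpos.ne' (measure_mono_null h hnull)
    have hpB' : p.1 ∈ B := by simpa using hpB
    have hp2 := mem_basin_of_generic hf hη hμη (p := p) hpB'
    exact probabilityMeasure_ext_of_integral_continuous fun φ hφ =>
      tendsto_nhds_unique (hp φ hφ) (hp2 φ hφ)
  · rintro rfl
    refine ⟨hη, lt_of_lt_of_le ?_ (measure_mono (s := Prod.fst ⁻¹' B) fun p hp =>
      mem_basin_of_generic hf hη hμη hp)⟩
    rw [lebesgueTorus_fst_preimage]
    refine ENNReal.mul_pos ?_ volume_comap_disk_univ_pos.ne'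
    intro h0
    have h2 := measure_union_le (μ := (volume : Measure S1)) B Bᶜ
    rw [h0, hBc, union_compl_self, UnitAddCircle.measure_univ] at h2
    simp at h2

theorem tendstoUniformly_solenoidMap {ι : Type*} {L : Filter ι} {fs : ι → S1 → S1}
    (h : TendstoUniformly fs f L) :
    TendstoUniformly (fun i => solenoidMap (fs i)) (solenoidMap f) L := by
  rw [Metric.tendstoUniformly_iff] at h ⊢
  intro ε hε
  filter_upwards [h ε hε] with i hi p
  have : dist (solenoidMap f p) (solenoidMap (fs i) p) = dist (f p.1) (fs i p.1) := by
    simp [solenoidMap, Prod.dist_eq]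
  rw [this]
  exact hi p.1

/-- Existence, uniqueness and stability of the SRB measures of solenoid skew products over a
family of Lebesgue-ergodic circle maps with uniformly dominated invariant measures. -/
theorem solenoid_statistical_stability (f : ℝ → S1 → S1)
    (hcont : ∀ α ∈ Ioo (0 : ℝ) 1, Continuous (f α))
    (herg : ∀ α ∈ Ioo (0 : ℝ) 1, IsLebesgueErgodic (f α))
    (hdom : ∀ α₀ ∈ Ioo (0 : ℝ) 1, ∃ ν : Measure S1, IsFiniteMeasure ν ∧ ν ≪ volume ∧
      ∀ᶠ α in 𝓝 α₀, ∃ μ : ProbabilityMeasure S1, IsACIP (f α) μ ∧ (μ : Measure S1) ≤ ν)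
    (hunif : ∀ (a : ℕ → ℝ) (α₀ : ℝ), (∀ n, a n ∈ Ioo (0 : ℝ) 1) → α₀ ∈ Ioo (0 : ℝ) 1 →
      Tendsto a atTop (𝓝 α₀) → TendstoUniformly (fun n => f (a n)) (f α₀) atTop) :
    ∃ (μ : ℝ → ProbabilityMeasure S1) (η : ℝ → ProbabilityMeasure SolidTorus),
      (∀ α ∈ Ioo (0 : ℝ) 1,
        (∀ μ' : ProbabilityMeasure S1, IsACIP (f α) μ' ↔ μ' = μ α) ∧
        (∀ η' : ProbabilityMeasure SolidTorus, IsSRB (solenoidMap (f α)) η' ↔ η' = η α) ∧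
        (∀ η' : ProbabilityMeasure SolidTorus,
          (MeasurePreserving (solenoidMap (f α)) (η' : Measure SolidTorus) (η' : Measure SolidTorus) ∧
            (η' : Measure SolidTorus).map Prod.fst = (μ α : Measure S1)) ↔ η' = η α)) ∧
      ∀ (a : ℕ → ℝ) (α₀ : ℝ), (∀ n, a n ∈ Ioo (0 : ℝ) 1) → α₀ ∈ Ioo (0 : ℝ) 1 →
        Tendsto a atTop (𝓝 α₀) →
        ∀ φ : SolidTorus → ℝ, Continuous φ →
          Tendsto (fun n => ∫ p, φ p ∂(η (a n) : Measure SolidTorus)) atTop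
            (𝓝 (∫ p, φ p ∂(η α₀ : Measure SolidTorus))) := by
  have h1 : ∀ α : ℝ, ∃ (μ : ProbabilityMeasure S1) (η : ProbabilityMeasure SolidTorus),
      α ∈ Ioo (0 : ℝ) 1 → IsACIP (f α) μ ∧
        MeasurePreserving (solenoidMap (f α)) (η : Measure SolidTorus) (η : Measure SolidTorus) ∧
          (η : Measure SolidTorus).map Prod.fst = (μ : Measure S1) := fun α => by
    by_cases hα : α ∈ Ioo (0 : ℝ) 1
    · obtain ⟨ν, -, -, hν⟩ := hdom α hα
      obtain ⟨μ, hμ, -⟩ := hν.self_of_nhds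
      obtain ⟨η, hη⟩ := solenoid_lift_exists (hcont α hα) hμ.1
      exact ⟨μ, η, fun _ => ⟨hμ, hη⟩⟩
    -- Nothing is claimed outside (0, 1); the Dirac masses only make the choice functions total.
    · exact ⟨⟨Measure.dirac 0, inferInstance⟩, ⟨Measure.dirac (zeroSection 0), inferInstance⟩,
        fun h => absurd h hα⟩
  choose μ η h using h1
  refine ⟨μ, η, fun α hα => ⟨fun μ' => ⟨fun h' => ?_, ?_⟩, fun η' => ?_, fun η' => ⟨fun h' => ?_, ?_⟩⟩,
    fun a α₀ ha hα₀ hlim φ hφ => ?_⟩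
  · exact h'.unique (hcont α hα) (herg α hα) (h α hα).1
  · rintro rfl; exact (h α hα).1
  · exact isSRB_iff (hcont α hα) (herg α hα) (h α hα).1 (h α hα).2.1 (h α hα).2.2 η'
  · exact solenoid_lift_unique (hcont α hα) h'.1 (h α hα).2.1 (h'.2.trans (h α hα).2.2.symm)
  · rintro rfl; exact (h α hα).2
  · refine ProbabilityMeasure.tendsto_integral (?_ : Tendsto (fun n => η (a n)) atTop (𝓝 (η α₀))) hφ
    -- Along an ultrafilter, compactness of the space of probability measures provides a limit, so
    -- it remains only to identify it.
    rw [tendsto_iff_ultrafilter]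
    intro L hL
    obtain ⟨η', -, hη'⟩ := isCompact_univ.ultrafilter_le_nhds' (L.map fun n => η (a n))
      (Ultrafilter.mem_coe.1 univ_mem)
    have hη'lim : Tendsto (fun n => η (a n)) L (𝓝 η') := hη'
    suffices η' = η α₀ by rw [← this]; exact hη'
    have hinv : MeasurePreserving (solenoidMap (f α₀)) (η' : Measure SolidTorus)
        (η' : Measure SolidTorus) :=
      measurePreserving_of_tendsto (continuous_solenoidMap (hcont α₀ hα₀))
        (fun n => continuous_solenoidMap (hcont _ (ha n)))
        (tendstoUniformly_solenoidMap fun u hu => hL (hunif a α₀ ha hα₀ hlim u hu))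
        hη'lim fun n => (h (a n) (ha n)).2.1
    let μ' : ProbabilityMeasure S1 := η'.map (continuous_fst (X := S1) (Y := Disk)).aemeasurable
    have hμ'lim : Tendsto (fun n => μ (a n)) L (𝓝 μ') := by
      refine (ProbabilityMeasure.tendsto_map_of_tendsto_of_continuous _ _ hη'lim
        continuous_fst).congr fun n => Subtype.ext ?_
      exact (h (a n) (ha n)).2.2
    have hμ'eq : (η' : Measure SolidTorus).map Prod.fst = (μ' : Measure S1) := rfl
    have hμ' : IsACIP (f α₀) μ' := by
      refine ⟨⟨(hcont α₀ hα₀).measurable, ?_⟩, ?_⟩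
      · rw [← hμ'eq, Measure.map_map (hcont α₀ hα₀).measurable measurable_fst]
        conv_rhs => rw [← hinv.map_eq, Measure.map_map measurable_fst hinv.measurable]
        rfl
      -- Absolute continuity alone would be lost in the weak limit. It survives because one ν
      -- dominates for all parameters near α₀.
      · obtain ⟨ν, hν, hac, hev⟩ := hdom α₀ hα₀
        refine (Measure.absolutelyContinuous_of_le ?_).trans hac
        refine ProbabilityMeasure.toMeasure_le_of_tendsto hμ'lim ?_
        refine hL ((hlim.eventually hev).mono fun n hn => ?_)
        obtain ⟨μ'', h1, h2⟩ := hn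
        rwa [h1.unique (hcont _ (ha n)) (herg _ (ha n)) (h _ (ha n)).1] at h2
    have : μ' = μ α₀ := hμ'.unique (hcont α₀ hα₀) (herg α₀ hα₀) (h α₀ hα₀).1
    refine solenoid_lift_unique (hcont α₀ hα₀) hinv (h α₀ hα₀).2.1 ?_
    rw [hμ'eq, this, (h α₀ hα₀).2.2]

end Solenoid

/-! ### Expanding maps with a neutral fixed point and the distortion scale -/

/-- The scale `log x - log (1 - x) + M x` on `(0, 1)` in which the distortion of the branches of an
intermittent map is measured. -/
def distortionScale (M x : ℝ) : ℝ := Real.log x - Real.log (1 - x) + M * x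

/-- `F` is the lift to `[0, 1]` of a full-branch circle map of degree `d`, expanding away from a
neutral fixed point at `0`, with derivative `F'`; the constants control the distortion and the
repulsion from the fixed point. -/
structure IsNeutralExpanding (d : ℕ) (β K M ρ c : ℝ) (F F' : ℝ → ℝ) : Prop where
  two_le : 2 ≤ d
  β_pos : 0 < β
  β_lt : β < 1
  K_nonneg : 0 ≤ K
  M_nonneg : 0 ≤ M
  ρ_pos : 0 < ρ
  ρ_le : ρ ≤ 1 / 4
  c_pos : 0 < c
  continuousOn : ContinuousOn F (Icc 0 1)
  map_zero : F 0 = 0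
  map_one : F 1 = d
  hasDerivAt : ∀ x ∈ Ioo (0 : ℝ) 1, HasDerivAt F (F' x) x
  continuousOn_deriv : ContinuousOn F' (Ioo 0 1)
  one_lt_deriv : ∀ x ∈ Ioo (0 : ℝ) 1, 1 < F' x
  deriv_le_left : ∀ x ∈ Ioo 0 ρ, F' x ≤ 2
  deriv_le_right : ∀ x ∈ Ioo 0 ρ, F' (1 - x) ≤ 2
  growth_left : ∀ x ∈ Ioo 0 ρ, x ^ (-β) + c ≤ F x ^ (-β) * F' x
  growth_right : ∀ x ∈ Ioo 0 ρ, x ^ (-β) + c ≤ (d - F (1 - x)) ^ (-β) * F' (1 - x)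
  distortion : ∀ i : ℕ, i < d → ∀ x y : ℝ, 0 < x → x < y → y < 1 → (i : ℝ) < F x → F y < i + 1 →
    |Real.log (F' y) - Real.log (F' x)| ≤ K * ((distortionScale M (F y - i) - distortionScale M y) -
      (distortionScale M (F x - i) - distortionScale M x))

theorem distortionScale_strictMono {M x y : ℝ} (hM : 0 ≤ M) (hx : 0 < x) (hxy : x < y)
    (hy : y < 1) : distortionScale M x < distortionScale M y := by
  have h1 := Real.log_lt_log hx hxy
  have h2 := Real.log_lt_log (by linarith : 0 < 1 - y) (by linarith : 1 - y < 1 - x)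
  have h3 : M * x ≤ M * y := by gcongr
  unfold distortionScale
  linarith

theorem distortionScale_mono {M x y : ℝ} (hM : 0 ≤ M) (hx : 0 < x) (hxy : x ≤ y)
    (hy : y < 1) : distortionScale M x ≤ distortionScale M y := by
  rcases hxy.eq_or_lt with rfl | h
  · exact le_rfl
  · exact (distortionScale_strictMono hM hx h hy).le

/-- The oscillation of `log h` is at most `K` times that of the distortion scale. -/
def HasLogDistortion (K M : ℝ) (h : ℝ → ℝ) : Prop :=
  ∀ x y : ℝ, 0 < x → x < y → y < 1 →
    h y ≤ h x * Real.exp (K * (distortionScale M y - distortionScale M x)) ∧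
      h x ≤ h y * Real.exp (K * (distortionScale M y - distortionScale M x))

/-- Both inequalities are linear in the function and carry the same factor for every summand, so
summing over branches costs nothing. -/
theorem HasLogDistortion.sum {K M : ℝ} {ι : Type*} {s : Finset ι} {h : ι → ℝ → ℝ}
    (H : ∀ i ∈ s, HasLogDistortion K M (h i)) :
    HasLogDistortion K M fun x => ∑ i ∈ s, h i x := by
  intro x y hx hxy hy
  simp only [Finset.sum_mul]
  exact ⟨Finset.sum_le_sum fun i hi => (H i hi x y hx hxy hy).1,
    Finset.sum_le_sum fun i hi => (H i hi x y hx hxy hy).2⟩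

/-- A Harnack inequality away from the fixed point, where the scale has finite oscillation. -/
theorem HasLogDistortion.le_mul_on_Icc {K M ρ : ℝ} {h : ℝ → ℝ} (H : HasLogDistortion K M h)
    (hK : 0 ≤ K) (hM : 0 ≤ M) (hρ : 0 < ρ) (hpos : ∀ x ∈ Ioo (0 : ℝ) 1, 0 < h x)
    {x z : ℝ} (hx : x ∈ Icc ρ (1 - ρ)) (hz : z ∈ Icc ρ (1 - ρ)) :
    h x ≤ h z * Real.exp (K * (distortionScale M (1 - ρ) - distortionScale M ρ)) := by
  have hz0 : 0 < h z := hpos z ⟨by linarith [hz.1], by linarith [hz.2]⟩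
  have key : ∀ u v : ℝ, u ∈ Icc ρ (1 - ρ) → v ∈ Icc ρ (1 - ρ) →
      distortionScale M v - distortionScale M u ≤
        distortionScale M (1 - ρ) - distortionScale M ρ := fun u v hu hv => by
    have h1 := distortionScale_mono hM hρ hu.1 (by linarith [hu.2])
    have h2 := distortionScale_mono hM (by linarith [hv.1] : 0 < v) hv.2 (by linarith)
    linarith
  rcases lt_trichotomy x z with hlt | rfl | hlt
  · refine (H x z (by linarith [hx.1]) hlt (by linarith [hz.2])).2.trans ?_
    have := key x z hx hz
    gcongr ?_ * Real.exp (K * ?_)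
  · refine le_mul_of_one_le_right hz0.le (Real.one_le_exp (mul_nonneg hK ?_))
    have := key x x hx hx
    linarith
  · refine (H z x (by linarith [hz.1]) hlt (by linarith [hx.2])).1.trans ?_
    have := key z x hz hx
    gcongr ?_ * Real.exp (K * ?_)

/-- The inverse of the restriction of `F` to the unit interval. -/
def unitInv (F : ℝ → ℝ) : ℝ → ℝ := Function.invFunOn F (Icc 0 1)

/-- The contribution of the `i`-th inverse branch to the transfer operator. -/
def branchTransfer (F F' : ℝ → ℝ) (i : ℕ) (h : ℝ → ℝ) (x : ℝ) : ℝ :=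
  h (unitInv F (x + i)) * (F' (unitInv F (x + i)))⁻¹

/-- The transfer operator of the circle map with lift `F`. -/
def transfer (d : ℕ) (F F' : ℝ → ℝ) (h : ℝ → ℝ) (x : ℝ) : ℝ :=
  ∑ i ∈ Finset.range d, branchTransfer F F' i h x

namespace IsNeutralExpanding

variable {d : ℕ} {β K M ρ c : ℝ} {F F' : ℝ → ℝ}

theorem strictMonoOn (H : IsNeutralExpanding d β K M ρ c F F') : StrictMonoOn F (Icc 0 1) := by
  refine strictMonoOn_of_deriv_pos (convex_Icc 0 1) H.continuousOn fun x hx => ?_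
  rw [interior_Icc] at hx
  rw [(H.hasDerivAt x hx).deriv]
  linarith [H.one_lt_deriv x hx]

theorem sub_id_strictMonoOn (H : IsNeutralExpanding d β K M ρ c F F') :
    StrictMonoOn (fun x => F x - x) (Icc 0 1) := by
  refine strictMonoOn_of_deriv_pos (convex_Icc 0 1) (H.continuousOn.sub continuousOn_id)
    fun x hx => ?_
  rw [interior_Icc] at hx
  have h : HasDerivAt (fun x => F x - x) (F' x - 1) x := (H.hasDerivAt x hx).sub (hasDerivAt_id x)
  rw [h.deriv]
  linarith [H.one_lt_deriv x hx]

theorem lt_map (H : IsNeutralExpanding d β K M ρ c F F') {x : ℝ} (hx : x ∈ Ioo (0 : ℝ) 1) :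
    x < F x := by
  have := H.sub_id_strictMonoOn (left_mem_Icc.2 zero_le_one) (Ioo_subset_Icc_self hx) hx.1
  simp only [H.map_zero] at this
  linarith

theorem lt_sub_map (H : IsNeutralExpanding d β K M ρ c F F') {x : ℝ} (hx : x ∈ Ioo (0 : ℝ) 1) :
    x < d - F (1 - x) := by
  have := H.sub_id_strictMonoOn (a := 1 - x) ⟨by linarith [hx.2], by linarith [hx.1]⟩
    (right_mem_Icc.2 zero_le_one) (by linarith [hx.1])
  simp only [H.map_one] at this
  linarith

theorem map_le_two_mul (H : IsNeutralExpanding d β K M ρ c F F') {x : ℝ} (hx : x ∈ Icc 0 ρ) :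
    F x ≤ 2 * x := by
  have hρ := H.ρ_le
  have h := (convex_Icc 0 ρ).image_sub_le_mul_sub_of_deriv_le (f := F) (C := 2)
    (H.continuousOn.mono (Icc_subset_Icc_right (by linarith))) (fun y hy => ?_) (fun y hy => ?_)
    0 (left_mem_Icc.2 H.ρ_pos.le) x hx hx.1
  · rw [H.map_zero] at h; linarith
  · rw [interior_Icc] at hy
    exact (H.hasDerivAt y ⟨hy.1, by linarith [hy.2]⟩).differentiableAt.differentiableWithinAt
  · rw [interior_Icc] at hy
    rw [(H.hasDerivAt y ⟨hy.1, by linarith [hy.2]⟩).deriv]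
    exact H.deriv_le_left y hy

theorem sub_map_le_two_mul (H : IsNeutralExpanding d β K M ρ c F F') {x : ℝ} (hx : x ∈ Icc 0 ρ) :
    d - F (1 - x) ≤ 2 * x := by
  have hρ := H.ρ_le
  have h := (convex_Icc (1 - ρ) 1).image_sub_le_mul_sub_of_deriv_le (f := F) (C := 2)
    (H.continuousOn.mono (Icc_subset_Icc_left (by linarith))) (fun y hy => ?_) (fun y hy => ?_)
    (1 - x) ⟨by linarith [hx.2], by linarith [hx.1]⟩ 1 (right_mem_Icc.2 (by linarith [H.ρ_pos]))
    (by linarith [hx.1])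
  · rw [H.map_one] at h; linarith
  · rw [interior_Icc] at hy
    exact (H.hasDerivAt y ⟨by linarith [hy.1], hy.2⟩).differentiableAt.differentiableWithinAt
  · rw [interior_Icc] at hy
    rw [(H.hasDerivAt y ⟨by linarith [hy.1], hy.2⟩).deriv]
    have := H.deriv_le_right (1 - y) ⟨by linarith [hy.2], by linarith [hy.1]⟩
    rwa [sub_sub_cancel] at this

theorem surjOn (H : IsNeutralExpanding d β K M ρ c F F') : SurjOn F (Icc 0 1) (Icc 0 d) := by
  have := intermediate_value_Icc zero_le_one H.continuousOn
  rwa [H.map_zero, H.map_one] at this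

theorem unitInv_mem_Icc (H : IsNeutralExpanding d β K M ρ c F F') {t : ℝ} (ht : t ∈ Icc (0 : ℝ) d) :
    unitInv F t ∈ Icc (0 : ℝ) 1 :=
  Function.invFunOn_mem (H.surjOn ht)

theorem map_unitInv (H : IsNeutralExpanding d β K M ρ c F F') {t : ℝ} (ht : t ∈ Icc (0 : ℝ) d) :
    F (unitInv F t) = t :=
  Function.invFunOn_eq (H.surjOn ht)

theorem map_mem_Icc (H : IsNeutralExpanding d β K M ρ c F F') {x : ℝ} (hx : x ∈ Icc (0 : ℝ) 1) :
    F x ∈ Icc (0 : ℝ) d := by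
  have h1 := H.strictMonoOn.monotoneOn (left_mem_Icc.2 zero_le_one) hx hx.1
  have h2 := H.strictMonoOn.monotoneOn hx (right_mem_Icc.2 zero_le_one) hx.2
  rw [H.map_zero] at h1
  rw [H.map_one] at h2
  exact ⟨h1, h2⟩

theorem map_mem_Ioo (H : IsNeutralExpanding d β K M ρ c F F') {x : ℝ} (hx : x ∈ Ioo (0 : ℝ) 1) :
    F x ∈ Ioo (0 : ℝ) d := by
  have h1 := H.strictMonoOn (left_mem_Icc.2 zero_le_one) (Ioo_subset_Icc_self hx) hx.1
  have h2 := H.strictMonoOn (Ioo_subset_Icc_self hx) (right_mem_Icc.2 zero_le_one) hx.2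
  rw [H.map_zero] at h1
  rw [H.map_one] at h2
  exact ⟨h1, h2⟩

theorem unitInv_map (H : IsNeutralExpanding d β K M ρ c F F') {x : ℝ} (hx : x ∈ Icc (0 : ℝ) 1) :
    unitInv F (F x) = x :=
  H.strictMonoOn.injOn (H.unitInv_mem_Icc (H.map_mem_Icc hx)) hx (H.map_unitInv (H.map_mem_Icc hx))

theorem unitInv_strictMonoOn (H : IsNeutralExpanding d β K M ρ c F F') :
    StrictMonoOn (unitInv F) (Icc 0 d) := fun s hs t ht hst => by
  by_contra! hle
  have := H.strictMonoOn.monotoneOn (H.unitInv_mem_Icc ht) (H.unitInv_mem_Icc hs) hle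
  rw [H.map_unitInv hs, H.map_unitInv ht] at this
  linarith

theorem unitInv_mem_Ioo (H : IsNeutralExpanding d β K M ρ c F F') {t : ℝ} (ht : t ∈ Ioo (0 : ℝ) d) :
    unitInv F t ∈ Ioo (0 : ℝ) 1 := by
  have h := H.unitInv_mem_Icc (Ioo_subset_Icc_self ht)
  have h' := H.map_unitInv (Ioo_subset_Icc_self ht)
  refine ⟨h.1.lt_of_ne fun h0 => ?_, h.2.lt_of_ne fun h1 => ?_⟩
  · rw [← h0, H.map_zero] at h'; exact ht.1.ne h'
  · rw [h1, H.map_one] at h'; exact ht.2.ne h'.symm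

theorem add_mem_Ioo {i : ℕ} (hi : i < d) {x : ℝ} (hx : x ∈ Ioo (0 : ℝ) 1) :
    x + i ∈ Ioo (0 : ℝ) d := by
  have h : (i : ℝ) + 1 ≤ d := by exact_mod_cast hi
  exact ⟨by have := hx.1; positivity, by linarith [hx.2]⟩

theorem branch_mem_Ioo (H : IsNeutralExpanding d β K M ρ c F F') {i : ℕ} (hi : i < d) {x : ℝ}
    (hx : x ∈ Ioo (0 : ℝ) 1) : unitInv F (x + i) ∈ Ioo (0 : ℝ) 1 :=
  H.unitInv_mem_Ioo (add_mem_Ioo hi hx)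

theorem map_branch (H : IsNeutralExpanding d β K M ρ c F F') {i : ℕ} (hi : i < d) {x : ℝ}
    (hx : x ∈ Ioo (0 : ℝ) 1) : F (unitInv F (x + i)) = x + i :=
  H.map_unitInv (Ioo_subset_Icc_self (add_mem_Ioo hi hx))

theorem hasDerivAt_unitInv (H : IsNeutralExpanding d β K M ρ c F F') {t : ℝ}
    (ht : t ∈ Ioo (0 : ℝ) d) : HasDerivAt (unitInv F) (F' (unitInv F t))⁻¹ t := by
  have hG := H.unitInv_mem_Ioo ht
  refine HasDerivAt.of_local_left_inverse ?_ (H.hasDerivAt _ hG) ?_ ?_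
  · refine H.unitInv_strictMonoOn.continuousAt_of_image_mem_nhds (Icc_mem_nhds ht.1 ht.2) ?_
    refine mem_of_superset (Icc_mem_nhds hG.1 hG.2) fun x hx => ?_
    exact ⟨F x, H.map_mem_Icc hx, H.unitInv_map hx⟩
  · linarith [H.one_lt_deriv _ hG]
  · filter_upwards [Icc_mem_nhds ht.1 ht.2] with y hy using H.map_unitInv hy

theorem hasDerivAt_branch (H : IsNeutralExpanding d β K M ρ c F F') {i : ℕ} (hi : i < d) {x : ℝ}
    (hx : x ∈ Ioo (0 : ℝ) 1) :
    HasDerivAt (fun x => unitInv F (x + i)) (F' (unitInv F (x + i)))⁻¹ x := by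
  exact (H.hasDerivAt_unitInv (add_mem_Ioo hi hx)).comp_add_const x (i : ℝ)

theorem branchTransfer_pos (H : IsNeutralExpanding d β K M ρ c F F') {i : ℕ} (hi : i < d) {h : ℝ → ℝ}
    (hpos : ∀ x ∈ Ioo (0 : ℝ) 1, 0 < h x) {x : ℝ} (hx : x ∈ Ioo (0 : ℝ) 1) :
    0 < branchTransfer F F' i h x := by
  have hy := H.branch_mem_Ioo hi hx
  have := H.one_lt_deriv _ hy
  exact mul_pos (hpos _ hy) (inv_pos.2 (by linarith))

theorem branchTransfer_le (H : IsNeutralExpanding d β K M ρ c F F') {i : ℕ} (hi : i < d) {h : ℝ → ℝ}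
    (hpos : ∀ x ∈ Ioo (0 : ℝ) 1, 0 < h x) {x : ℝ} (hx : x ∈ Ioo (0 : ℝ) 1) :
    branchTransfer F F' i h x ≤ h (unitInv F (x + i)) := by
  have hy := H.branch_mem_Ioo hi hx
  exact mul_le_of_le_one_right (hpos _ hy).le (inv_le_one_of_one_le₀ (H.one_lt_deriv _ hy).le)

theorem continuousOn_branchTransfer (H : IsNeutralExpanding d β K M ρ c F F') {i : ℕ} (hi : i < d)
    {h : ℝ → ℝ} (hc : ContinuousOn h (Ioo 0 1)) :
    ContinuousOn (branchTransfer F F' i h) (Ioo 0 1) := by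
  have hG : ContinuousOn (fun x => unitInv F (x + i)) (Ioo 0 1) := fun x hx =>
    (H.hasDerivAt_branch hi hx).continuousAt.continuousWithinAt
  have hm : MapsTo (fun x => unitInv F (x + i)) (Ioo 0 1) (Ioo 0 1) := fun x hx =>
    H.branch_mem_Ioo hi hx
  refine (hc.comp hG hm).mul ((H.continuousOn_deriv.comp hG hm).inv₀ fun x hx => ?_)
  have := H.one_lt_deriv _ (hm hx)
  simp only [Function.comp_apply]
  linarith

/-- The exponents add up exactly: with a, b the preimages of x, y, the function h contributes K
times the increment of the scale from a to b, and F' contributes K times the increment from x to y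
minus that from a to b. The constants do not deteriorate, so any number of iterations is allowed. -/
theorem hasLogDistortion_branchTransfer (H : IsNeutralExpanding d β K M ρ c F F') {i : ℕ}
    (hi : i < d) {h : ℝ → ℝ} (hpos : ∀ x ∈ Ioo (0 : ℝ) 1, 0 < h x) (hh : HasLogDistortion K M h) :
    HasLogDistortion K M (branchTransfer F F' i h) := by
  intro x y hx hxy hy
  have hxI : x ∈ Ioo (0 : ℝ) 1 := ⟨hx, hxy.trans hy⟩
  have hyI : y ∈ Ioo (0 : ℝ) 1 := ⟨hx.trans hxy, hy⟩
  set a := unitInv F (x + i) with ha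
  set b := unitInv F (y + i) with hb
  have haI : a ∈ Ioo (0 : ℝ) 1 := H.branch_mem_Ioo hi hxI
  have hbI : b ∈ Ioo (0 : ℝ) 1 := H.branch_mem_Ioo hi hyI
  have hab : a < b := H.unitInv_strictMonoOn (Ioo_subset_Icc_self (add_mem_Ioo hi hxI))
    (Ioo_subset_Icc_self (add_mem_Ioo hi hyI)) (by linarith)
  have hFa : F a = x + i := H.map_branch hi hxI
  have hFb : F b = y + i := H.map_branch hi hyI
  have hdist := H.distortion i hi a b haI.1 hab hbI.2 (by linarith) (by linarith)
  rw [hFa, hFb, add_sub_cancel_right, add_sub_cancel_right, abs_le] at hdist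
  have h1 := hh a b haI.1 hab hbI.2
  have ha1 : 0 < F' a := by linarith [H.one_lt_deriv a haI]
  have hb1 : 0 < F' b := by linarith [H.one_lt_deriv b hbI]
  set D := K * ((distortionScale M y - distortionScale M b) -
    (distortionScale M x - distortionScale M a)) with hD
  have hsum : K * (distortionScale M y - distortionScale M x) =
      K * (distortionScale M b - distortionScale M a) + D := by rw [hD]; ring
  have hinv : ∀ u v : ℝ, 0 < u → 0 < v → Real.log v - Real.log u ≤ D → u⁻¹ ≤ v⁻¹ * Real.exp D :=
    fun u v hu hv huv => by
      rw [inv_eq_one_div, inv_mul_eq_div, div_le_div_iff₀ hu hv, one_mul, ← Real.exp_log hv,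
        mul_comm, ← Real.exp_log hu, ← Real.exp_add]
      exact Real.exp_le_exp.2 (by linarith)
  have hfin : ∀ p q u v E : ℝ, 0 < q → 0 < u → p ≤ q * Real.exp E → u ≤ v * Real.exp D →
      p * u ≤ q * v * Real.exp (E + D) := fun p q u v E hq hu hpq huv => by
    rw [Real.exp_add]
    calc p * u ≤ (q * Real.exp E) * (v * Real.exp D) := by gcongr
      _ = _ := by ring
  rw [hsum]
  refine ⟨hfin _ _ _ _ _ (hpos a haI) (inv_pos.2 hb1) h1.1 (hinv _ _ hb1 ha1 (by linarith [hdist.1])),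
    hfin _ _ _ _ _ (hpos b hbI) (inv_pos.2 ha1) h1.2 (hinv _ _ ha1 hb1 (by linarith [hdist.2]))⟩

end IsNeutralExpanding

/-! ### Duality between the transfer operator and the circle map -/

theorem rep_coe {x : ℝ} (hx : x ∈ Ico (0 : ℝ) 1) : rep (x : S1) = x := by
  unfold rep
  rw [AddCircle.equivIco_coe_eq (p := (1 : ℝ)) (a := 0) (by simpa using hx)]

theorem circleMapOf_coe (F : ℝ → ℝ) {x : ℝ} (hx : x ∈ Ico (0 : ℝ) 1) :
    circleMapOf F (x : S1) = (F x : S1) := by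
  rw [circleMapOf, rep_coe hx]

theorem coe_add_natCast (x : ℝ) (i : ℕ) : ((x + i : ℝ) : S1) = (x : S1) := by
  have h : ((i : ℝ) : S1) = 0 := (AddCircle.coe_eq_zero_iff (1 : ℝ)).2 ⟨i, by simp⟩
  rw [AddCircle.coe_add, h, add_zero]

theorem measurable_coe_circle : Measurable ((↑) : ℝ → S1) :=
  AddCircle.measurable_mk'

theorem lintegral_Ioo_natCast (g : ℝ → ENNReal) (n : ℕ) :
    ∫⁻ t in Ioo (0 : ℝ) n, g t = ∑ i ∈ Finset.range n, ∫⁻ x in Ioo (0 : ℝ) 1, g (x + i) := by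
  induction n with
  | zero => simp
  | succ n ih =>
    have h1 : ∫⁻ x in Ioo (0 : ℝ) 1, g (x + n) = ∫⁻ t in Ioo (n : ℝ) (n + 1), g t := by
      have := lintegral_image_eq_lintegral_abs_deriv_mul (s := Ioo (0 : ℝ) 1) (f := fun x => x + n)
        (f' := fun _ => 1) measurableSet_Ioo
        (fun x _ => ((hasDerivAt_id x).add_const (n : ℝ)).hasDerivWithinAt)
        (fun x _ y _ h => by simpa using h) g
      rw [image_add_const_Ioo, zero_add, add_comm] at this
      simpa using this.symm
    rw [Finset.sum_range_succ, ← ih, h1]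
    have h2 : Ioc (0 : ℝ) ((n + 1 : ℕ) : ℝ) = Ioc 0 (n : ℝ) ∪ Ioc (n : ℝ) (n + 1) := by
      rw [Ioc_union_Ioc_eq_Ioc (Nat.cast_nonneg n) (by linarith)]; push_cast; rfl
    have h3 : ∀ a b : ℝ, ∫⁻ t in Ioo a b, g t = ∫⁻ t in Ioc a b, g t := fun a b =>
      setLIntegral_congr Ioo_ae_eq_Ioc
    rw [h3, h3, h3, h2, lintegral_union measurableSet_Ioc]
    exact Ioc_disjoint_Ioc_of_le le_rfl

theorem volume_circle_eq : (volume : Measure S1) =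
    (volume.restrict (Ioo (0 : ℝ) 1)).map ((↑) : ℝ → S1) := by
  have h := (UnitAddCircle.measurePreserving_mk 0).map_eq
  rw [zero_add, ← restrict_Ioo_eq_restrict_Ioc] at h
  exact h.symm

namespace IsNeutralExpanding

variable {d : ℕ} {β K M ρ c : ℝ} {F F' : ℝ → ℝ}

theorem image_Ioo (H : IsNeutralExpanding d β K M ρ c F F') : F '' Ioo 0 1 = Ioo (0 : ℝ) d := by
  ext t
  constructor
  · rintro ⟨x, hx, rfl⟩; exact H.map_mem_Ioo hx
  · exact fun ht => ⟨_, H.unitInv_mem_Ioo ht, H.map_unitInv (Ioo_subset_Icc_self ht)⟩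

/-- The transfer operator is dual to composition with the circle map. -/
theorem lintegral_comp_mul (H : IsNeutralExpanding d β K M ρ c F F') {ψ : S1 → ENNReal}
    (hψ : Measurable ψ) {h : ℝ → ℝ} (hpos : ∀ x ∈ Ioo (0 : ℝ) 1, 0 < h x)
    (hc : ContinuousOn h (Ioo 0 1)) :
    ∫⁻ x in Ioo (0 : ℝ) 1, ψ (F x : ℝ) * ENNReal.ofReal (h x) =
      ∫⁻ x in Ioo (0 : ℝ) 1, ψ x * ENNReal.ofReal (transfer d F F' h x) := by
  let g : ℝ → ENNReal := fun t =>
    ψ t * ENNReal.ofReal (h (unitInv F t) * (F' (unitInv F t))⁻¹)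
  -- The substitution t = F x turns (0, 1) into (0, d), which is cut into d unit intervals, one for
  -- each branch.
  have h1 := lintegral_image_eq_lintegral_abs_deriv_mul (s := Ioo (0 : ℝ) 1) measurableSet_Ioo
    (fun x hx => (H.hasDerivAt x hx).hasDerivWithinAt)
    (H.strictMonoOn.injOn.mono Ioo_subset_Icc_self) g
  rw [H.image_Ioo, lintegral_Ioo_natCast] at h1
  have h2 : ∫⁻ x in Ioo (0 : ℝ) 1, ψ (F x : ℝ) * ENNReal.ofReal (h x) =
      ∫⁻ x in Ioo (0 : ℝ) 1, ENNReal.ofReal |F' x| * g (F x) := by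
    refine setLIntegral_congr_fun measurableSet_Ioo fun x hx => ?_
    have h3 : 0 < F' x := by linarith [H.one_lt_deriv x hx]
    simp only [g, H.unitInv_map (Ioo_subset_Icc_self hx)]
    rw [mul_left_comm, ← ENNReal.ofReal_mul (abs_nonneg _), abs_of_pos h3]
    congr 2
    field_simp
  rw [h2, ← h1, ← lintegral_finsetSum']
  · refine setLIntegral_congr_fun measurableSet_Ioo fun x hx => ?_
    simp only [transfer, g, coe_add_natCast]
    rw [← Finset.mul_sum, ENNReal.ofReal_sum_of_nonneg]
    · rfl
    · exact fun i hi => (H.branchTransfer_pos (Finset.mem_range.1 hi) hpos hx).le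
  · intro i hi
    have h4 := (H.continuousOn_branchTransfer (Finset.mem_range.1 hi) hc).aemeasurable
      (μ := volume) measurableSet_Ioo
    simp only [g, coe_add_natCast]
    exact ((hψ.comp measurable_coe_circle).aemeasurable).mul h4.ennreal_ofReal

end IsNeutralExpanding

/-! ### Invariant class of densities and the absolutely continuous invariant measure -/

/-- A bound for the middle part of the densities. -/
def middleBound (K M ρ : ℝ) : ℝ :=
  2 * Real.exp (K * (distortionScale M (1 - ρ) - distortionScale M ρ))

/-- A bound for the singular part of the densities. -/
def poleBound (d : ℕ) (K M ρ c : ℝ) : ℝ := max 1 (2 * (d * middleBound K M ρ) / c)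

/-- The class of probability densities that is preserved by the transfer operator. -/
structure IsAdmissibleDensity (d : ℕ) (β K M ρ c : ℝ) (h : ℝ → ℝ) : Prop where
  pos : ∀ x ∈ Ioo (0 : ℝ) 1, 0 < h x
  continuousOn : ContinuousOn h (Ioo 0 1)
  logDistortion : HasLogDistortion K M h
  lintegral_eq_one : ∫⁻ x in Ioo (0 : ℝ) 1, ENNReal.ofReal (h x) = 1
  le_left : ∀ x ∈ Ioo 0 ρ, h x ≤ poleBound d K M ρ c * x ^ (-β)
  le_right : ∀ x ∈ Ioo 0 ρ, h (1 - x) ≤ poleBound d K M ρ c * x ^ (-β)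

/-- Meant for the transfer operator near the fixed point: one summand carries the singularity and
leaves room for d bounded ones. -/
theorem Finset.sum_range_le_of_one {d : ℕ} {t : ℕ → ℝ} {j : ℕ} (hj : j < d) {A B : ℝ} (hB : 0 ≤ B)
    (h1 : t j ≤ A - d * B) (h2 : ∀ i < d, i ≠ j → t i ≤ B) : ∑ i ∈ Finset.range d, t i ≤ A := by
  rw [← Finset.add_sum_erase _ _ (Finset.mem_range.2 hj)]
  have h3 : ∑ i ∈ (Finset.range d).erase j, t i ≤ d * B := by
    refine (Finset.sum_le_card_nsmul _ _ B fun i hi => ?_).trans ?_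
    · rw [Finset.mem_erase, Finset.mem_range] at hi
      exact h2 i hi.2 hi.1
    · rw [nsmul_eq_mul]
      gcongr
      exact (Finset.card_erase_le).trans_eq (Finset.card_range d)
  linarith

namespace IsNeutralExpanding

variable {d : ℕ} {β K M ρ c : ℝ} {F F' : ℝ → ℝ}

theorem middleBound_pos : 0 < middleBound K M ρ := by unfold middleBound; positivity

/-- By the Harnack bound, `h x / R` is a lower bound for h on the whole middle interval. That
interval has length at least 1/2 and the total mass is one, whence `h x / R ≤ 2`. -/
theorem admissible_le_middleBound (H : IsNeutralExpanding d β K M ρ c F F') {h : ℝ → ℝ}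
    (hh : IsAdmissibleDensity d β K M ρ c h) {x : ℝ} (hx : x ∈ Icc ρ (1 - ρ)) :
    h x ≤ middleBound K M ρ := by
  have hρ := H.ρ_pos
  have hρ' := H.ρ_le
  set R := Real.exp (K * (distortionScale M (1 - ρ) - distortionScale M ρ)) with hR
  have hR0 : 0 < R := Real.exp_pos _
  have h1 : ENNReal.ofReal (h x / R) * ENNReal.ofReal (1 - ρ - ρ) ≤ 1 := by
    rw [← Real.volume_Icc, ← setLIntegral_const, ← hh.lintegral_eq_one]
    refine (setLIntegral_mono' measurableSet_Icc fun z hz => ?_).trans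
      (lintegral_mono_set fun z hz => ⟨by linarith [hz.1], by linarith [hz.2]⟩)
    refine ENNReal.ofReal_le_ofReal ?_
    rw [div_le_iff₀ hR0]
    exact hh.logDistortion.le_mul_on_Icc H.K_nonneg H.M_nonneg hρ hh.pos hx hz
  have hx0 : 0 < h x := hh.pos x ⟨by linarith [hx.1], by linarith [hx.2]⟩
  rw [← ENNReal.ofReal_mul (by positivity), ENNReal.ofReal_le_one] at h1
  have h2 : h x / R ≤ 2 := by
    have : 0 < h x / R := by positivity
    nlinarith
  rw [div_le_iff₀ hR0] at h2
  exact h2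

/-- Distances to the ends at most double under F, and 2ρ ≤ 1/2, so a value at distance at least 1/2
from both 0 and d cannot come from a point within ρ of an end. -/
theorem unitInv_mem_middle (H : IsNeutralExpanding d β K M ρ c F F') {t : ℝ} (h1 : 1 / 2 ≤ t)
    (h2 : t ≤ d - 1 / 2) : unitInv F t ∈ Icc ρ (1 - ρ) := by
  have hρ := H.ρ_pos
  have hρ' := H.ρ_le
  have ht : t ∈ Icc (0 : ℝ) d := ⟨by linarith, by linarith⟩
  have hG := H.unitInv_mem_Icc ht
  have hF := H.map_unitInv ht
  constructor
  · by_contra! hlt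
    have h3 := H.strictMonoOn hG ⟨hρ.le, by linarith⟩ hlt
    have h4 := H.map_le_two_mul (right_mem_Icc.2 hρ.le)
    linarith
  · by_contra! hlt
    have h3 := H.strictMonoOn ⟨by linarith, by linarith⟩ hG hlt
    have h4 := H.sub_map_le_two_mul (right_mem_Icc.2 hρ.le)
    linarith

/-- The maximum with 1 in `poleBound` is there so that Lebesgue measure itself belongs to the class.
-/
theorem admissible_one (H : IsNeutralExpanding d β K M ρ c F F') :
    IsAdmissibleDensity d β K M ρ c fun _ => 1 := by
  have key : ∀ x ∈ Ioo 0 ρ, 1 ≤ poleBound d K M ρ c * x ^ (-β) := fun x hx => by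
    have h1 : 1 ≤ x ^ (-β) := Real.one_le_rpow_of_pos_of_le_one_of_nonpos hx.1
      (by linarith [hx.2, H.ρ_le]) (by linarith [H.β_pos])
    have h2 : 1 ≤ poleBound d K M ρ c := le_max_left _ _
    nlinarith
  refine ⟨fun _ _ => one_pos, continuousOn_const, fun x y hx hxy hy => ?_, by simp, key, key⟩
  have h1 := distortionScale_strictMono H.M_nonneg hx hxy hy
  have h2 := Real.one_le_exp (mul_nonneg H.K_nonneg (sub_nonneg.2 h1.le))
  simpa using h2

/-- With a the pole constant, a u^(−β)/p ≤ a v^(−β) − a c/p. Since p ≤ 2, the gain a c/p is at least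
a c/2, and a was chosen so that this covers d times the middle bound. -/
theorem pole_step (H : IsNeutralExpanding d β K M ρ c F F') {u v p hv : ℝ} (hp : 1 < p)
    (hp2 : p ≤ 2) (hgrow : u ^ (-β) + c ≤ v ^ (-β) * p)
    (hle : hv ≤ poleBound d K M ρ c * u ^ (-β)) :
    hv * p⁻¹ ≤ poleBound d K M ρ c * v ^ (-β) - d * middleBound K M ρ := by
  have hc := H.c_pos
  have h0 : 2 * (d * middleBound K M ρ) ≤ poleBound d K M ρ c * c := by
    rw [← div_le_iff₀ hc]; exact le_max_right _ _
  have h1 : 1 ≤ poleBound d K M ρ c := le_max_left _ _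
  set a := poleBound d K M ρ c
  have h3 : a * (u ^ (-β) + c) ≤ a * (v ^ (-β) * p) := by gcongr
  have h4 : 0 ≤ d * middleBound K M ρ := mul_nonneg (Nat.cast_nonneg d) middleBound_pos.le
  rw [← div_eq_mul_inv, div_le_iff₀ (by linarith)]
  nlinarith

/-- A point near an end has exactly one preimage whose density may be singular, namely the one on
the branch fixing that end; it is even closer to the end and `pole_step` applies. The other
preimages lie in the middle, where the density is bounded. -/
theorem admissible_transfer (H : IsNeutralExpanding d β K M ρ c F F') {h : ℝ → ℝ}
    (hh : IsAdmissibleDensity d β K M ρ c h) :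
    IsAdmissibleDensity d β K M ρ c (transfer d F F' h) := by
  have hρ := H.ρ_pos
  have hρ' := H.ρ_le
  have hd : (2 : ℝ) ≤ d := by exact_mod_cast H.two_le
  have hmid : ∀ i < d, ∀ x ∈ Ioo (0 : ℝ) 1, 1 / 2 ≤ x + i → x + i ≤ d - 1 / 2 →
      branchTransfer F F' i h x ≤ middleBound K M ρ := fun i hi x hx h1 h2 =>
    (H.branchTransfer_le hi hh.pos hx).trans
      (H.admissible_le_middleBound hh (H.unitInv_mem_middle h1 h2))
  refine ⟨fun x hx => ?_, ?_, ?_, ?_, fun x hx => ?_, fun x hx => ?_⟩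
  · exact Finset.sum_pos (fun i hi => H.branchTransfer_pos (Finset.mem_range.1 hi) hh.pos hx)
      ⟨0, Finset.mem_range.2 (by linarith [H.two_le])⟩
  · exact continuousOn_finsetSum _ fun i hi =>
      H.continuousOn_branchTransfer (Finset.mem_range.1 hi) hh.continuousOn
  · exact HasLogDistortion.sum fun i hi =>
      H.hasLogDistortion_branchTransfer (Finset.mem_range.1 hi) hh.pos hh.logDistortion
  · have := H.lintegral_comp_mul (ψ := fun _ => 1) measurable_const hh.pos hh.continuousOn
    simp only [one_mul] at this
    rw [← this, hh.lintegral_eq_one]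
  · have hxI : x ∈ Ioo (0 : ℝ) 1 := ⟨hx.1, by linarith [hx.2]⟩
    have hd0 : 0 < d := by linarith [H.two_le]
    refine Finset.sum_range_le_of_one hd0 (middleBound_pos (K := K) (M := M) (ρ := ρ)).le
      ?_ fun i hi hi0 => ?_
    · have hy := H.branch_mem_Ioo hd0 hxI
      have hFy := H.map_branch hd0 hxI
      have hlt := H.lt_map hy
      unfold branchTransfer
      rw [Nat.cast_zero, add_zero] at hy hFy hlt ⊢
      have hyρ : unitInv F x ∈ Ioo 0 ρ := ⟨hy.1, by linarith [hx.2]⟩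
      have hg := H.growth_left _ hyρ
      rw [hFy] at hg
      exact H.pole_step (H.one_lt_deriv _ hy) (H.deriv_le_left _ hyρ) hg (hh.le_left _ hyρ)
    · have h1 : (1 : ℝ) ≤ i := by exact_mod_cast Nat.one_le_iff_ne_zero.2 hi0
      have h2 : (i : ℝ) + 1 ≤ d := by exact_mod_cast hi
      exact hmid i hi x hxI (by linarith [hx.1]) (by linarith [hx.2])
  · have hxI : 1 - x ∈ Ioo (0 : ℝ) 1 := ⟨by linarith [hx.2], by linarith [hx.1]⟩
    have hd1 : d - 1 < d := by have := H.two_le; omega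
    have hcast : ((d - 1 : ℕ) : ℝ) = d - 1 := by
      have := H.two_le
      push_cast [Nat.cast_sub (by omega : 1 ≤ d)]; rfl
    refine Finset.sum_range_le_of_one hd1 (middleBound_pos (K := K) (M := M) (ρ := ρ)).le
      ?_ fun i hi hi0 => ?_
    · have hy := H.branch_mem_Ioo hd1 hxI
      have hFy := H.map_branch hd1 hxI
      unfold branchTransfer
      rw [hcast] at hy hFy ⊢
      set y := unitInv F (1 - x + (d - 1)) with hydef
      have hlt := H.lt_sub_map (x := 1 - y) ⟨by linarith [hy.2], by linarith [hy.1]⟩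
      rw [sub_sub_cancel] at hlt
      have hyρ : 1 - y ∈ Ioo 0 ρ := ⟨by linarith [hy.2], by linarith [hx.2]⟩
      have hg := H.growth_right _ hyρ
      rw [sub_sub_cancel, hFy, show (d : ℝ) - (1 - x + (d - 1)) = x by ring] at hg
      have h2 := H.deriv_le_right _ hyρ
      have h3 := hh.le_right _ hyρ
      rw [sub_sub_cancel] at h2 h3
      exact H.pole_step (H.one_lt_deriv _ hy) h2 hg h3
    · have h2 : (i : ℝ) + 2 ≤ d := by exact_mod_cast (by omega : i + 2 ≤ d)
      have h1 : (0 : ℝ) ≤ i := Nat.cast_nonneg i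
      exact hmid i hi _ hxI (by linarith [hx.2]) (by linarith [hx.1])

end IsNeutralExpanding

/-- An integrable function dominating all admissible densities. -/
def dominatingDensity (d : ℕ) (β K M ρ c x : ℝ) : ℝ :=
  poleBound d K M ρ c * x ^ (-β) + middleBound K M ρ + poleBound d K M ρ c * (1 - x) ^ (-β)

/-- A finite measure dominating all measures with an admissible density. -/
def dominatingMeasure (d : ℕ) (β K M ρ c : ℝ) : Measure S1 :=
  ((volume.restrict (Ioo (0 : ℝ) 1)).withDensity fun x =>
    ENNReal.ofReal (dominatingDensity d β K M ρ c x)).map ((↑) : ℝ → S1)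

theorem dominatingMeasure_absolutelyContinuous (d : ℕ) (β K M ρ c : ℝ) :
    dominatingMeasure d β K M ρ c ≪ volume := by
  rw [volume_circle_eq]
  exact (withDensity_absolutelyContinuous _ _).map measurable_coe_circle

theorem isFiniteMeasure_dominatingMeasure (d : ℕ) {β : ℝ} (K M ρ c : ℝ) (hβ : β < 1) :
    IsFiniteMeasure (dominatingMeasure d β K M ρ c) := by
  have h1 : IntervalIntegrable (fun x : ℝ => x ^ (-β)) volume 0 1 :=
    intervalIntegral.intervalIntegrable_rpow' (by linarith)
  have h2 : IntervalIntegrable (fun x : ℝ => (1 - x) ^ (-β)) volume 0 1 := by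
    simpa using (h1.comp_sub_left 1).symm
  have h3 : IntervalIntegrable (dominatingDensity d β K M ρ c) volume 0 1 :=
    ((h1.const_mul _).add intervalIntegrable_const).add (h2.const_mul _)
  rw [intervalIntegrable_iff_integrableOn_Ioo_of_le zero_le_one] at h3
  have := isFiniteMeasure_withDensity_ofReal h3.2
  unfold dominatingMeasure
  infer_instance

namespace IsNeutralExpanding

variable {d : ℕ} {β K M ρ c : ℝ} {F F' : ℝ → ℝ}

theorem admissible_le_dominatingDensity (H : IsNeutralExpanding d β K M ρ c F F') {h : ℝ → ℝ}
    (hh : IsAdmissibleDensity d β K M ρ c h) {x : ℝ} (hx : x ∈ Ioo (0 : ℝ) 1) :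
    h x ≤ dominatingDensity d β K M ρ c x := by
  have hx' : 0 < 1 - x := by linarith [hx.2]
  have h0 : 0 < poleBound d K M ρ c := lt_of_lt_of_le one_pos (le_max_left _ _)
  have h1 : 0 < poleBound d K M ρ c * x ^ (-β) := mul_pos h0 (Real.rpow_pos_of_pos hx.1 _)
  have h2 : 0 < poleBound d K M ρ c * (1 - x) ^ (-β) := mul_pos h0 (Real.rpow_pos_of_pos hx' _)
  have h3 := middleBound_pos (K := K) (M := M) (ρ := ρ)
  unfold dominatingDensity
  rcases lt_or_ge x ρ with h4 | h4
  · linarith [hh.le_left x ⟨hx.1, h4⟩]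
  rcases lt_or_ge (1 - ρ) x with h5 | h5
  · have := hh.le_right (1 - x) ⟨hx', by linarith⟩
    rw [sub_sub_cancel] at this
    linarith
  · linarith [H.admissible_le_middleBound hh ⟨h4, h5⟩]

theorem continuous_circleMapOf (H : IsNeutralExpanding d β K M ρ c F F') :
    Continuous (circleMapOf F) := by
  refine AddCircle.liftIco_zero_continuous (f := fun x => ((F x : ℝ) : S1)) ?_
    ((AddCircle.continuous_mk' (1 : ℝ)).comp_continuousOn H.continuousOn)
  have := coe_add_natCast 0 d
  rw [zero_add] at this
  rw [H.map_zero, H.map_one, this]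

theorem exists_density_iterate (H : IsNeutralExpanding d β K M ρ c F F') (n : ℕ) :
    ∃ h : ℝ → ℝ, IsAdmissibleDensity d β K M ρ c h ∧
      (volume : Measure S1).map (circleMapOf F)^[n] =
        ((volume.restrict (Ioo (0 : ℝ) 1)).withDensity fun x => ENNReal.ofReal (h x)).map
          ((↑) : ℝ → S1) := by
  have hcont := H.continuous_circleMapOf
  induction n with
  | zero =>
    refine ⟨fun _ => 1, H.admissible_one, ?_⟩
    simp [volume_circle_eq]
  | succ n ih =>
    obtain ⟨h, hh, heq⟩ := ih
    refine ⟨transfer d F F' h, H.admissible_transfer hh, ?_⟩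
    rw [Function.iterate_succ', ← Measure.map_map hcont.measurable (hcont.iterate n).measurable, heq,
      Measure.map_map hcont.measurable measurable_coe_circle]
    have hm : ∀ {h : ℝ → ℝ}, IsAdmissibleDensity d β K M ρ c h →
        AEMeasurable (fun x => ENNReal.ofReal (h x)) (volume.restrict (Ioo (0 : ℝ) 1)) := fun hh =>
      (hh.continuousOn.aemeasurable measurableSet_Ioo).ennreal_ofReal
    ext s hs
    have hψ : Measurable (s.indicator (1 : S1 → ENNReal)) := measurable_one.indicator hs
    have key := H.lintegral_comp_mul hψ hh.pos hh.continuousOn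
    have e : ∀ (T : ℝ → S1), Measurable T → ∀ {h : ℝ → ℝ}, IsAdmissibleDensity d β K M ρ c h →
        (((volume.restrict (Ioo (0 : ℝ) 1)).withDensity fun x => ENNReal.ofReal (h x)).map T) s =
          ∫⁻ x in Ioo (0 : ℝ) 1, s.indicator 1 (T x) * ENNReal.ofReal (h x) := fun T hT h hh => by
      rw [Measure.map_apply hT hs, withDensity_apply _ (hT hs), ← lintegral_indicator (hT hs)]
      refine lintegral_congr fun x => ?_
      by_cases hx : T x ∈ s
      · rw [indicator_of_mem (show x ∈ T ⁻¹' s from hx), indicator_of_mem hx]; simp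
      · rw [indicator_of_notMem (show x ∉ T ⁻¹' s from hx), indicator_of_notMem hx]; simp
    rw [e _ (hcont.measurable.comp measurable_coe_circle) hh,
      e _ measurable_coe_circle (H.admissible_transfer hh), ← key]
    refine setLIntegral_congr_fun measurableSet_Ioo fun x hx => ?_
    simp only [Function.comp_apply, circleMapOf_coe F (Ioo_subset_Ico_self hx)]

theorem map_iterate_le (H : IsNeutralExpanding d β K M ρ c F F') (n : ℕ) :
    (volume : Measure S1).map (circleMapOf F)^[n] ≤ dominatingMeasure d β K M ρ c := by
  obtain ⟨h, hh, heq⟩ := H.exists_density_iterate n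
  rw [heq]
  refine Measure.map_mono ?_ measurable_coe_circle
  refine withDensity_mono ((ae_restrict_iff' measurableSet_Ioo).2 (Eventually.of_forall fun x hx => ?_))
  exact ENNReal.ofReal_le_ofReal (H.admissible_le_dominatingDensity hh hx)

/-- All Cesàro averages of Lebesgue measure lie below a measure that depends only on the constants,
and this bound passes to the weak limit. -/
theorem exists_acip (H : IsNeutralExpanding d β K M ρ c F F') :
    ∃ μ : ProbabilityMeasure S1, IsACIP (circleMapOf F) μ ∧
      (μ : Measure S1) ≤ dominatingMeasure d β K M ρ c := by
  have hprob : IsProbabilityMeasure (volume : Measure S1) := ⟨UnitAddCircle.measure_univ⟩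
  have hfin := isFiniteMeasure_dominatingMeasure d K M ρ c H.β_lt
  obtain ⟨μ, hμ, L, s, hs, hlim⟩ := exists_invariant_of_cesaro H.continuous_circleMapOf
    (⟨volume, hprob⟩ : ProbabilityMeasure S1)
  have hle : (μ : Measure S1) ≤ dominatingMeasure d β K M ρ c :=
    ProbabilityMeasure.toMeasure_le_of_tendsto hlim (Eventually.of_forall fun n => by
      rw [hs n]; exact cesaro_le H.map_iterate_le n)
  exact ⟨μ, ⟨hμ, (Measure.absolutelyContinuous_of_le hle).trans
    (dominatingMeasure_absolutelyContinuous d β K M ρ c)⟩, hle⟩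

end IsNeutralExpanding

/-! ### Inverse branches of iterates and ergodicity -/

/-- `g`, with derivative `v`, has the distortion properties of an inverse branch of an iterate, and
it respects membership in the invariant set `A`. -/
structure IsInverseBranch (K M : ℝ) (A : Set S1) (g v : ℝ → ℝ) : Prop where
  mapsTo : ∀ x ∈ Ioo (0 : ℝ) 1, g x ∈ Ioo (0 : ℝ) 1
  hasDerivAt : ∀ x ∈ Ioo (0 : ℝ) 1, HasDerivAt g (v x) x
  pos : ∀ x ∈ Ioo (0 : ℝ) 1, 0 < v x
  logDistortion : HasLogDistortion K M v
  mem_iff : ∀ x ∈ Ioo (0 : ℝ) 1, (g x : S1) ∈ A ↔ (x : S1) ∈ A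

theorem IsInverseBranch.strictMonoOn {K M : ℝ} {A : Set S1} {g v : ℝ → ℝ}
    (h : IsInverseBranch K M A g v) : StrictMonoOn g (Ioo 0 1) := by
  refine strictMonoOn_of_deriv_pos (convex_Ioo 0 1)
    (fun x hx => (h.hasDerivAt x hx).continuousAt.continuousWithinAt) fun x hx => ?_
  rw [interior_Ioo] at hx
  rw [(h.hasDerivAt x hx).deriv]
  exact h.pos x hx

theorem IsInverseBranch.image_Icc {K M : ℝ} {A : Set S1} {g v : ℝ → ℝ}
    (h : IsInverseBranch K M A g v) {σ : ℝ} (h0 : 0 < σ) (h1 : σ < 1 / 2) :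
    g '' Icc σ (1 - σ) = Icc (g σ) (g (1 - σ)) := by
  have hsub : Icc σ (1 - σ) ⊆ Ioo 0 1 := fun x hx => ⟨by linarith [hx.1], by linarith [hx.2]⟩
  refine subset_antisymm ?_ (intermediate_value_Icc (by linarith) fun x hx =>
    (h.hasDerivAt x (hsub hx)).continuousAt.continuousWithinAt)
  rintro _ ⟨x, hx, rfl⟩
  have hm := h.strictMonoOn.monotoneOn
  exact ⟨hm (hsub (left_mem_Icc.2 (by linarith))) (hsub hx) hx.1,
    hm (hsub hx) (hsub (right_mem_Icc.2 (by linarith))) hx.2⟩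

/-- Such an orbit increases to a limit in (0, ρ], which by continuity would be a fixed point of φ.
-/
theorem not_orbit_of_lt_map {φ : ℝ → ℝ} {ρ : ℝ} (hφ : ContinuousOn φ (Icc 0 ρ))
    (hlt : ∀ x ∈ Ioc 0 ρ, x < φ x) {u : ℕ → ℝ} (hu : ∀ n, u n ∈ Ioo 0 ρ)
    (hs : ∀ n, u (n + 1) = φ (u n)) : False := by
  have hmono : Monotone u := monotone_nat_of_le_succ fun n => by
    rw [hs]; exact (hlt _ (Ioo_subset_Ioc_self (hu n))).le
  have hbdd : BddAbove (range u) := ⟨ρ, by rintro _ ⟨n, rfl⟩; exact (hu n).2.le⟩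
  have hlim := tendsto_atTop_ciSup hmono hbdd
  set L := ⨆ n, u n
  have hL : L ∈ Ioc 0 ρ :=
    ⟨(hu 0).1.trans_le (le_ciSup hbdd 0), ciSup_le fun n => (hu n).2.le⟩
  have h1 : Tendsto (fun n => φ (u n)) atTop (𝓝 (φ L)) :=
    (hφ L (Ioc_subset_Icc_self hL)).tendsto.comp (tendsto_nhdsWithin_iff.2
      ⟨hlim, Eventually.of_forall fun n => Ioo_subset_Icc_self (hu n)⟩)
  have h2 := (tendsto_add_atTop_iff_nat 1).2 hlim
  simp only [hs] at h2
  exact (hlt L hL).ne (tendsto_nhds_unique h2 h1)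

/-- The circle map with lift `F`, acting on `[0, 1)`. -/
def fractMap (F : ℝ → ℝ) (x : ℝ) : ℝ := Int.fract (F x)

namespace IsNeutralExpanding

variable {d : ℕ} {β K M ρ c : ℝ} {F F' : ℝ → ℝ}

theorem isInverseBranch_id (H : IsNeutralExpanding d β K M ρ c F F') (A : Set S1) :
    IsInverseBranch K M A id fun _ => 1 :=
  ⟨fun _ hx => hx, fun x _ => hasDerivAt_id x, fun _ _ => one_pos, H.admissible_one.logDistortion,
    fun _ _ => Iff.rfl⟩

/-- By the chain rule, derivatives of inverse branches evolve like the summands of the transfer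
operator, so the distortion lemma for densities applies verbatim. -/
theorem isInverseBranch_comp (H : IsNeutralExpanding d β K M ρ c F F') {A : Set S1}
    (hA : circleMapOf F ⁻¹' A = A) {g v : ℝ → ℝ} (h : IsInverseBranch K M A g v) {i : ℕ}
    (hi : i < d) :
    IsInverseBranch K M A (fun x => g (unitInv F (x + i))) (branchTransfer F F' i v) := by
  refine ⟨fun x hx => h.mapsTo _ (H.branch_mem_Ioo hi hx), fun x hx => ?_,
    fun x hx => H.branchTransfer_pos hi h.pos hx,
    H.hasLogDistortion_branchTransfer hi h.pos h.logDistortion, fun x hx => ?_⟩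
  · exact (h.hasDerivAt _ (H.branch_mem_Ioo hi hx)).comp x (H.hasDerivAt_branch hi hx)
  · have hy := H.branch_mem_Ioo hi hx
    rw [h.mem_iff _ hy]
    conv_lhs => rw [← hA]
    rw [mem_preimage, circleMapOf_coe F (Ioo_subset_Ico_self hy), H.map_branch hi hx,
      coe_add_natCast]

theorem exists_branch_index (H : IsNeutralExpanding d β K M ρ c F F') {p : ℝ}
    (hp : p ∈ Ioo (0 : ℝ) 1) : ∃ i < d, F p = fractMap F p + i := by
  have hF := H.map_mem_Ioo hp
  have h0 : 0 ≤ ⌊F p⌋ := Int.floor_nonneg.2 hF.1.le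
  have h1 : ((⌊F p⌋.toNat : ℤ) : ℝ) = ⌊F p⌋ := by rw [Int.toNat_of_nonneg h0]
  have h2 : ((⌊F p⌋.toNat : ℕ) : ℝ) = ⌊F p⌋ := by exact_mod_cast h1
  refine ⟨⌊F p⌋.toNat, ?_, ?_⟩
  · have : ((⌊F p⌋.toNat : ℕ) : ℝ) < d := by rw [h2]; exact (Int.floor_le _).trans_lt hF.2
    exact_mod_cast this
  · rw [h2, fractMap, Int.fract_add_floor]

/-- At each step the branch through the actual orbit point of p is chosen. The derivative at the
endpoint is then the reciprocal of the expansion accumulated along the orbit. -/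
theorem exists_inverseBranch (H : IsNeutralExpanding d β K M ρ c F F') {A : Set S1}
    (hA : circleMapOf F ⁻¹' A = A) {p : ℝ} (hp : ∀ n, (fractMap F)^[n] p ∈ Ioo (0 : ℝ) 1) (n : ℕ) :
    ∃ g v, IsInverseBranch K M A g v ∧ g ((fractMap F)^[n] p) = p ∧
      v ((fractMap F)^[n] p) * ∏ j ∈ Finset.range n, F' ((fractMap F)^[j] p) = 1 := by
  induction n with
  | zero => exact ⟨id, fun _ => 1, H.isInverseBranch_id A, rfl, by simp⟩
  | succ n ih =>
    obtain ⟨g, v, h, hg, hv⟩ := ih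
    obtain ⟨i, hi, hFi⟩ := H.exists_branch_index (hp n)
    set q := (fractMap F)^[n] p with hq
    have hq' : (fractMap F)^[n + 1] p = fractMap F q := Function.iterate_succ_apply' _ _ _
    have hinv : unitInv F (fractMap F q + i) = q := by
      rw [← hFi, H.unitInv_map (Ioo_subset_Icc_self (hp n))]
    refine ⟨_, _, H.isInverseBranch_comp hA h hi, ?_, ?_⟩
    · rw [hq', hinv, hg]
    · have h1 := H.one_lt_deriv q (hp n)
      rw [Finset.prod_range_succ, ← hq, hq', branchTransfer, hinv]
      have h2 : F' q ≠ 0 := by linarith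
      calc _ = (v q * ∏ j ∈ Finset.range n, F' ((fractMap F)^[j] p)) * ((F' q)⁻¹ * F' q) := by ring
        _ = 1 := by rw [hv, inv_mul_cancel₀ h2, one_mul]

/-- Near an end one step at most doubles the distance to that end, so an orbit avoiding the middle
cannot change sides. Staying at one end is excluded by `not_orbit_of_lt_map`. -/
theorem exists_visit (H : IsNeutralExpanding d β K M ρ c F F') {p : ℝ}
    (hp : ∀ n, (fractMap F)^[n] p ∈ Ioo (0 : ℝ) 1) (N : ℕ) :
    ∃ n ≥ N, (fractMap F)^[n] p ∈ Icc ρ (1 - ρ) := by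
  have hρ := H.ρ_pos
  have hρ' := H.ρ_le
  by_contra! hno
  set u : ℕ → ℝ := fun m => (fractMap F)^[N + m] p with hu
  have hstep : ∀ m, u (m + 1) = fractMap F (u m) := fun m => Function.iterate_succ_apply' _ _ _
  have huI : ∀ m, u m ∈ Ioo (0 : ℝ) 1 := fun m => hp _
  have hout : ∀ m, u m < ρ ∨ 1 - ρ < u m := fun m => by
    have := hno (N + m) (Nat.le_add_right _ _)
    by_contra! h
    exact this ⟨h.1, h.2⟩
  have hleft : ∀ m, u m < ρ → u (m + 1) = F (u m) ∧ u (m + 1) < ρ := fun m hm => by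
    have h1 := H.map_le_two_mul (x := u m) ⟨(huI m).1.le, hm.le⟩
    have h2 := (H.map_mem_Ioo (huI m)).1
    have h3 : u (m + 1) = F (u m) := by
      rw [hstep, fractMap, Int.fract_eq_self]; exact ⟨h2.le, by linarith⟩
    refine ⟨h3, (hout (m + 1)).resolve_right fun h => ?_⟩
    rw [h3] at h
    linarith
  have hright : ∀ m, 1 - ρ < u m → 1 - u (m + 1) = d - F (1 - (1 - u m)) ∧ 1 - ρ < u (m + 1) :=
    fun m hm => by
      have h1 := H.sub_map_le_two_mul (x := 1 - u m) ⟨by linarith [(huI m).2], by linarith⟩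
      have h2 := (H.map_mem_Ioo (huI m)).2
      have h3 : 1 - u (m + 1) = d - F (1 - (1 - u m)) := by
        rw [sub_sub_cancel] at h1 ⊢
        -- Close to 1 the point lies on the last branch, so the integer part of its image is d − 1.
        have h4 : u (m + 1) = F (u m) - ((d - 1 : ℤ) : ℝ) := by
          rw [hstep, fractMap, ← Int.fract_sub_intCast (F (u m)) (d - 1 : ℤ), Int.fract_eq_self]
          push_cast
          exact ⟨by linarith, by linarith⟩
        rw [h4]; push_cast; ring
      refine ⟨h3, (hout (m + 1)).resolve_left fun h => ?_⟩
      linarith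
  rcases hout 0 with h0 | h0
  · have hall : ∀ m, u m < ρ := fun m => by
      induction m with
      | zero => exact h0
      | succ m ih => exact (hleft m ih).2
    refine not_orbit_of_lt_map (φ := F) (ρ := ρ)
      (H.continuousOn.mono (Icc_subset_Icc_right (by linarith)))
      (fun x hx => H.lt_map ⟨hx.1, by linarith [hx.2]⟩) (u := u)
      (fun n => ⟨(huI n).1, hall n⟩) fun n => (hleft n (hall n)).1
  · have hall : ∀ m, 1 - ρ < u m := fun m => by
      induction m with
      | zero => exact h0
      | succ m ih => exact (hright m ih).2
    refine not_orbit_of_lt_map (φ := fun x => d - F (1 - x)) (ρ := ρ) ?_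
      (fun x hx => H.lt_sub_map ⟨hx.1, by linarith [hx.2]⟩) (u := fun n => 1 - u n)
      (fun n => ⟨by linarith [(huI n).2], by linarith [hall n]⟩) fun n => (hright n (hall n)).1
    refine continuousOn_const.sub (H.continuousOn.comp (by fun_prop) fun x hx => ?_)
    exact ⟨by linarith [hx.2], by linarith [hx.1]⟩

/-- F' has a minimum larger than 1 on the compact middle interval. Each of the infinitely many
visits multiplies the product by at least this number, and the other steps do not decrease it. -/
theorem exists_visit_prod_ge (H : IsNeutralExpanding d β K M ρ c F F') {p : ℝ}
    (hp : ∀ n, (fractMap F)^[n] p ∈ Ioo (0 : ℝ) 1) (B : ℝ) :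
    ∃ n, (fractMap F)^[n] p ∈ Icc ρ (1 - ρ) ∧
      B ≤ ∏ j ∈ Finset.range n, F' ((fractMap F)^[j] p) := by
  have hρ := H.ρ_pos
  have hρ' := H.ρ_le
  set P : ℕ → ℝ := fun n => ∏ j ∈ Finset.range n, F' ((fractMap F)^[j] p) with hP
  have hsub : Icc ρ (1 - ρ) ⊆ Ioo 0 1 := fun x hx => ⟨by linarith [hx.1], by linarith [hx.2]⟩
  obtain ⟨x₀, hx₀, hmin⟩ := isCompact_Icc.exists_isMinOn (nonempty_Icc.2 (by linarith : ρ ≤ 1 - ρ))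
    (H.continuousOn_deriv.mono hsub)
  have hl := H.one_lt_deriv x₀ (hsub hx₀)
  have hpos : ∀ n, 0 < P n := fun n => Finset.prod_pos fun j _ => by
    linarith [H.one_lt_deriv _ (hp j)]
  have hmono : Monotone P := monotone_nat_of_le_succ fun n => by
    simp only [hP, Finset.prod_range_succ]
    exact le_mul_of_one_le_right (hpos n).le (H.one_lt_deriv _ (hp n)).le
  have hk : ∀ k : ℕ, ∃ n, F' x₀ ^ k ≤ P n := fun k => by
    induction k with
    | zero => exact ⟨0, by simp [hP]⟩
    | succ k ih =>
      obtain ⟨n, hn⟩ := ih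
      obtain ⟨m, hm, hmem⟩ := H.exists_visit hp n
      refine ⟨m + 1, ?_⟩
      have h1 : P (m + 1) = P m * F' ((fractMap F)^[m] p) := Finset.prod_range_succ _ _
      rw [h1, pow_succ]
      exact mul_le_mul (hn.trans (hmono hm)) (hmin hmem) (by linarith) (hpos m).le
  obtain ⟨k, hkB⟩ := pow_unbounded_of_one_lt B hl
  obtain ⟨n, hn⟩ := hk k
  obtain ⟨m, hm, hmem⟩ := H.exists_visit hp n
  exact ⟨m, hmem, hkB.le.trans (hn.trans (hmono hm))⟩

/-- The excluded points are those that reach 0 after finitely many steps, and there are countably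
many of them. -/
theorem ae_orbit_mem_Ioo (H : IsNeutralExpanding d β K M ρ c F F') :
    ∀ᵐ p : ℝ, p ∈ Ioo (0 : ℝ) 1 → ∀ n, (fractMap F)^[n] p ∈ Ioo (0 : ℝ) 1 := by
  have hcount : ∀ n, {p : ℝ | p ∈ Ico (0 : ℝ) 1 ∧ (fractMap F)^[n] p = 0}.Countable := fun n => by
    induction n with
    | zero => exact (countable_singleton (0 : ℝ)).mono fun p hp => hp.2
    | succ n ih =>
      refine (countable_iUnion fun i : ℤ => ih.image fun q => unitInv F (q + i)).mono ?_
      rintro p ⟨hp, hn⟩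
      refine mem_iUnion.2 ⟨⌊F p⌋, fractMap F p, ⟨⟨Int.fract_nonneg _, Int.fract_lt_one _⟩, hn⟩, ?_⟩
      simp only [fractMap, Int.fract_add_floor]
      exact H.unitInv_map (Ico_subset_Icc_self hp)
  have hnull := (countable_iUnion hcount).ae_notMem (volume : Measure ℝ)
  filter_upwards [hnull] with p hp hpI n
  have hne : ∀ n, (fractMap F)^[n] p ≠ 0 := fun n h =>
    hp (mem_iUnion.2 ⟨n, Ioo_subset_Ico_self hpI, h⟩)
  cases n with
  | zero => exact hpI
  | succ n =>
    have h1 := hne (n + 1)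
    rw [Function.iterate_succ_apply'] at h1 ⊢
    exact ⟨(Int.fract_nonneg _).lt_of_ne' h1, Int.fract_lt_one _⟩

end IsNeutralExpanding

/-- Images of an inverse branch contain a definite proportion of the invariant set. -/
theorem IsInverseBranch.volume_inter_image_ge {K M : ℝ} {A : Set S1} {g v : ℝ → ℝ}
    (h : IsInverseBranch K M A g v) (hA : MeasurableSet A) (hK : 0 ≤ K) (hM : 0 ≤ M) {σ : ℝ}
    (hσ : 0 < σ) (hσ2 : σ < 1 / 2) {x₀ : ℝ} (hx₀ : x₀ ∈ Icc σ (1 - σ)) {R : ℝ}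
    (hR : R = Real.exp (K * (distortionScale M (1 - σ) - distortionScale M σ))) :
    volume (Icc (g σ) (g (1 - σ))) ≤ ENNReal.ofReal (v x₀ * R) ∧
      ENNReal.ofReal (v x₀ / R) * volume ((↑) ⁻¹' A ∩ Icc σ (1 - σ) : Set ℝ) ≤
        volume ((↑) ⁻¹' A ∩ Icc (g σ) (g (1 - σ)) : Set ℝ) := by
  have hsub : Icc σ (1 - σ) ⊆ Ioo 0 1 := fun x hx => ⟨by linarith [hx.1], by linarith [hx.2]⟩
  have hR0 : 0 < R := hR ▸ Real.exp_pos _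
  have himage : ∀ s : Set ℝ, MeasurableSet s → s ⊆ Icc σ (1 - σ) →
      volume (g '' s) = ∫⁻ x in s, ENNReal.ofReal (v x) := fun s hs hss => by
    have := lintegral_image_eq_lintegral_abs_deriv_mul hs
      (fun x hx => (h.hasDerivAt x (hsub (hss hx))).hasDerivWithinAt)
      (h.strictMonoOn.injOn.mono (hss.trans hsub)) (fun _ => 1)
    rw [setLIntegral_one] at this
    rw [this]
    refine setLIntegral_congr_fun hs fun x hx => ?_
    simp only [mul_one, abs_of_pos (h.pos x (hsub (hss hx)))]
  have hbound : ∀ x z, x ∈ Icc σ (1 - σ) → z ∈ Icc σ (1 - σ) → v x ≤ v z * R := fun x z hx hz =>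
    hR ▸ h.logDistortion.le_mul_on_Icc hK hM hσ h.pos hx hz
  have hmeas : MeasurableSet ((↑) ⁻¹' A ∩ Icc σ (1 - σ) : Set ℝ) :=
    (measurable_coe_circle hA).inter measurableSet_Icc
  constructor
  · rw [← h.image_Icc hσ hσ2, himage _ measurableSet_Icc subset_rfl]
    calc _ ≤ ∫⁻ _ in Icc σ (1 - σ), ENNReal.ofReal (v x₀ * R) :=
          setLIntegral_mono' measurableSet_Icc fun x hx =>
            ENNReal.ofReal_le_ofReal (hbound x x₀ hx hx₀)
      _ = ENNReal.ofReal (v x₀ * R) * ENNReal.ofReal (1 - σ - σ) := by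
          rw [setLIntegral_const, Real.volume_Icc]
      _ ≤ ENNReal.ofReal (v x₀ * R) :=
          mul_le_of_le_one_right' (ENNReal.ofReal_le_one.2 (by linarith))
  · calc _ = ∫⁻ _ in (↑) ⁻¹' A ∩ Icc σ (1 - σ), ENNReal.ofReal (v x₀ / R) := by
          rw [setLIntegral_const]
      _ ≤ ∫⁻ x in (↑) ⁻¹' A ∩ Icc σ (1 - σ), ENNReal.ofReal (v x) :=
          setLIntegral_mono' hmeas fun x hx => ENNReal.ofReal_le_ofReal
            ((div_le_iff₀ hR0).2 (hbound x₀ x hx₀ hx.2))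
      _ = volume (g '' ((↑) ⁻¹' A ∩ Icc σ (1 - σ))) := (himage _ hmeas inter_subset_right).symm
      _ ≤ _ := by
          refine measure_mono ?_
          rintro _ ⟨x, hx, rfl⟩
          refine ⟨(h.mem_iff x (hsub hx.2)).2 hx.1, ?_⟩
          rw [← h.image_Icc hσ hσ2]
          exact mem_image_of_mem g hx.2

theorem exists_Icc_of_volume_Ioo_ne_zero {S : Set ℝ} (h : volume (S ∩ Ioo 0 1) ≠ 0) {ρ : ℝ}
    (hρ : 0 < ρ) : ∃ σ, 0 < σ ∧ σ ≤ ρ ∧ volume (S ∩ Icc σ (1 - σ)) ≠ 0 := by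
  by_contra! hno
  refine h (measure_mono_null ?_ (measure_iUnion_null fun n : ℕ =>
    hno (min ρ (1 / ((n : ℝ) + 1))) (by positivity) (min_le_left _ _)))
  rintro x ⟨hxS, hx⟩
  obtain ⟨n, hn⟩ := exists_nat_one_div_lt (lt_min hx.1 (sub_pos.2 hx.2))
  rw [lt_min_iff] at hn
  have := min_le_right ρ (1 / ((n : ℝ) + 1))
  exact mem_iUnion.2 ⟨n, hxS, by linarith, by linarith⟩

theorem volume_circle_apply {A : Set S1} (hA : MeasurableSet A) :
    volume A = volume ((↑) ⁻¹' A ∩ Ioo 0 1 : Set ℝ) := by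
  rw [volume_circle_eq, Measure.map_apply measurable_coe_circle hA,
    Measure.restrict_apply (measurable_coe_circle hA)]

/-- If A and its complement both had positive measure, choose a density point p of the complement
whose orbit avoids 0. Along returns to the middle with derivative tending to infinity, inverse
branches map [σ, 1 − σ] onto intervals that contain p and shrink to it. By bounded distortion A
occupies at least the proportion s/R² of each, contradicting density. -/
theorem IsNeutralExpanding.isLebesgueErgodic {d : ℕ} {β K M ρ c : ℝ} {F F' : ℝ → ℝ}
    (H : IsNeutralExpanding d β K M ρ c F F') : IsLebesgueErgodic (circleMapOf F) := by
  intro A hA hinv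
  by_contra! hne
  obtain ⟨h1, h2⟩ := hne
  have hρ' := H.ρ_le
  rw [volume_circle_apply hA] at h1
  rw [volume_circle_apply hA.compl] at h2
  -- Shrinking ρ to σ lets [σ, 1 − σ] meet A in positive measure while still containing the interval
  -- to which orbits return.
  obtain ⟨σ, hσ, hσρ, hS⟩ := exists_Icc_of_volume_Ioo_ne_zero h1 H.ρ_pos
  have hσ2 : σ < 1 / 2 := by linarith
  set B : Set ℝ := (↑) ⁻¹' A with hB
  have hBm : MeasurableSet B := measurable_coe_circle hA
  -- The intervals below contain p but need not be centred at it, so the density theorem is taken in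
  -- its form for balls containing the point, with dilation factor 1.
  have hdens := IsUnifLocDoublingMeasure.ae_tendsto_measure_inter_div (volume : Measure ℝ)
    Bᶜ 1
  rw [ae_restrict_iff' hBm.compl] at hdens
  obtain ⟨p, hp, hpd, hporb⟩ : ∃ p ∈ (↑) ⁻¹' Aᶜ ∩ Ioo (0 : ℝ) 1, (p ∈ Bᶜ → _) ∧
      (p ∈ Ioo (0 : ℝ) 1 → ∀ n, (fractMap F)^[n] p ∈ Ioo (0 : ℝ) 1) := by
    by_contra! hno
    refine h2 (measure_mono_null (fun p hp => ?_) (hdens.and H.ae_orbit_mem_Ioo))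
    intro hp'
    obtain ⟨hpI, n, hn⟩ := hno p hp hp'.1
    exact hn (hp'.2 hpI n)
  have horb := hporb hp.2
  set R := Real.exp (K * (distortionScale M (1 - σ) - distortionScale M σ)) with hR
  have hR0 : 0 < R := Real.exp_pos _
  choose n hnmem hnprod using fun k : ℕ => H.exists_visit_prod_ge horb ((k : ℝ) + 1)
  choose g v hbr hgp hvp using fun k : ℕ => H.exists_inverseBranch hinv horb (n k)
  have hmemσ : ∀ k, (fractMap F)^[n k] p ∈ Icc σ (1 - σ) := fun k =>
    ⟨hσρ.trans (hnmem k).1, (hnmem k).2.trans (by linarith)⟩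
  have hest := fun k => (hbr k).volume_inter_image_ge hA H.K_nonneg H.M_nonneg hσ hσ2 (hmemσ k) hR
  have hv0 : ∀ k, 0 < v k ((fractMap F)^[n k] p) := fun k => (hbr k).pos _ (horb _)
  have hvle : ∀ k, v k ((fractMap F)^[n k] p) ≤ 1 / ((k : ℝ) + 1) := fun k => by
    rw [le_div_iff₀ (by positivity)]
    exact (mul_le_mul_of_nonneg_left (hnprod k) (hv0 k).le).trans_eq (hvp k)
  have hpI : ∀ k, p ∈ Icc (g k σ) (g k (1 - σ)) := fun k => by
    rw [← (hbr k).image_Icc hσ hσ2]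
    exact ⟨_, hmemσ k, hgp k⟩
  have hlt : ∀ k, g k σ < g k (1 - σ) := fun k => (hbr k).strictMonoOn
    ⟨hσ, by linarith⟩ ⟨by linarith, by linarith⟩ (by linarith)
  set w : ℕ → ℝ := fun k => (g k σ + g k (1 - σ)) / 2
  set δ : ℕ → ℝ := fun k => (g k (1 - σ) - g k σ) / 2
  have hball : ∀ k, Metric.closedBall (w k) (δ k) = Icc (g k σ) (g k (1 - σ)) := fun k => by
    rw [Real.closedBall_eq_Icc]
    congr 1 <;> simp only [w, δ] <;> ring
  have hδ : Tendsto δ atTop (𝓝[>] 0) := by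
    refine tendsto_nhdsWithin_iff.2 ⟨?_, Eventually.of_forall fun k => by
      simp only [δ, mem_Ioi]; linarith [hlt k]⟩
    have hz : Tendsto (fun k : ℕ => 1 / ((k : ℝ) + 1) * R) atTop (𝓝 0) := by
      simpa using (tendsto_one_div_add_atTop_nhds_zero_nat (𝕜 := ℝ)).mul_const R
    refine squeeze_zero (fun k => by simp only [δ]; linarith [hlt k]) (fun k => ?_) hz
    have h3 := (hest k).1
    rw [Real.volume_Icc, ENNReal.ofReal_le_ofReal_iff (mul_nonneg (hv0 k).le hR0.le)] at h3
    have h4 : v k ((fractMap F)^[n k] p) * R ≤ 1 / ((k : ℝ) + 1) * R := by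
      gcongr
      exact hvle k
    simp only [δ]
    linarith [hlt k]
  have hconv := hpd hp.1 w δ hδ (Eventually.of_forall fun k => by
    rw [one_mul, hball]; exact hpI k)
  simp only [hball] at hconv
  have hSfin : volume (B ∩ Icc σ (1 - σ)) ≠ ⊤ :=
    ((measure_mono inter_subset_right).trans_lt measure_Icc_lt_top).ne
  set s := (volume (B ∩ Icc σ (1 - σ))).toReal with hs
  have hs0 : 0 < s := ENNReal.toReal_pos hS hSfin
  have hupper : ∀ k, volume (Bᶜ ∩ Icc (g k σ) (g k (1 - σ))) / volume (Icc (g k σ) (g k (1 - σ))) ≤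
      ENNReal.ofReal (1 - s / R ^ 2) := fun k => by
    have hlen : 0 < g k (1 - σ) - g k σ := sub_pos.2 (hlt k)
    obtain ⟨e1, e2⟩ := hest k
    have hadd : volume.real (B ∩ Icc (g k σ) (g k (1 - σ))) +
        volume.real (Bᶜ ∩ Icc (g k σ) (g k (1 - σ))) = g k (1 - σ) - g k σ := by
      rw [← Real.volume_real_Icc_of_le (hlt k).le,
        ← measureReal_inter_add_sdiff (s := Icc (g k σ) (g k (1 - σ))) hBm measure_Icc_lt_top.ne,
        inter_comm, sdiff_eq, inter_comm Bᶜ]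
    have hf1 : volume (B ∩ Icc (g k σ) (g k (1 - σ))) ≠ ⊤ :=
      ((measure_mono inter_subset_right).trans_lt measure_Icc_lt_top).ne
    have hf2 : volume (Bᶜ ∩ Icc (g k σ) (g k (1 - σ))) ≠ ⊤ :=
      ((measure_mono inter_subset_right).trans_lt measure_Icc_lt_top).ne
    rw [Real.volume_Icc, ENNReal.ofReal_le_ofReal_iff (mul_nonneg (hv0 k).le hR0.le)] at e1
    have e3 : v k ((fractMap F)^[n k] p) / R * s ≤ volume.real (B ∩ Icc (g k σ) (g k (1 - σ))) := by
      have := ENNReal.toReal_mono hf1 e2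
      rwa [ENNReal.toReal_mul, ENNReal.toReal_ofReal (div_nonneg (hv0 k).le hR0.le)] at this
    rw [Real.volume_Icc, ← ENNReal.ofReal_toReal hf2, ← ENNReal.ofReal_div_of_pos hlen]
    refine ENNReal.ofReal_le_ofReal ?_
    change volume.real _ / _ ≤ _
    rw [div_le_iff₀ hlen]
    -- The interval has length at most v R and its intersection with A has measure at least v s/R;
    -- the derivative v cancels.
    have e4 : s / R ^ 2 * (g k (1 - σ) - g k σ) ≤ v k ((fractMap F)^[n k] p) / R * s := by
      calc _ ≤ s / R ^ 2 * (v k ((fractMap F)^[n k] p) * R) := by gcongr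
        _ = _ := by field_simp
    linarith
  have hle := le_of_tendsto' hconv hupper
  rw [ENNReal.one_le_ofReal] at hle
  have : 0 < s / R ^ 2 := by positivity
  linarith

/-! ### Estimates at the neutral fixed point -/

/-- This integrates φ'' ≤ C x^(α−1) from 0 without assuming φ' continuous there: φ' − (C/α) x^α is
nonincreasing, and the mean value theorem supplies t in (0, s) with φ'(t) = φ(s)/s, which tends to
1. -/
theorem deriv_le_of_mul_second_deriv_le {φ φ' φ'' : ℝ → ℝ} {α C ε : ℝ} (hα : 0 < α) (hC : 0 ≤ C)
    (h00 : φ 0 = 0) (h0 : HasDerivAt φ 1 0) (h1 : ∀ x ∈ Ioo 0 ε, HasDerivAt φ (φ' x) x)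
    (h2 : ∀ x ∈ Ioo 0 ε, HasDerivAt φ' (φ'' x) x)
    (h3 : ∀ x ∈ Ioo 0 ε, x * φ'' x ≤ C * x ^ α) {x : ℝ} (hx : x ∈ Ioo 0 ε) :
    φ' x ≤ 1 + C / α * x ^ α := by
  have hder : ∀ y ∈ Ioo 0 ε, HasDerivAt (fun y => φ' y - C / α * y ^ α)
      (φ'' y - C / α * (α * y ^ (α - 1))) y := fun y hy =>
    (h2 y hy).sub ((Real.hasDerivAt_rpow_const (Or.inl hy.1.ne')).const_mul _)
  have hanti : AntitoneOn (fun y => φ' y - C / α * y ^ α) (Ioo 0 ε) := by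
    refine antitoneOn_of_deriv_nonpos (convex_Ioo 0 ε)
      (fun y hy => (hder y hy).continuousAt.continuousWithinAt)
      (fun y hy => ?_) fun y hy => ?_
    · rw [interior_Ioo] at hy
      exact (hder y hy).differentiableAt.differentiableWithinAt
    · rw [interior_Ioo] at hy
      rw [(hder y hy).deriv]
      have h4 := h3 y hy
      have h5 : y ^ (α - 1) = y ^ α / y := Real.rpow_sub_one hy.1.ne' α
      rw [h5]
      have h6 : C / α * (α * (y ^ α / y)) = C * y ^ α / y := by field_simp
      rw [h6, sub_nonpos, le_div_iff₀ hy.1, mul_comm]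
      exact h4
  have hlim : Tendsto (fun s => s⁻¹ * φ s + C / α * x ^ α) (𝓝[>] 0) (𝓝 (1 + C / α * x ^ α)) := by
    have := (hasDerivAt_iff_tendsto_slope_zero.1 h0).mono_left
      (nhdsWithin_mono 0 fun s (hs : s ∈ Ioi (0 : ℝ)) => ne_of_gt hs)
    simp only [zero_add, h00, sub_zero, smul_eq_mul] at this
    exact this.add_const _
  refine ge_of_tendsto hlim ?_
  filter_upwards [Ioo_mem_nhdsGT hx.1] with s hs
  obtain ⟨t, ht, hts⟩ := exists_hasDerivAt_eq_slope φ φ' hs.1 (fun y hy => by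
      rcases hy.1.eq_or_lt with rfl | hy0
      · exact h0.continuousAt.continuousWithinAt
      · exact (h1 y ⟨hy0, by linarith [hy.2, hs.2, hx.2]⟩).continuousAt.continuousWithinAt)
    fun y hy => h1 y ⟨hy.1, by linarith [hy.2, hs.2, hx.2]⟩
  have h4 := hanti (a := t) ⟨ht.1, by linarith [ht.2, hs.2, hx.2]⟩ hx (by linarith [ht.2, hs.2])
  simp only at h4
  rw [hts, h00, sub_zero, sub_zero, div_eq_inv_mul (φ s) s] at h4
  have h5 : 0 ≤ C / α * t ^ α := by have := ht.1; positivity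
  linarith

/-- Behaviour of a lift on one side of the neutral fixed point. -/
structure IsNeutralGerm (α C ρ : ℝ) (φ φ' φ'' : ℝ → ℝ) : Prop where
  α_pos : 0 < α
  α_lt : α < 1
  C_pos : 0 < C
  ρ_le : ρ ≤ 1 / 4
  map_zero : φ 0 = 0
  continuousWithinAt : ContinuousWithinAt φ (Ioi 0) 0
  hasDerivAt : ∀ x ∈ Ioo 0 ρ, HasDerivAt φ (φ' x) x
  hasDerivAt' : ∀ x ∈ Ioo 0 ρ, HasDerivAt φ' (φ'' x) x
  one_lt_deriv : ∀ x ∈ Ioo 0 ρ, 1 < φ' x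
  lt_map : ∀ x ∈ Ioo 0 ρ, x < φ x
  map_le : ∀ x ∈ Ioo 0 ρ, φ x ≤ 2 * x
  le_second : ∀ x ∈ Ioo 0 ρ, C⁻¹ * x ^ α ≤ x * φ'' x
  second_le : ∀ x ∈ Ioo 0 ρ, x * φ'' x ≤ C * x ^ α

namespace IsNeutralGerm

variable {α C ρ : ℝ} {φ φ' φ'' : ℝ → ℝ}

/-- The derivative of x φ' − φ is x φ'' ≥ C⁻¹ x^α, which exceeds that of the left side because 1 + α
≤ 2. At 0 it suffices that φ tends to 0 and s φ'(s) is positive. -/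
theorem mul_deriv_sub_ge (H : IsNeutralGerm α C ρ φ φ' φ'') {x : ℝ} (hx : x ∈ Ioo 0 ρ) :
    (2 * C)⁻¹ * x ^ (1 + α) ≤ x * φ' x - φ x := by
  have hC := H.C_pos
  have hα := H.α_pos
  have hα1 := H.α_lt
  have hder : ∀ y ∈ Ioo 0 ρ, HasDerivAt (fun y => y * φ' y - φ y - (2 * C)⁻¹ * y ^ (1 + α))
      ((1 * φ' y + y * φ'' y - φ' y) - (2 * C)⁻¹ * ((1 + α) * y ^ (1 + α - 1))) y := fun y hy =>
    (((hasDerivAt_id y).mul (H.hasDerivAt' y hy)).sub (H.hasDerivAt y hy)).sub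
      ((Real.hasDerivAt_rpow_const (Or.inl hy.1.ne')).const_mul _)
  have hmono : MonotoneOn (fun y => y * φ' y - φ y - (2 * C)⁻¹ * y ^ (1 + α)) (Ioo 0 ρ) := by
    refine monotoneOn_of_deriv_nonneg (convex_Ioo 0 ρ)
      (fun y hy => (hder y hy).continuousAt.continuousWithinAt)
      (fun y hy => ?_) fun y hy => ?_
    · rw [interior_Ioo] at hy
      exact (hder y hy).differentiableAt.differentiableWithinAt
    · rw [interior_Ioo] at hy
      rw [(hder y hy).deriv, add_sub_cancel_left]
      have h1 := H.le_second y hy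
      have h2 : 0 < y ^ α := Real.rpow_pos_of_pos hy.1 α
      have h3 : (2 * C)⁻¹ * ((1 + α) * y ^ α) ≤ C⁻¹ * y ^ α := by
        rw [mul_inv, ← mul_assoc]
        refine mul_le_mul_of_nonneg_right ?_ h2.le
        have : 0 < C⁻¹ := inv_pos.2 hC
        nlinarith
      linarith
  have hlim : Tendsto (fun s => -φ s - (2 * C)⁻¹ * s ^ (1 + α)) (𝓝[>] 0) (𝓝 0) := by
    have h1 : Tendsto φ (𝓝[>] 0) (𝓝 0) := by
      have := H.continuousWithinAt.tendsto
      rwa [H.map_zero] at this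
    have h2 : Tendsto (fun s : ℝ => s ^ (1 + α)) (𝓝[>] 0) (𝓝 0) := by
      have := (Real.continuousAt_rpow_const 0 (1 + α) (Or.inr (by linarith))).tendsto
      rw [Real.zero_rpow (by linarith)] at this
      exact this.mono_left nhdsWithin_le_nhds
    simpa using h1.neg.sub (h2.const_mul (2 * C)⁻¹)
  have hge : 0 ≤ x * φ' x - φ x - (2 * C)⁻¹ * x ^ (1 + α) := by
    refine le_of_tendsto hlim ?_
    filter_upwards [Ioo_mem_nhdsGT hx.1] with s hs
    have hsρ : s ∈ Ioo 0 ρ := ⟨hs.1, hs.2.trans hx.2⟩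
    have h1 := hmono hsρ hx hs.2.le
    simp only at h1
    have h2 : 0 < s * φ' s := mul_pos hs.1 (by linarith [H.one_lt_deriv s hsρ])
    linarith
  linarith

/-- Here φ' ≥ φ/x + (2C)⁻¹ x^α. The first term yields φ^(1−β)/x ≥ x^(−β), since φ > x. The second
yields the constant, since φ^(−β) ≥ (2x)^(−β) ≥ x^(−β)/2 and x^(α−β) ≥ 1. -/
theorem growth (H : IsNeutralGerm α C ρ φ φ' φ'') {β : ℝ} (hαβ : α ≤ β) (hβ : β < 1)
    {x : ℝ} (hx : x ∈ Ioo 0 ρ) : x ^ (-β) + (4 * C)⁻¹ ≤ φ x ^ (-β) * φ' x := by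
  have hC := H.C_pos
  have hα := H.α_pos
  have hρ := H.ρ_le
  have hx0 := hx.1
  have hx1 : x ≤ 1 := by linarith [hx.2]
  have hE := H.mul_deriv_sub_ge hx
  have hlt := H.lt_map x hx
  have hle := H.map_le x hx
  have hφ0 : 0 < φ x := hx0.trans hlt
  have hp : 0 < φ x ^ (-β) := Real.rpow_pos_of_pos hφ0 _
  have h1 : φ x / x + (2 * C)⁻¹ * x ^ α ≤ φ' x := by
    have e : x ^ (1 + α) = x * x ^ α := by rw [Real.rpow_add hx0, Real.rpow_one]
    rw [e] at hE
    have : φ x / x + (2 * C)⁻¹ * x ^ α = (φ x + (2 * C)⁻¹ * (x * x ^ α)) / x := by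
      field_simp
    rw [this, div_le_iff₀ hx0]
    linarith
  have h2 : x ^ (-β) ≤ φ x ^ (-β) * (φ x / x) := by
    have e1 : φ x ^ (-β) * (φ x / x) = φ x ^ (1 - β) / x := by
      rw [sub_eq_neg_add, Real.rpow_add hφ0, Real.rpow_one, mul_div_assoc]
    have e2 : x ^ (-β) = x ^ (1 - β) / x := by
      rw [sub_eq_neg_add, Real.rpow_add hx0, Real.rpow_one]; field_simp
    rw [e1, e2]
    gcongr
  have h3 : (4 * C)⁻¹ ≤ φ x ^ (-β) * ((2 * C)⁻¹ * x ^ α) := by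
    have e1 : (2 * x) ^ (-β) ≤ φ x ^ (-β) :=
      Real.rpow_le_rpow_of_nonpos hφ0 hle (by linarith)
    have e2 : (2 * x) ^ (-β) = 2 ^ (-β) * x ^ (-β) := Real.mul_rpow (by norm_num) hx0.le
    have e3 : (2 : ℝ)⁻¹ ≤ 2 ^ (-β) := by
      rw [← Real.rpow_neg_one]
      exact Real.rpow_le_rpow_of_exponent_le (by norm_num) (by linarith)
    have e4 : 1 ≤ x ^ (-β) * x ^ α := by
      rw [← Real.rpow_add hx0]
      exact Real.one_le_rpow_of_pos_of_le_one_of_nonpos hx0 hx1 (by linarith)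
    have e5 : 0 < x ^ α := Real.rpow_pos_of_pos hx0 _
    have e6 : 0 < x ^ (-β) := Real.rpow_pos_of_pos hx0 _
    have hCi : (0 : ℝ) < (2 * C)⁻¹ := by positivity
    calc (4 * C)⁻¹ = 2⁻¹ * 1 * (2 * C)⁻¹ := by field_simp; norm_num
      _ ≤ 2 ^ (-β) * (x ^ (-β) * x ^ α) * (2 * C)⁻¹ := by gcongr
      _ = (2 * x) ^ (-β) * ((2 * C)⁻¹ * x ^ α) := by rw [e2]; ring
      _ ≤ _ := by gcongr
  calc _ ≤ φ x ^ (-β) * (φ x / x) + φ x ^ (-β) * ((2 * C)⁻¹ * x ^ α) := add_le_add h2 h3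
    _ = φ x ^ (-β) * (φ x / x + (2 * C)⁻¹ * x ^ α) := by ring
    _ ≤ _ := by gcongr

/-- Both sides are compared with x^(α−1): φ'' ≤ C x^(α−1), while φ'/φ − 1/x = (x φ' − φ)/(x φ) ≥
(2C)⁻¹ x^(1+α)/(2x²). The quotient of the constants is 4C². -/
theorem distortion (H : IsNeutralGerm α C ρ φ φ' φ'') {x : ℝ} (hx : x ∈ Ioo 0 ρ) :
    |φ'' x| / φ' x ≤ 4 * C ^ 2 * (φ' x / φ x - 1 / x) := by
  have hC := H.C_pos
  have hx0 := hx.1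
  have hE := H.mul_deriv_sub_ge hx
  have hle := H.map_le x hx
  have hφ0 : 0 < φ x := hx0.trans (H.lt_map x hx)
  have h1 := H.one_lt_deriv x hx
  have hxα : 0 < x ^ α := Real.rpow_pos_of_pos hx0 _
  have h2 : 0 < φ'' x := by
    have := H.le_second x hx
    have h3 : 0 < C⁻¹ * x ^ α := by positivity
    exact pos_of_mul_pos_right (h3.trans_le this) hx0.le
  have h3 : φ'' x ≤ C * x ^ α / x := by
    rw [le_div_iff₀ hx0, mul_comm]; exact H.second_le x hx
  have e : x ^ (1 + α) = x * x ^ α := by rw [Real.rpow_add hx0, Real.rpow_one]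
  rw [e] at hE
  have h4 : (2 * C)⁻¹ * (x * x ^ α) / (x * (2 * x)) ≤ φ' x / φ x - 1 / x := by
    have e2 : φ' x / φ x - 1 / x = (x * φ' x - φ x) / (x * φ x) := by field_simp
    rw [e2]
    have : 0 ≤ (2 * C)⁻¹ * (x * x ^ α) := by positivity
    have h5 := this.trans hE
    gcongr
  calc |φ'' x| / φ' x ≤ φ'' x := by
        rw [abs_of_pos h2]; exact div_le_self h2.le h1.le
    _ ≤ C * x ^ α / x := h3
    _ = 4 * C ^ 2 * ((2 * C)⁻¹ * (x * x ^ α) / (x * (2 * x))) := by field_simp; norm_num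
    _ ≤ _ := by gcongr

end IsNeutralGerm

/-! ### Quantitative intermittent lifts are neutral expanding -/

/-- Quantitative form of the hypotheses on the lift to `[0, 1]` of an intermittent circle map. -/
structure IsIntermittentLift (d : ℕ) (α C ρ l B : ℝ) (F F' F'' : ℝ → ℝ) : Prop where
  two_le : 2 ≤ d
  α_pos : 0 < α
  α_lt : α < 1
  C_pos : 0 < C
  ρ_pos : 0 < ρ
  ρ_le : ρ ≤ 1 / 4
  one_lt : 1 < l
  continuousOn : ContinuousOn F (Icc 0 1)
  map_zero : F 0 = 0
  map_one : F 1 = d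
  hasDerivAt : ∀ x ∈ Ioo (0 : ℝ) 1, HasDerivAt F (F' x) x
  continuousOn_deriv : ContinuousOn F' (Ioo 0 1)
  one_lt_deriv : ∀ x ∈ Ioo (0 : ℝ) 1, 1 < F' x
  hasDerivAt' : ∀ x ∈ Ioo (0 : ℝ) 1, (x ∈ Icc ρ (1 - ρ) → ∀ i : ℕ, F x ≠ i) →
    HasDerivAt F' (F'' x) x
  deriv_le_left : ∀ x ∈ Ioo 0 ρ, F' x ≤ 2
  deriv_le_right : ∀ x ∈ Ioo 0 ρ, F' (1 - x) ≤ 2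
  le_second_left : ∀ x ∈ Ioo 0 ρ, C⁻¹ * x ^ α ≤ x * F'' x
  second_le_left : ∀ x ∈ Ioo 0 ρ, x * F'' x ≤ C * x ^ α
  le_second_right : ∀ x ∈ Ioo 0 ρ, C⁻¹ * x ^ α ≤ x * -F'' (1 - x)
  second_le_right : ∀ x ∈ Ioo 0 ρ, x * -F'' (1 - x) ≤ C * x ^ α
  le_deriv_middle : ∀ x ∈ Icc ρ (1 - ρ), l ≤ F' x
  abs_second_le_middle : ∀ x ∈ Icc ρ (1 - ρ), |F'' x| ≤ B

theorem lt_map_of_one_lt_deriv {φ φ' : ℝ → ℝ} {ρ : ℝ} (h00 : φ 0 = 0)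
    (hc : ContinuousOn φ (Ico 0 ρ)) (h : ∀ x ∈ Ioo 0 ρ, HasDerivAt φ (φ' x) x)
    (h1 : ∀ x ∈ Ioo 0 ρ, 1 < φ' x) {x : ℝ} (hx : x ∈ Ioo 0 ρ) : x < φ x := by
  have := (convex_Ico 0 ρ).mul_sub_lt_image_sub_of_lt_deriv (f := φ) (C := 1) hc
    (fun y hy => by
      rw [interior_Ico] at hy; exact (h y hy).differentiableAt.differentiableWithinAt)
    (fun y hy => by rw [interior_Ico] at hy; rw [(h y hy).deriv]; exact h1 y hy)
    0 ⟨le_rfl, hx.1.trans hx.2⟩ x (Ioo_subset_Ico_self hx) hx.1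
  rw [h00] at this
  linarith

theorem map_le_of_deriv_le_two {φ φ' : ℝ → ℝ} {ρ : ℝ} (h00 : φ 0 = 0)
    (hc : ContinuousOn φ (Ico 0 ρ)) (h : ∀ x ∈ Ioo 0 ρ, HasDerivAt φ (φ' x) x)
    (h1 : ∀ x ∈ Ioo 0 ρ, φ' x ≤ 2) {x : ℝ} (hx : x ∈ Ioo 0 ρ) : φ x ≤ 2 * x := by
  have := (convex_Ico 0 ρ).image_sub_le_mul_sub_of_deriv_le (f := φ) (C := 2) hc
    (fun y hy => by
      rw [interior_Ico] at hy; exact (h y hy).differentiableAt.differentiableWithinAt)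
    (fun y hy => by rw [interior_Ico] at hy; rw [(h y hy).deriv]; exact h1 y hy)
    0 ⟨le_rfl, hx.1.trans hx.2⟩ x (Ioo_subset_Ico_self hx) hx.1.le
  rw [h00] at this
  linarith

namespace IsIntermittentLift

variable {d : ℕ} {α C ρ l B : ℝ} {F F' F'' : ℝ → ℝ}

theorem germ_left (H : IsIntermittentLift d α C ρ l B F F' F'') : IsNeutralGerm α C ρ F F' F'' := by
  have hρ := H.ρ_le
  have hI : ∀ x ∈ Ioo 0 ρ, x ∈ Ioo (0 : ℝ) 1 := fun x hx => ⟨hx.1, by linarith [hx.2]⟩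
  have hder : ∀ x ∈ Ioo 0 ρ, HasDerivAt F (F' x) x := fun x hx => H.hasDerivAt x (hI x hx)
  have hone : ∀ x ∈ Ioo 0 ρ, 1 < F' x := fun x hx => H.one_lt_deriv x (hI x hx)
  have hc : ContinuousOn F (Ico 0 ρ) := H.continuousOn.mono fun x hx => ⟨hx.1, by linarith [hx.2]⟩
  exact ⟨H.α_pos, H.α_lt, H.C_pos, hρ, H.map_zero,
    (H.continuousOn 0 (left_mem_Icc.2 zero_le_one)).mono_of_mem_nhdsWithin
      (mem_of_superset (Ioo_mem_nhdsGT one_pos) Ioo_subset_Icc_self),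
    hder, fun x hx => H.hasDerivAt' x (hI x hx) fun h => absurd h.1 (not_le.2 hx.2), hone,
    fun x hx => lt_map_of_one_lt_deriv H.map_zero hc hder hone hx,
    fun x hx => map_le_of_deriv_le_two H.map_zero hc hder H.deriv_le_left hx,
    H.le_second_left, H.second_le_left⟩

theorem germ_right (H : IsIntermittentLift d α C ρ l B F F' F'') :
    IsNeutralGerm α C ρ (fun x => d - F (1 - x)) (fun x => F' (1 - x)) fun x => -F'' (1 - x) := by
  have hρ := H.ρ_le
  have hI : ∀ x ∈ Ioo 0 ρ, 1 - x ∈ Ioo (0 : ℝ) 1 := fun x hx =>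
    ⟨by linarith [hx.2], by linarith [hx.1]⟩
  have hder : ∀ x ∈ Ioo 0 ρ, HasDerivAt (fun x => d - F (1 - x)) (F' (1 - x)) x := fun x hx => by
    simpa using ((H.hasDerivAt _ (hI x hx)).comp_const_sub 1 x).const_sub (d : ℝ)
  have hone : ∀ x ∈ Ioo 0 ρ, 1 < F' (1 - x) := fun x hx => H.one_lt_deriv _ (hI x hx)
  have hc1 : ContinuousOn (fun x => d - F (1 - x)) (Icc 0 1) :=
    continuousOn_const.sub (H.continuousOn.comp (by fun_prop) fun x hx =>
      ⟨by linarith [hx.2], by linarith [hx.1]⟩)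
  have hc : ContinuousOn (fun x => d - F (1 - x)) (Ico 0 ρ) :=
    hc1.mono fun x hx => ⟨hx.1, by linarith [hx.2]⟩
  have h0 : d - F (1 - 0) = 0 := by rw [sub_zero, H.map_one, sub_self]
  exact ⟨H.α_pos, H.α_lt, H.C_pos, hρ, h0,
    (hc1 0 (left_mem_Icc.2 zero_le_one)).mono_of_mem_nhdsWithin
      (mem_of_superset (Ioo_mem_nhdsGT one_pos) Ioo_subset_Icc_self),
    hder, fun x hx => (H.hasDerivAt' _ (hI x hx) fun h =>
      absurd h.2 (by linarith [hx.2])).comp_const_sub 1 x, hone,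
    fun x hx => lt_map_of_one_lt_deriv h0 hc hder hone hx,
    fun x hx => map_le_of_deriv_le_two h0 hc hder H.deriv_le_right hx,
    H.le_second_right, H.second_le_right⟩

/-- The weight of the linear term in the distortion scale. -/
def scaleWeight (ρ l : ℝ) : ℝ := (2 / ρ + 1) / (l - 1)

/-- The bracket is the derivative of D(F − i) − D, with D the distortion scale. Near an end the germ
estimate pays through the singular term at that end, and the other differences are nonnegative. In
the middle the scale weight is chosen so that its term is at least 2/ρ + 1; this beats 1/x + 1/(1 −
x) by 1, and B bounds F''. -/
theorem infinitesimal_distortion (H : IsIntermittentLift d α C ρ l B F F' F'') {i : ℕ} (hi : i < d)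
    {x : ℝ} (hx : x ∈ Ioo (0 : ℝ) 1) (h1 : (i : ℝ) < F x) (h2 : F x < i + 1) :
    |F'' x / F' x| ≤ max (4 * C ^ 2) B * ((F' x / (F x - i) + F' x / (1 - (F x - i)) +
      scaleWeight ρ l * F' x) - (1 / x + 1 / (1 - x) + scaleWeight ρ l)) := by
  have hρ := H.ρ_pos
  have hρ' := H.ρ_le
  have hF1 := H.one_lt_deriv x hx
  have hF0 : 0 < F' x := by linarith
  have hl := H.one_lt
  have hx' : 0 < 1 - x := by linarith [hx.2]
  have hM : 0 ≤ scaleWeight ρ l := by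
    unfold scaleWeight
    have : 0 < l - 1 := by linarith
    positivity
  have hMF : scaleWeight ρ l ≤ scaleWeight ρ l * F' x := le_mul_of_one_le_right hM hF1.le
  have ha : 0 < F x - i := by linarith
  have hb : 0 < 1 - (F x - i) := by linarith
  have hK : 4 * C ^ 2 ≤ max (4 * C ^ 2) B := le_max_left _ _
  have hK0 : 0 ≤ 4 * C ^ 2 := by positivity
  rw [abs_div, abs_of_pos hF0]
  rcases lt_or_ge x ρ with hxρ | hxρ
  · have hxI : x ∈ Ioo 0 ρ := ⟨hx.1, hxρ⟩
    have hle := H.germ_left.map_le x hxI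
    have hlt := H.germ_left.lt_map x hxI
    have hi0 : i = 0 := by
      have : (i : ℝ) < 1 := by linarith
      exact Nat.lt_one_iff.1 (by exact_mod_cast this)
    subst hi0
    rw [Nat.cast_zero, sub_zero] at *
    have h3 := H.germ_left.distortion hxI
    have h4 : 1 / (1 - x) ≤ F' x / (1 - F x) := by
      gcongr
    have h5 : 0 ≤ F' x / F x - 1 / x := by
      have h6 : 0 ≤ |F'' x| / F' x := by positivity
      have hC := H.C_pos
      exact nonneg_of_mul_nonneg_right (h6.trans h3) (by positivity)
    calc _ ≤ _ := h3
      _ ≤ max (4 * C ^ 2) B * (F' x / F x - 1 / x) := by gcongr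
      _ ≤ _ := by gcongr ?_ * ?_; linarith
  rcases lt_or_ge (1 - ρ) x with hxρ2 | hxρ2
  · have hxI : 1 - x ∈ Ioo 0 ρ := ⟨hx', by linarith⟩
    have hle := H.germ_right.map_le _ hxI
    have hlt := H.germ_right.lt_map _ hxI
    have h3 := H.germ_right.distortion hxI
    simp only [sub_sub_cancel, abs_neg] at hle hlt h3
    have hi0 : (i : ℝ) + 1 = d := by
      have h6 : (d : ℝ) < (i + 1 : ℕ) + 1 := by push_cast; linarith
      have h7 : d < i + 1 + 1 := by exact_mod_cast h6
      exact_mod_cast (by omega : i + 1 = d)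
    have e1 : 1 - (F x - i) = d - F x := by linarith
    have e2 : F x - i = 1 - (d - F x) := by linarith
    rw [e1] at hb ⊢
    rw [e2] at ha ⊢
    have h4 : 1 / x ≤ F' x / (1 - (d - F x)) := by
      gcongr
      linarith
    have h5 : 0 ≤ F' x / (d - F x) - 1 / (1 - x) := by
      have h6 : 0 ≤ |F'' x| / F' x := by positivity
      have hC := H.C_pos
      exact nonneg_of_mul_nonneg_right (h6.trans h3) (by positivity)
    calc _ ≤ _ := h3
      _ ≤ max (4 * C ^ 2) B * (F' x / (d - F x) - 1 / (1 - x)) := by gcongr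
      _ ≤ _ := by gcongr ?_ * ?_; linarith
  · have hmem : x ∈ Icc ρ (1 - ρ) := ⟨hxρ, hxρ2⟩
    have hlF := H.le_deriv_middle x hmem
    have hB := H.abs_second_le_middle x hmem
    have h3 : 1 / x ≤ 1 / ρ := by gcongr
    have h4 : 1 / (1 - x) ≤ 1 / ρ := by gcongr; linarith
    have h5 : 2 / ρ + 1 ≤ scaleWeight ρ l * (F' x - 1) := by
      have h6 : 0 < l - 1 := by linarith
      have h7 : scaleWeight ρ l * (l - 1) = 2 / ρ + 1 := by
        unfold scaleWeight; field_simp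
      rw [← h7]
      gcongr
    have h6 : 0 < F' x / (F x - i) := by positivity
    have h7 : 0 < F' x / (1 - (F x - i)) := by positivity
    have h8 : 2 / ρ = 1 / ρ + 1 / ρ := by ring
    have h9 : 1 ≤ (F' x / (F x - i) + F' x / (1 - (F x - i)) +
      scaleWeight ρ l * F' x) - (1 / x + 1 / (1 - x) + scaleWeight ρ l) := by linarith
    calc |F'' x| / F' x ≤ |F'' x| := div_le_self (abs_nonneg _) hF1.le
      _ ≤ max (4 * C ^ 2) B * 1 := by rw [mul_one]; exact hB.trans (le_max_right _ _)
      _ ≤ _ := by gcongr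

theorem hasDerivAt_distortionScale {M : ℝ} {φ : ℝ → ℝ} {φ' x : ℝ} (h : HasDerivAt φ φ' x)
    (h0 : 0 < φ x) (h1 : φ x < 1) :
    HasDerivAt (fun x => distortionScale M (φ x)) (φ' / φ x + φ' / (1 - φ x) + M * φ') x := by
  have h2 : HasDerivAt (fun x => distortionScale M (φ x))
      (φ' / φ x - -φ' / (1 - φ x) + M * φ') x :=
    ((h.log h0.ne').sub ((h.const_sub 1).log (by linarith : 1 - φ x ≠ 0))).add (h.const_mul M)
  convert h2 using 1
  ring

/-- By the infinitesimal estimate, K (D(F − i) − D) + s log F' is nondecreasing for both signs s =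
±1. -/
theorem distortion (H : IsIntermittentLift d α C ρ l B F F' F'') {i : ℕ} (hi : i < d) {x y : ℝ}
    (hx : 0 < x) (hxy : x < y) (hy : y < 1) (hFx : (i : ℝ) < F x) (hFy : F y < i + 1) :
    |Real.log (F' y) - Real.log (F' x)| ≤ max (4 * C ^ 2) B *
      ((distortionScale (scaleWeight ρ l) (F y - i) - distortionScale (scaleWeight ρ l) y) -
        (distortionScale (scaleWeight ρ l) (F x - i) - distortionScale (scaleWeight ρ l) x)) := by
  set M := scaleWeight ρ l
  set K := max (4 * C ^ 2) B
  have hI : ∀ z ∈ Icc x y, z ∈ Ioo (0 : ℝ) 1 := fun z hz => ⟨by linarith [hz.1], by linarith [hz.2]⟩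
  have hFmono : MonotoneOn F (Icc x y) := by
    refine monotoneOn_of_deriv_nonneg (convex_Icc x y)
      (fun z hz => (H.hasDerivAt z (hI z hz)).continuousAt.continuousWithinAt)
      (fun z hz => ?_) fun z hz => ?_
    · exact (H.hasDerivAt z (hI z (interior_subset hz))).differentiableAt.differentiableWithinAt
    · rw [(H.hasDerivAt z (hI z (interior_subset hz))).deriv]
      linarith [H.one_lt_deriv z (hI z (interior_subset hz))]
  have hlow : ∀ z ∈ Icc x y, (i : ℝ) < F z := fun z hz =>
    hFx.trans_le (hFmono (left_mem_Icc.2 hxy.le) hz hz.1)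
  have hup : ∀ z ∈ Icc x y, F z < i + 1 := fun z hz =>
    (hFmono hz (right_mem_Icc.2 hxy.le) hz.2).trans_lt hFy
  have hder : ∀ s : ℝ, ∀ z ∈ Icc x y, HasDerivAt
      (fun z => K * (distortionScale M (F z - i) - distortionScale M z) + s * Real.log (F' z))
      (K * ((F' z / (F z - i) + F' z / (1 - (F z - i)) + M * F' z) - (1 / z + 1 / (1 - z) + M * 1)) +
        s * (F'' z / F' z)) z := fun s z hz => by
    have hzI := hI z hz
    have h1 := hlow z hz
    have h2 := hup z hz
    -- Inside a branch F takes no integer value, so points where F'' may fail to exist are not met.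
    have hF'' : HasDerivAt F' (F'' z) z := H.hasDerivAt' z hzI fun _ j hj => by
      rw [hj] at h1 h2
      have h1' : i < j := by exact_mod_cast h1
      have h2' : j < i + 1 := by exact_mod_cast h2
      omega
    have hF1 := H.one_lt_deriv z hzI
    refine ((HasDerivAt.sub (hasDerivAt_distortionScale (φ := fun z => F z - i)
      ((H.hasDerivAt z hzI).sub_const _) (by linarith) (by linarith))
      (hasDerivAt_distortionScale (φ := fun z => z) (hasDerivAt_id z) hzI.1 hzI.2)).const_mul K).add
      ((hF''.log (by linarith)).const_mul s)
  have hmono : ∀ s : ℝ, |s| = 1 → MonotoneOn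
      (fun z => K * (distortionScale M (F z - i) - distortionScale M z) + s * Real.log (F' z))
      (Icc x y) := fun s hs => by
    refine monotoneOn_of_deriv_nonneg (convex_Icc x y)
      (fun z hz => (hder s z hz).continuousAt.continuousWithinAt)
      (fun z hz => (hder s z (interior_subset hz)).differentiableAt.differentiableWithinAt)
      fun z hz => ?_
    replace hz := interior_subset hz
    rw [(hder s z hz).deriv, mul_one]
    have h1 := H.infinitesimal_distortion hi (hI z hz) (hlow z hz) (hup z hz)
    have h2 : |s * (F'' z / F' z)| = |F'' z / F' z| := by rw [abs_mul, hs, one_mul]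
    have h3 := neg_abs_le (s * (F'' z / F' z))
    rw [h2] at h3
    linarith
  have h1 := hmono 1 (by simp) (left_mem_Icc.2 hxy.le) (right_mem_Icc.2 hxy.le) hxy.le
  have h2 := hmono (-1) (by simp) (left_mem_Icc.2 hxy.le) (right_mem_Icc.2 hxy.le) hxy.le
  simp only at h1 h2
  rw [abs_le]
  constructor <;> linarith

/-- The resulting constants do not involve α, and β may be any exponent in [α, 1), so a single
choice serves a whole parameter interval. -/
theorem isNeutralExpanding (H : IsIntermittentLift d α C ρ l B F F' F'') {β : ℝ} (hαβ : α ≤ β)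
    (hβ : β < 1) :
    IsNeutralExpanding d β (max (4 * C ^ 2) B) (scaleWeight ρ l) ρ (4 * C)⁻¹ F F' where
  two_le := H.two_le
  β_pos := H.α_pos.trans_le hαβ
  β_lt := hβ
  K_nonneg := (by positivity : (0 : ℝ) ≤ 4 * C ^ 2).trans (le_max_left _ _)
  M_nonneg := by
    have h1 := H.one_lt
    have h2 := H.ρ_pos
    have : 0 < l - 1 := by linarith
    unfold scaleWeight
    positivity
  ρ_pos := H.ρ_pos
  ρ_le := H.ρ_le
  c_pos := by have := H.C_pos; positivity
  continuousOn := H.continuousOn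
  map_zero := H.map_zero
  map_one := H.map_one
  hasDerivAt := H.hasDerivAt
  continuousOn_deriv := H.continuousOn_deriv
  one_lt_deriv := H.one_lt_deriv
  deriv_le_left := H.deriv_le_left
  deriv_le_right := H.deriv_le_right
  growth_left := fun _ hx => H.germ_left.growth hαβ hβ hx
  growth_right := fun _ hx => H.germ_right.growth hαβ hβ hx
  distortion := fun _ hi _ _ hx hxy hy hFx hFy => H.distortion hi hx hxy hy hFx hFy

end IsIntermittentLift

/-! ### Uniform convergence of the circle maps and the reduction to lifts -/

theorem dist_coe_circle_le (s t : ℝ) : dist (s : S1) (t : S1) ≤ |s - t| := by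
  rw [dist_eq_norm, ← AddCircle.coe_sub]
  exact (QuotientAddGroup.norm_mk_le_norm (S := AddSubgroup.zmultiples (1 : ℝ)) (m := s - t))

/-- Joint continuity away from the fixed point, together with uniform control near it, gives
uniform convergence of lifts. -/
theorem eventually_abs_lift_sub_le {F : ℝ → ℝ → ℝ} {d : ℕ} {a b α₀ ρ : ℝ} (hα₀ : α₀ ∈ Ioo a b)
    (hρ : 0 < ρ) (hl : ∀ α ∈ Icc a b, ∀ x ∈ Icc 0 ρ, F α x ∈ Icc 0 (2 * x))
    (hr : ∀ α ∈ Icc a b, ∀ x ∈ Icc 0 ρ, d - F α (1 - x) ∈ Icc 0 (2 * x))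
    (hc : ∀ δ > 0, ContinuousOn (fun p : ℝ × ℝ => F p.1 p.2) (Icc a b ×ˢ Icc δ (1 - δ)))
    {ε : ℝ} (hε : 0 < ε) : ∀ᶠ α in 𝓝 α₀, ∀ x ∈ Icc (0 : ℝ) 1, |F α x - F α₀ x| ≤ ε := by
  -- Within δ of an end both lifts lie in a common interval of length 2δ ≤ ε. On the rest, joint
  -- continuity on a compact set is uniform.
  set δ := min ρ (ε / 2) with hδ
  have hδ0 : 0 < δ := lt_min hρ (half_pos hε)
  have hδρ : δ ≤ ρ := min_le_left _ _
  have hδε : 2 * δ ≤ ε := by have := min_le_right ρ (ε / 2); linarith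
  obtain ⟨δ', hδ', huc⟩ := Metric.uniformContinuousOn_iff.1
    ((isCompact_Icc.prod isCompact_Icc).uniformContinuousOn_of_continuous (hc δ hδ0)) ε hε
  have hα₀' : α₀ ∈ Icc a b := Ioo_subset_Icc_self hα₀
  filter_upwards [Icc_mem_nhds hα₀.1 hα₀.2, Metric.ball_mem_nhds α₀ hδ'] with α hα hball x hx
  rcases lt_or_ge x δ with h1 | h1
  · have hxρ : x ∈ Icc 0 ρ := ⟨hx.1, h1.le.trans hδρ⟩
    have e1 := hl α hα x hxρ
    have e2 := hl α₀ hα₀' x hxρ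
    rw [abs_le]
    constructor <;> linarith [e1.1, e1.2, e2.1, e2.2]
  rcases lt_or_ge (1 - δ) x with h2 | h2
  · have hxρ : 1 - x ∈ Icc 0 ρ := ⟨by linarith [hx.2], by linarith⟩
    have e1 := hr α hα _ hxρ
    have e2 := hr α₀ hα₀' _ hxρ
    rw [sub_sub_cancel] at e1 e2
    rw [abs_le]
    constructor <;> linarith [e1.1, e1.2, e2.1, e2.2]
  · have := huc (α, x) ⟨hα, h1, h2⟩ (α₀, x) ⟨hα₀', h1, h2⟩ (by
      rw [Prod.dist_eq, dist_self, max_eq_left dist_nonneg]; exact hball)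
    exact this.le

/-- The conclusion for a family of circle maps whose lifts satisfy locally uniform estimates. -/
theorem solenoid_of_isIntermittentLift (f : ℝ → S1 → S1) (F : ℝ → ℝ → ℝ) (d : ℕ)
    (hf : ∀ α ∈ Ioo (0 : ℝ) 1, f α = circleMapOf (F α))
    (hF : ∀ α₀ ∈ Ioo (0 : ℝ) 1, ∃ a b C ρ l B : ℝ, α₀ ∈ Ioo a b ∧ b < 1 ∧
      (∀ α ∈ Icc a b, ∃ F' F'', IsIntermittentLift d α C ρ l B (F α) F' F'') ∧
      ∀ δ > 0, ContinuousOn (fun p : ℝ × ℝ => F p.1 p.2) (Icc a b ×ˢ Icc δ (1 - δ))) :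
    ∃ (μ : ℝ → ProbabilityMeasure S1) (η : ℝ → ProbabilityMeasure SolidTorus),
      (∀ α ∈ Ioo (0 : ℝ) 1,
        (∀ μ' : ProbabilityMeasure S1, IsACIP (f α) μ' ↔ μ' = μ α) ∧
        (∀ η' : ProbabilityMeasure SolidTorus, IsSRB (solenoidMap (f α)) η' ↔ η' = η α) ∧
        (∀ η' : ProbabilityMeasure SolidTorus,
          (MeasurePreserving (solenoidMap (f α)) (η' : Measure SolidTorus) (η' : Measure SolidTorus) ∧
            (η' : Measure SolidTorus).map Prod.fst = (μ α : Measure S1)) ↔ η' = η α)) ∧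
      ∀ (a : ℕ → ℝ) (α₀ : ℝ), (∀ n, a n ∈ Ioo (0 : ℝ) 1) → α₀ ∈ Ioo (0 : ℝ) 1 →
        Tendsto a atTop (𝓝 α₀) →
        ∀ φ : SolidTorus → ℝ, Continuous φ →
          Tendsto (fun n => ∫ p, φ p ∂(η (a n) : Measure SolidTorus)) atTop
            (𝓝 (∫ p, φ p ∂(η α₀ : Measure SolidTorus))) := by
  have hne : ∀ α ∈ Ioo (0 : ℝ) 1, ∃ β K M ρ c F', IsNeutralExpanding d β K M ρ c (F α) F' :=
    fun α hα => by
      obtain ⟨a, b, C, ρ, l, B, hα0, hb, h, -⟩ := hF α hα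
      obtain ⟨F', F'', h'⟩ := h α (Ioo_subset_Icc_self hα0)
      exact ⟨_, _, _, _, _, _, h'.isNeutralExpanding hα0.2.le hb⟩
  refine solenoid_statistical_stability f (fun α hα => ?_) (fun α hα => ?_) (fun α₀ hα₀ => ?_)
    fun s α₀ hs hα₀ hlim => ?_
  · obtain ⟨β, K, M, ρ, c, F', h⟩ := hne α hα
    rw [hf α hα]
    exact h.continuous_circleMapOf
  · obtain ⟨β, K, M, ρ, c, F', h⟩ := hne α hα
    rw [hf α hα]
    exact h.isLebesgueErgodic
  · obtain ⟨a, b, C, ρ, l, B, hα0, hb, h, -⟩ := hF α₀ hα₀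
    -- The exponent is the right end b of the parameter interval: it is at least every α there and
    -- still less than 1, so the dominating measure is finite.
    refine ⟨dominatingMeasure d b (max (4 * C ^ 2) B) (IsIntermittentLift.scaleWeight ρ l) ρ
      (4 * C)⁻¹, isFiniteMeasure_dominatingMeasure _ _ _ _ _ hb,
      dominatingMeasure_absolutelyContinuous _ _ _ _ _ _, ?_⟩
    filter_upwards [Icc_mem_nhds hα0.1 hα0.2, Ioo_mem_nhds hα₀.1 hα₀.2] with α hα hα'
    obtain ⟨F', F'', h'⟩ := h α hα
    rw [hf α hα']
    exact (h'.isNeutralExpanding hα.2 hb).exists_acip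
  · obtain ⟨a, b, C, ρ, l, B, hα0, hb, h, hcont⟩ := hF α₀ hα₀
    have hH : ∀ α ∈ Icc a b, ∃ F', IsNeutralExpanding d b (max (4 * C ^ 2) B)
        (IsIntermittentLift.scaleWeight ρ l) ρ (4 * C)⁻¹ (F α) F' := fun α hα => by
      obtain ⟨F', F'', h'⟩ := h α hα
      exact ⟨F', h'.isNeutralExpanding hα.2 hb⟩
    obtain ⟨F₀', hF₀'⟩ := hH α₀ (Ioo_subset_Icc_self hα0)
    have hρ := hF₀'.ρ_pos
    have hρ' := hF₀'.ρ_le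
    rw [Metric.tendstoUniformly_iff]
    intro ε hε
    have hev := eventually_abs_lift_sub_le (F := F) (d := d) hα0 hρ (fun α hα x hx => ?_)
      (fun α hα x hx => ?_) hcont (half_pos hε)
    · filter_upwards [hlim.eventually hev] with n hn x
      rw [hf α₀ hα₀, hf _ (hs n)]
      have hrep : rep x ∈ Icc (0 : ℝ) 1 := by
        have := (AddCircle.equivIco (1 : ℝ) 0 x).2
        exact ⟨this.1, this.2.le.trans_eq (zero_add 1)⟩
      rw [dist_comm]
      refine (dist_coe_circle_le _ _).trans_lt ?_
      linarith [hn _ hrep]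
    · obtain ⟨F', h'⟩ := hH α hα
      exact ⟨(h'.map_mem_Icc ⟨hx.1, by linarith [hx.2]⟩).1, h'.map_le_two_mul hx⟩
    · obtain ⟨F', h'⟩ := hH α hα
      exact ⟨sub_nonneg.2 (h'.map_mem_Icc ⟨by linarith [hx.2], by linarith [hx.1]⟩).2,
        h'.sub_map_le_two_mul hx⟩

/-! ### General families of intermittent maps -/

theorem isOpen_nonIntegers : IsOpen nonIntegers :=
  Int.isClosedEmbedding_coe_real.isClosed_range.isOpen_compl

theorem mem_nonIntegers_of_mem_Ioo {x : ℝ} {n : ℤ} (h : x ∈ Ioo (n : ℝ) (n + 1)) :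
    x ∈ nonIntegers := by
  rintro ⟨m, rfl⟩
  have h1 : n < m := by exact_mod_cast h.1
  have h2 : m < n + 1 := by exact_mod_cast h.2
  omega

theorem mem_nonIntegers_of_mem_unit {x : ℝ} (h : x ∈ Ioo (0 : ℝ) 1) : x ∈ nonIntegers :=
  mem_nonIntegers_of_mem_Ioo (n := 0) (by simpa using h)

theorem neg_mem_nonIntegers_of_mem_unit {x : ℝ} (h : x ∈ Ioo (0 : ℝ) 1) : -x ∈ nonIntegers :=
  mem_nonIntegers_of_mem_Ioo (n := -1) (by
    push_cast
    exact ⟨by linarith [h.2], by linarith [h.1]⟩)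

theorem hasDerivAt_comp_neg' {φ : ℝ → ℝ} {φ' x : ℝ} (h : HasDerivAt φ φ' (-x)) :
    HasDerivAt (fun y => φ (-y)) (-φ') x := by
  have := HasDerivAt.scomp x h (hasDerivAt_neg x)
  rw [neg_one_smul] at this
  exact this

theorem hasDerivAt_neg_comp_neg {φ : ℝ → ℝ} {φ' x : ℝ} (h : HasDerivAt φ φ' (-x)) :
    HasDerivAt (fun y => -φ (-y)) φ' x := by
  have := (hasDerivAt_comp_neg' h).neg
  rw [neg_neg] at this
  exact this

namespace IsIntermittentLiftFamily

variable {d : ℕ} {F : ℝ → ℝ → ℝ}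

theorem hasDerivAt (H : IsIntermittentLiftFamily d F) {α : ℝ} (hα : α ∈ Ioo (0 : ℝ) 1) {x : ℝ}
    (hx : x ∈ nonIntegers) : HasDerivAt (F α) (deriv (F α) x) x :=
  (((H.contDiffOn α hα).contDiffAt (isOpen_nonIntegers.mem_nhds hx)).differentiableAt
    (by norm_num)).hasDerivAt

theorem contDiffOn_deriv (H : IsIntermittentLiftFamily d F) {α : ℝ} (hα : α ∈ Ioo (0 : ℝ) 1) :
    ContDiffOn ℝ 1 (deriv (F α)) nonIntegers := by
  have h := H.contDiffOn α hα
  rw [show (2 : WithTop ℕ∞) = 1 + 1 by norm_num,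
    contDiffOn_succ_iff_deriv_of_isOpen isOpen_nonIntegers] at h
  exact h.2.2

theorem hasDerivAt_deriv (H : IsIntermittentLiftFamily d F) {α : ℝ} (hα : α ∈ Ioo (0 : ℝ) 1)
    {x : ℝ} (hx : x ∈ nonIntegers) : HasDerivAt (deriv (F α)) (iteratedDeriv 2 (F α) x) x := by
  rw [iteratedDeriv_succ, iteratedDeriv_one]
  exact (((H.contDiffOn_deriv hα).contDiffAt (isOpen_nonIntegers.mem_nhds hx)).differentiableAt
    (by norm_num)).hasDerivAt

/-- Periodicity of the derivative carries the hypotheses on the left of 0 to the right end of the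
unit interval. -/
theorem deriv_one_sub (H : IsIntermittentLiftFamily d F) {α : ℝ} (hα : α ∈ Ioo (0 : ℝ) 1) (x : ℝ) :
    deriv (F α) (1 - x) = deriv (F α) (-x) := by
  have h : (fun y => F α (y + 1)) = fun y => F α y + d := funext (H.map_add_one α hα)
  have h1 := deriv_comp_add_const (F α) 1 (-x)
  rw [h, deriv_add_const] at h1
  rw [h1, neg_add_eq_sub]

theorem iteratedDeriv_one_sub (H : IsIntermittentLiftFamily d F) {α : ℝ} (hα : α ∈ Ioo (0 : ℝ) 1)
    (x : ℝ) : iteratedDeriv 2 (F α) (1 - x) = iteratedDeriv 2 (F α) (-x) := by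
  rw [iteratedDeriv_succ, iteratedDeriv_one]
  have h : (fun y => deriv (F α) (y + 1)) = deriv (F α) := funext fun y => by
    have := H.deriv_one_sub hα (-y)
    rwa [neg_neg, sub_neg_eq_add, add_comm] at this
  have h1 := deriv_comp_add_const (deriv (F α)) 1 (-x)
  rw [h] at h1
  rw [h1, neg_add_eq_sub]

theorem continuousOn_Icc (H : IsIntermittentLiftFamily d F) {α : ℝ} (hα : α ∈ Ioo (0 : ℝ) 1) :
    ContinuousOn (F α) (Icc 0 1) := by
  intro x hx
  refine ContinuousAt.continuousWithinAt ?_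
  have h0 := (H.hasDerivAt_zero α hα).continuousAt
  rcases hx.1.eq_or_lt with rfl | h1
  · exact h0
  rcases hx.2.eq_or_lt with rfl | h2
  · have h : F α = fun y => F α (y - 1) + d := funext fun y => by
      rw [← H.map_add_one α hα, sub_add_cancel]
    rw [h]
    refine ContinuousAt.add ?_ continuousAt_const
    refine ContinuousAt.comp (f := fun y : ℝ => y - 1) (g := F α) ?_ (by fun_prop)
    simpa using h0
  · exact (H.hasDerivAt hα (mem_nonIntegers_of_mem_unit ⟨h1, h2⟩)).continuousAt

/-- On a compact parameter interval C comes from the neutral condition, while l and B are the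
minimum of F' and the maximum of |F''| over a compact set away from the fixed point, attained by
joint continuity. -/
theorem exists_isIntermittentLift (hd : 2 ≤ d) (H : IsIntermittentLiftFamily d F) {α₀ : ℝ}
    (hα₀ : α₀ ∈ Ioo (0 : ℝ) 1) : ∃ a b C ρ l B : ℝ, α₀ ∈ Ioo a b ∧ b < 1 ∧
      (∀ α ∈ Icc a b, ∃ F' F'', IsIntermittentLift d α C ρ l B (F α) F' F'') ∧
      ∀ δ > 0, ContinuousOn (fun p : ℝ × ℝ => F p.1 p.2) (Icc a b ×ˢ Icc δ (1 - δ)) := by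
  obtain ⟨a, ha0, haα⟩ := exists_between hα₀.1
  obtain ⟨b, hαb, hb1⟩ := exists_between hα₀.2
  obtain ⟨C, hC1, ε, hε, hneut⟩ := H.neutral a b ha0 hb1
  have hC0 : 0 < C := by linarith
  have haC : 0 < a / C := by positivity
  -- The last entry makes C/α · x^α ≤ 1 for x < ρ and hence F' ≤ 2 near the ends; ε/2 keeps ρ inside
  -- the range of the neutral condition.
  set ρ := min (1 / 4) (min (ε / 2) ((a / C) ^ (1 / a))) with hρdef
  have hρ : 0 < ρ := by positivity
  have hρ1 : ρ ≤ 1 / 4 := min_le_left _ _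
  have hρ2 : ρ < ε := ((min_le_right _ _).trans (min_le_left _ _)).trans_lt (half_lt_self hε)
  have hρ3 : ρ ^ a ≤ a / C := by
    have h1 : ρ ≤ (a / C) ^ (1 / a) := (min_le_right _ _).trans (min_le_right _ _)
    calc ρ ^ a ≤ ((a / C) ^ (1 / a)) ^ a := Real.rpow_le_rpow hρ.le h1 ha0.le
      _ = a / C := by
        rw [← Real.rpow_mul haC.le, one_div_mul_cancel ha0.ne', Real.rpow_one]
  have hI : ∀ α ∈ Icc a b, α ∈ Ioo (0 : ℝ) 1 := fun α hα =>
    ⟨ha0.trans_le hα.1, hα.2.trans_lt hb1⟩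
  have hmid : ∀ δ > 0, Icc a b ×ˢ Icc δ (1 - δ) ⊆ Ioo (0 : ℝ) 1 ×ˢ nonIntegers :=
    fun δ hδ p hp => ⟨hI _ hp.1, mem_nonIntegers_of_mem_unit
      ⟨by linarith [hp.2.1], by linarith [hp.2.2]⟩⟩
  have hcpt : IsCompact (Icc a b ×ˢ Icc ρ (1 - ρ)) := isCompact_Icc.prod isCompact_Icc
  have hnonempty : (Icc a b ×ˢ Icc ρ (1 - ρ)).Nonempty :=
    ⟨(α₀, ρ), ⟨haα.le, hαb.le⟩, le_rfl, by linarith⟩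
  obtain ⟨p₁, hp₁, hmin⟩ := hcpt.exists_isMinOn hnonempty
    ((H.continuous_param 1 (by norm_num)).mono (hmid ρ hρ))
  obtain ⟨p₂, hp₂, hmax⟩ := hcpt.exists_isMaxOn hnonempty
    ((H.continuous_param 2 le_rfl).mono (hmid ρ hρ)).abs
  have hsmall : ∀ α ∈ Icc a b, ∀ x ∈ Ioo 0 ρ, C / α * x ^ α ≤ 1 := fun α hα x hx => by
    have hx1 : x ≤ 1 := by linarith [hx.2]
    have h1 : x ^ α ≤ a / C := calc
      x ^ α ≤ x ^ a := Real.rpow_le_rpow_of_exponent_ge hx.1 hx1 hα.1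
      _ ≤ ρ ^ a := Real.rpow_le_rpow hx.1.le hx.2.le ha0.le
      _ ≤ a / C := hρ3
    calc C / α * x ^ α ≤ C / a * (a / C) := by
          have := hα.1
          have := Real.rpow_nonneg hx.1.le α
          gcongr
      _ = 1 := by field_simp
  refine ⟨a, b, C, ρ, deriv (F p₁.1) p₁.2, |iteratedDeriv 2 (F p₂.1) p₂.2|, ⟨haα, hαb⟩, hb1,
    fun α hα => ⟨deriv (F α), iteratedDeriv 2 (F α), ?_⟩, fun δ hδ => ?_⟩
  · have hα' := hI α hα
    have hone := H.map_add_one α hα' 0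
    rw [zero_add, H.map_zero α hα', zero_add] at hone
    have hunit : ∀ x ∈ Ioo 0 ρ, x ∈ Ioo (0 : ℝ) 1 := fun x hx => ⟨hx.1, by linarith [hx.2]⟩
    have hnr : ∀ x ∈ Ioo 0 ρ, C⁻¹ * x ^ α ≤ x * iteratedDeriv 2 (F α) x ∧
        x * iteratedDeriv 2 (F α) x ≤ C * x ^ α := fun x hx => by
      have := hneut α hα x (abs_pos.2 hx.1.ne') (by rw [abs_of_pos hx.1]; linarith [hx.2])
      rwa [abs_of_pos hx.1] at this
    have hnl : ∀ x ∈ Ioo 0 ρ, C⁻¹ * x ^ α ≤ x * -iteratedDeriv 2 (F α) (-x) ∧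
        x * -iteratedDeriv 2 (F α) (-x) ≤ C * x ^ α := fun x hx => by
      have := hneut α hα (-x) (abs_pos.2 (neg_ne_zero.2 hx.1.ne'))
        (by rw [abs_neg, abs_of_pos hx.1]; linarith [hx.2])
      rwa [abs_neg, abs_of_pos hx.1, neg_mul_comm] at this
    refine ⟨hd, hα'.1, hα'.2, hC0, hρ, hρ1,
      H.one_lt_deriv _ (hmid ρ hρ hp₁).1 _ (hmid ρ hρ hp₁).2, H.continuousOn_Icc hα',
      H.map_zero α hα', hone, fun x hx => H.hasDerivAt hα' (mem_nonIntegers_of_mem_unit hx),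
      (H.contDiffOn_deriv hα').continuousOn.mono fun x hx => mem_nonIntegers_of_mem_unit hx,
      fun x hx => H.one_lt_deriv α hα' x (mem_nonIntegers_of_mem_unit hx),
      fun x hx _ => H.hasDerivAt_deriv hα' (mem_nonIntegers_of_mem_unit hx),
      fun x hx => ?_, fun x hx => ?_, fun x hx => (hnr x hx).1, fun x hx => (hnr x hx).2,
      fun x hx => ?_, fun x hx => ?_, fun x hx => ?_, fun x hx => ?_⟩
    · have := deriv_le_of_mul_second_deriv_le hα'.1 hC0.le (H.map_zero α hα')
        (H.hasDerivAt_zero α hα') (fun y hy => H.hasDerivAt hα' (mem_nonIntegers_of_mem_unit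
          (hunit y hy))) (fun y hy => H.hasDerivAt_deriv hα' (mem_nonIntegers_of_mem_unit
          (hunit y hy))) (fun y hy => (hnr y hy).2) hx
      linarith [hsmall α hα x hx]
    -- The left side of 0 is reduced to the right side by passing to y ↦ −F(−y).
    · rw [H.deriv_one_sub hα']
      have h0 : HasDerivAt (fun y => -F α (-y)) 1 0 := by
        have h1 : HasDerivAt (F α) 1 (-0) := by rw [neg_zero]; exact H.hasDerivAt_zero α hα'
        exact hasDerivAt_neg_comp_neg h1
      have h1 : ∀ y ∈ Ioo 0 ρ, HasDerivAt (fun y => -F α (-y)) (deriv (F α) (-y)) y := fun y hy =>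
        hasDerivAt_neg_comp_neg (H.hasDerivAt hα' (neg_mem_nonIntegers_of_mem_unit
          (hunit y hy)))
      have h2 : ∀ y ∈ Ioo 0 ρ, HasDerivAt (fun y => deriv (F α) (-y))
          (-iteratedDeriv 2 (F α) (-y)) y := fun y hy =>
        hasDerivAt_comp_neg' (H.hasDerivAt_deriv hα' (neg_mem_nonIntegers_of_mem_unit
          (hunit y hy)))
      have := deriv_le_of_mul_second_deriv_le hα'.1 hC0.le
        (by rw [neg_zero, H.map_zero α hα', neg_zero]) h0 h1 h2 (fun y hy => (hnl y hy).2) hx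
      linarith [hsmall α hα x hx]
    · rw [H.iteratedDeriv_one_sub hα']; exact (hnl x hx).1
    · rw [H.iteratedDeriv_one_sub hα']; exact (hnl x hx).2
    · have := isMinOn_iff.1 hmin (α, x) ⟨hα, hx⟩
      simpa only [iteratedDeriv_one] using this
    · exact isMaxOn_iff.1 hmax (α, x) ⟨hα, hx⟩
  · simpa only [iteratedDeriv_zero] using (H.continuous_param 0 (by norm_num)).mono (hmid δ hδ)

end IsIntermittentLiftFamily

/-! ### The explicit family -/

/-- The left branch of the explicit intermittent map. -/
def explicitBranch (α x : ℝ) : ℝ := x * (1 + 2 ^ α * x ^ α)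

/-- The derivative of `explicitBranch`. -/
def explicitBranchDeriv (α x : ℝ) : ℝ := 1 + 2 ^ α * (1 + α) * x ^ α

/-- The second derivative of `explicitBranch`. -/
def explicitBranchDeriv₂ (α x : ℝ) : ℝ := 2 ^ α * (1 + α) * α * x ^ (α - 1)

/-- The lift of the explicit intermittent map. -/
def explicitLift (α x : ℝ) : ℝ :=
  explicitBranch α (min x (1 / 2)) + (1 - explicitBranch α (min (1 - x) (1 / 2)))

theorem explicitBranch_half (α : ℝ) : explicitBranch α (1 / 2) = 1 := by
  rw [explicitBranch, ← Real.mul_rpow (by norm_num) (by norm_num)]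
  norm_num

theorem explicitLift_of_le {α x : ℝ} (hx : x ≤ 1 / 2) : explicitLift α x = explicitBranch α x := by
  rw [explicitLift, min_eq_left hx, min_eq_right (by linarith), explicitBranch_half, sub_self,
    add_zero]

theorem explicitLift_of_ge {α x : ℝ} (hx : 1 / 2 ≤ x) :
    explicitLift α x = 2 - explicitBranch α (1 - x) := by
  rw [explicitLift, min_eq_right hx, min_eq_left (by linarith), explicitBranch_half]
  ring

theorem explicitMap_eq (α : ℝ) : explicitMap α = circleMapOf (explicitLift α) := by
  funext x
  unfold explicitMap circleMapOf
  have hr : rep x < 1 := (AddCircle.equivIco (1 : ℝ) 0 x).2.2.trans_eq (zero_add 1)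
  set r := rep x
  by_cases h : r < 1 / 2
  · simp only [h, if_true, explicitLift_of_le h.le, explicitBranch]
  · simp only [h, if_false]
    -- On the right half the continuous lift exceeds the given formula by 1, which disappears modulo
    -- 1.
    rw [explicitLift_of_ge (not_lt.1 h), ← coe_add_natCast _ 1, explicitBranch,
      Real.rpow_add_one (by linarith)]
    congr 1
    push_cast
    ring

theorem hasDerivAt_explicitBranch {α x : ℝ} (hx : 0 < x) :
    HasDerivAt (explicitBranch α) (explicitBranchDeriv α x) x := by
  have h : HasDerivAt (fun y : ℝ => y * (1 + 2 ^ α * y ^ α))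
      (1 * (1 + 2 ^ α * x ^ α) + x * (2 ^ α * (α * x ^ (α - 1)))) x :=
    (hasDerivAt_id x).mul
      (((Real.hasDerivAt_rpow_const (Or.inl hx.ne')).const_mul ((2 : ℝ) ^ α)).const_add 1)
  have e : explicitBranchDeriv α x =
      1 * (1 + 2 ^ α * x ^ α) + x * (2 ^ α * (α * x ^ (α - 1))) := by
    unfold explicitBranchDeriv
    rw [Real.rpow_sub_one hx.ne']
    field_simp
    ring
  rw [e]
  exact h

theorem hasDerivAt_explicitBranchDeriv {α x : ℝ} (hx : 0 < x) :
    HasDerivAt (explicitBranchDeriv α) (explicitBranchDeriv₂ α x) x := by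
  have h : HasDerivAt (fun y : ℝ => 1 + 2 ^ α * (1 + α) * y ^ α)
      (2 ^ α * (1 + α) * (α * x ^ (α - 1))) x :=
    ((Real.hasDerivAt_rpow_const (Or.inl hx.ne')).const_mul _).const_add 1
  have e : explicitBranchDeriv₂ α x = 2 ^ α * (1 + α) * (α * x ^ (α - 1)) := by
    unfold explicitBranchDeriv₂
    ring
  rw [e]
  exact h

theorem hasDerivAt_explicitLift {α x : ℝ} (hx : x ∈ Ioo (0 : ℝ) 1) :
    HasDerivAt (explicitLift α) (explicitBranchDeriv α (min x (1 - x))) x := by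
  have hx' : 0 < 1 - x := by linarith [hx.2]
  have hl : HasDerivAt (explicitBranch α) (explicitBranchDeriv α x) x :=
    hasDerivAt_explicitBranch hx.1
  have hr : HasDerivAt (fun y => 2 - explicitBranch α (1 - y)) (explicitBranchDeriv α (1 - x)) x := by
    simpa using ((hasDerivAt_explicitBranch hx').comp_const_sub 1 x).const_sub 2
  rcases lt_trichotomy x (1 / 2) with h | h | h
  · rw [min_eq_left (by linarith)]
    refine hl.congr_of_eventuallyEq ?_
    filter_upwards [Iio_mem_nhds h] with y hy using explicitLift_of_le (le_of_lt hy)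
  -- At the midpoint the two branches have the same slope, so the one-sided derivatives glue.
  · have e : 1 - x = x := by linarith
    rw [e, min_self]
    rw [e] at hr
    rw [← hasDerivWithinAt_univ, ← Iic_union_Ici (a := x)]
    exact (hl.hasDerivWithinAt.congr (fun y hy => explicitLift_of_le (h ▸ hy))
      (explicitLift_of_le h.le)).union (hr.hasDerivWithinAt.congr
        (fun y hy => explicitLift_of_ge (h ▸ hy)) (explicitLift_of_ge h.ge))
  · rw [min_eq_right (by linarith)]
    refine hr.congr_of_eventuallyEq ?_
    filter_upwards [Ioi_mem_nhds h] with y hy using explicitLift_of_ge (le_of_lt hy)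

theorem hasDerivAt_explicitLift_deriv {α x : ℝ} (hx : x ∈ Ioo (0 : ℝ) 1) (hne : x ≠ 1 / 2) :
    HasDerivAt (fun x => explicitBranchDeriv α (min x (1 - x)))
      (if x < 1 / 2 then explicitBranchDeriv₂ α x else -explicitBranchDeriv₂ α (1 - x)) x := by
  rcases hne.lt_or_gt with h | h
  · rw [if_pos h]
    refine (hasDerivAt_explicitBranchDeriv hx.1).congr_of_eventuallyEq ?_
    filter_upwards [Iio_mem_nhds h] with y hy
    rw [min_eq_left (by linarith [show y < 1 / 2 from hy])]
  · rw [if_neg h.not_gt]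
    refine ((hasDerivAt_explicitBranchDeriv
      (by linarith [hx.2] : 0 < 1 - x)).comp_const_sub 1 x).congr_of_eventuallyEq ?_
    filter_upwards [Ioi_mem_nhds h] with y hy
    rw [min_eq_right (by linarith [show 1 / 2 < y from hy])]

theorem continuous_explicitLift {α : ℝ} (hα : 0 ≤ α) : Continuous (explicitLift α) := by
  have h : Continuous (explicitBranch α) :=
    continuous_id.mul (continuous_const.add (continuous_const.mul
      (Real.continuous_rpow_const hα)))
  exact (h.comp (by fun_prop)).add (continuous_const.sub (h.comp (by fun_prop)))

theorem continuousOn_explicitLift_joint {a b δ : ℝ} (hδ : 0 < δ) :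
    ContinuousOn (fun p : ℝ × ℝ => explicitLift p.1 p.2) (Icc a b ×ˢ Icc δ (1 - δ)) := by
  have h : ContinuousOn (fun p : ℝ × ℝ => explicitBranch p.1 p.2) (univ ×ˢ Ioi 0) := by
    refine continuousOn_snd.mul (continuousOn_const.add (ContinuousOn.mul ?_ ?_))
    · exact ContinuousOn.rpow continuousOn_const continuousOn_fst fun _ _ => Or.inl two_ne_zero
    · exact ContinuousOn.rpow continuousOn_snd continuousOn_fst fun p hp => Or.inl (ne_of_gt hp.2)
  have h1 : ContinuousOn (fun p : ℝ × ℝ => explicitBranch p.1 (min p.2 (1 / 2)))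
      (Icc a b ×ˢ Icc δ (1 - δ)) :=
    h.comp (f := fun p : ℝ × ℝ => (p.1, min p.2 (1 / 2))) (by fun_prop) fun p hp =>
      ⟨mem_univ _, lt_min (hδ.trans_le hp.2.1) (by norm_num)⟩
  have h2 : ContinuousOn (fun p : ℝ × ℝ => explicitBranch p.1 (min (1 - p.2) (1 / 2)))
      (Icc a b ×ˢ Icc δ (1 - δ)) :=
    h.comp (f := fun p : ℝ × ℝ => (p.1, min (1 - p.2) (1 / 2))) (by fun_prop) fun p hp =>
      ⟨mem_univ _, lt_min (show (0 : ℝ) < 1 - p.2 by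
        linarith [show p.2 ≤ 1 - δ from hp.2.2]) (by norm_num)⟩
  exact h1.add (continuousOn_const.sub h2)

theorem explicit_coeff_bounds {α : ℝ} (hα : α ∈ Ioo (0 : ℝ) 1) :
    1 ≤ (2 : ℝ) ^ α * (1 + α) ∧ (2 : ℝ) ^ α * (1 + α) ≤ 4 := by
  have h1 : 1 ≤ (2 : ℝ) ^ α := Real.one_le_rpow (by norm_num) hα.1.le
  have h2 : (2 : ℝ) ^ α ≤ 2 := by
    calc (2 : ℝ) ^ α ≤ 2 ^ (1 : ℝ) := Real.rpow_le_rpow_of_exponent_le (by norm_num) hα.2.le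
      _ = 2 := Real.rpow_one 2
  constructor <;> nlinarith [hα.1, hα.2]

/-- Let κ = 2^α (1 + α), which lies in [1, 4]. Then a ≤ κα ≤ 4 accounts for C. The choice ρ^a = 1/4
gives κ x^α ≤ 1, hence slope at most 2 near the ends. In the middle x^α ≥ x ≥ ρ gives the lower
slope bound 1 + ρ, and x^(α−1) ≤ 1/x gives the bound 4/ρ on the second derivative. -/
theorem explicit_isIntermittentLift {a b α : ℝ} (ha0 : 0 < a) (hb1 : b < 1) (hα : α ∈ Icc a b) :
    IsIntermittentLift 2 α (max 4 (1 / a)) ((1 / 4) ^ (1 / a)) (1 + (1 / 4) ^ (1 / a))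
      (4 / (1 / 4) ^ (1 / a)) (explicitLift α) (fun x => explicitBranchDeriv α (min x (1 - x)))
      fun x => if x < 1 / 2 then explicitBranchDeriv₂ α x else -explicitBranchDeriv₂ α (1 - x) := by
  have hα' : α ∈ Ioo (0 : ℝ) 1 := ⟨ha0.trans_le hα.1, hα.2.trans_lt hb1⟩
  have ha1 : a < 1 := hα.1.trans_lt hα'.2
  obtain ⟨hc1, hc4⟩ := explicit_coeff_bounds hα'
  set κ := (2 : ℝ) ^ α * (1 + α) with hκ
  set C := max 4 (1 / a)
  have hC4 : 4 ≤ C := le_max_left _ _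
  have hCa : C⁻¹ ≤ a := by
    rw [inv_le_comm₀ (by linarith) ha0, ← one_div]; exact le_max_right _ _
  set ρ : ℝ := (1 / 4) ^ (1 / a) with hρdef
  have hρ : 0 < ρ := by positivity
  have hρ1 : ρ ≤ 1 / 4 := by
    calc ρ ≤ (1 / 4 : ℝ) ^ (1 : ℝ) := Real.rpow_le_rpow_of_exponent_ge (by norm_num) (by norm_num)
          ((one_le_div ha0).2 ha1.le)
      _ = 1 / 4 := Real.rpow_one _
  have hρa : ρ ^ a = 1 / 4 := by
    rw [hρdef, ← Real.rpow_mul (by norm_num), one_div_mul_cancel ha0.ne', Real.rpow_one]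
  have hd2 : ∀ x, explicitBranchDeriv₂ α x = κ * α * x ^ (α - 1) := fun x => rfl
  have hd1 : ∀ x, explicitBranchDeriv α x = 1 + κ * x ^ α := fun x => rfl
  have hle2 : ∀ x ∈ Ioo 0 ρ, explicitBranchDeriv α x ≤ 2 := fun x hx => by
    have h1 : x ^ α ≤ 1 / 4 := calc
      x ^ α ≤ x ^ a := Real.rpow_le_rpow_of_exponent_ge hx.1 (by linarith [hx.2]) hα.1
      _ ≤ ρ ^ a := Real.rpow_le_rpow hx.1.le hx.2.le ha0.le
      _ = 1 / 4 := hρa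
    have h2 := Real.rpow_nonneg hx.1.le α
    rw [hd1]
    nlinarith
  have hmul : ∀ x ∈ Ioo 0 ρ, x * explicitBranchDeriv₂ α x = κ * α * x ^ α := fun x hx => by
    have := hx.1.ne'
    rw [hd2, Real.rpow_sub_one this]
    field_simp
  have hlow : ∀ x ∈ Ioo 0 ρ, C⁻¹ * x ^ α ≤ x * explicitBranchDeriv₂ α x := fun x hx => by
    have h2 := Real.rpow_nonneg hx.1.le α
    rw [hmul x hx]
    refine mul_le_mul_of_nonneg_right ?_ h2
    nlinarith [hα.1]
  have hupp : ∀ x ∈ Ioo 0 ρ, x * explicitBranchDeriv₂ α x ≤ C * x ^ α := fun x hx => by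
    have h2 := Real.rpow_nonneg hx.1.le α
    rw [hmul x hx]
    refine mul_le_mul_of_nonneg_right ?_ h2
    nlinarith [hα'.1, hα'.2]
  have hlmid : ∀ x, ρ ≤ x → x ≤ 1 → 1 + ρ ≤ explicitBranchDeriv α x := fun x h1 h2 => by
    have h3 : x ≤ x ^ α := by
      calc x = x ^ (1 : ℝ) := (Real.rpow_one x).symm
        _ ≤ x ^ α := Real.rpow_le_rpow_of_exponent_ge (by linarith) h2 hα'.2.le
    rw [hd1]
    nlinarith
  have hBmid : ∀ x, ρ ≤ x → x ≤ 1 → |explicitBranchDeriv₂ α x| ≤ 4 / ρ := fun x h1 h2 => by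
    have hx0 : 0 < x := hρ.trans_le h1
    have h3 : x ^ (α - 1) ≤ 1 / ρ := calc
      x ^ (α - 1) ≤ x ^ (-1 : ℝ) := Real.rpow_le_rpow_of_exponent_ge hx0 h2 (by linarith [hα'.1])
      _ = 1 / x := by rw [Real.rpow_neg_one, one_div]
      _ ≤ 1 / ρ := by gcongr
    have h4 := Real.rpow_nonneg hx0.le (α - 1)
    have h5 : 0 ≤ κ * α := mul_nonneg (by linarith) hα'.1.le
    have h6 : κ * α ≤ 4 := by nlinarith [hα'.1, hα'.2]
    rw [hd2, abs_of_nonneg (mul_nonneg h5 h4), div_eq_mul_one_div]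
    exact mul_le_mul h6 h3 h4 (by norm_num)
  have hsub : ∀ x ∈ Ioo 0 ρ, x ≤ 1 - x ∧ x < 1 / 2 := fun x hx =>
    ⟨by linarith [hx.2], by linarith [hx.2]⟩
  have hnot : ∀ x ∈ Ioo 0 ρ, ¬ 1 - x < 1 / 2 := fun x hx => by linarith [hx.2]
  refine ⟨le_rfl, hα'.1, hα'.2, by linarith, hρ, hρ1, by linarith,
    (continuous_explicitLift hα'.1.le).continuousOn, ?_, ?_,
    fun x hx => hasDerivAt_explicitLift hx, fun x hx => ?_, fun x hx => ?_, fun x hx hne => ?_,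
    fun x hx => ?_, fun x hx => ?_, fun x hx => ?_, fun x hx => ?_, fun x hx => ?_, fun x hx => ?_,
    fun x hx => ?_, fun x hx => ?_⟩
  · rw [explicitLift_of_le (by norm_num), explicitBranch, zero_mul]
  · rw [explicitLift_of_ge (by norm_num), explicitBranch]; norm_num
  · have hmin : 0 < min x (1 - x) := lt_min hx.1 (by linarith [hx.2])
    exact (ContinuousAt.comp (f := fun x : ℝ => min x (1 - x)) (g := explicitBranchDeriv α)
      (hasDerivAt_explicitBranchDeriv hmin).continuousAt (by fun_prop)).continuousWithinAt
  · have h1 : 0 < min x (1 - x) ^ α := Real.rpow_pos_of_pos (lt_min hx.1 (by linarith [hx.2])) _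
    rw [hd1]
    have : 0 < κ * min x (1 - x) ^ α := mul_pos (by linarith) h1
    linarith
  -- The second derivative changes sign abruptly at 1/2, but the lift equals 1 there: the point
  -- separates two branches and is exempt.
  · refine hasDerivAt_explicitLift_deriv hx fun h => ?_
    refine hne ⟨by linarith, by linarith⟩ 1 ?_
    rw [explicitLift_of_le h.le, h, explicitBranch_half, Nat.cast_one]
  · rw [min_eq_left (hsub x hx).1]; exact hle2 x hx
  · rw [sub_sub_cancel, min_eq_right (hsub x hx).1]; exact hle2 x hx
  · rw [if_pos (hsub x hx).2]; exact hlow x hx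
  · rw [if_pos (hsub x hx).2]; exact hupp x hx
  · rw [if_neg (hnot x hx), neg_neg, sub_sub_cancel]; exact hlow x hx
  · rw [if_neg (hnot x hx), neg_neg, sub_sub_cancel]; exact hupp x hx
  · exact hlmid _ (le_min hx.1 (by linarith [hx.2])) ((min_le_left _ _).trans (by linarith [hx.2]))
  · split_ifs with h
    · exact hBmid x hx.1 (by linarith)
    · rw [abs_neg]; exact hBmid _ (by linarith [hx.2]) (by linarith [hx.1])

end

theorem theoremB (f : ℝ → S1 → S1)
    (hf : (∃ d : ℕ, 2 ≤ d ∧ IsIntermittentFamily d f) ∨ (∀ α ∈ Ioo (0 : ℝ) 1, f α = explicitMap α)) :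
    ∃ (μ : ℝ → ProbabilityMeasure S1) (η : ℝ → ProbabilityMeasure SolidTorus),
      (∀ α ∈ Ioo (0 : ℝ) 1,
        (∀ μ' : ProbabilityMeasure S1, IsACIP (f α) μ' ↔ μ' = μ α) ∧
        (∀ η' : ProbabilityMeasure SolidTorus, IsSRB (solenoidMap (f α)) η' ↔ η' = η α) ∧
        (∀ η' : ProbabilityMeasure SolidTorus,
          (MeasurePreserving (solenoidMap (f α)) (η' : Measure SolidTorus) (η' : Measure SolidTorus) ∧
            (η' : Measure SolidTorus).map Prod.fst = (μ α : Measure S1)) ↔ η' = η α)) ∧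
      ∀ (a : ℕ → ℝ) (α₀ : ℝ), (∀ n, a n ∈ Ioo (0 : ℝ) 1) → α₀ ∈ Ioo (0 : ℝ) 1 →
        Tendsto a atTop (𝓝 α₀) →
        ∀ φ : SolidTorus → ℝ, Continuous φ →
          Tendsto (fun n => ∫ p, φ p ∂(η (a n) : Measure SolidTorus)) atTop
            (𝓝 (∫ p, φ p ∂(η α₀ : Measure SolidTorus))) := by
  rcases hf with ⟨d, hd, F, hF, hfF⟩ | hf
  · exact solenoid_of_isIntermittentLift f F d hfF fun α₀ hα₀ => hF.exists_isIntermittentLift hd hα₀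
  · refine solenoid_of_isIntermittentLift f explicitLift 2
      (fun α hα => (hf α hα).trans (explicitMap_eq α)) fun α₀ hα₀ => ?_
    obtain ⟨a, ha0, haα⟩ := exists_between hα₀.1
    obtain ⟨b, hαb, hb1⟩ := exists_between hα₀.2
    exact ⟨a, b, _, _, _, _, ⟨haα, hαb⟩, hb1,
      fun α hα => ⟨_, _, explicit_isIntermittentLift ha0 hb1 hα⟩,
      fun δ hδ => continuousOn_explicitLift_joint hδ⟩
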